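/- Let $(\Omega,\mathcal F,(\mathcal F_t)_{t\ge 0},\mathbb P)$ be a filtered probability space carrying two independent standard Brownian motions $B$ and $W$ (each a Brownian motion relative to $(\mathcal F_t)$). Let $H\in(0,1)$ and let $B^H$ be the fractional Brownian motion with Hurst exponent $H$ generated by $B$, that is, the almost surely continuous process with $B^H_t=\int_0^t K_H(t,s)\,dB_s$ a.s. for every $t\ge 0$, where $$K_H(t,s)=c_H\,(t-s)^{H-\frac12}\,F\!\left(H-\tfrac12,\tfrac12-H,H+\tfrac12;1-\tfrac ts\right)\mathbf 1_{[0,t]}(s),\qquad c_H=\left[\frac{2H\,\Gamma(\frac32-H)}{\Gamma(2-2H)\,\Gamma(H+\frac12)}\right]^{1/2},$$ is the Molchan–Golosov kernel and $F$ is the Gauss hypergeometric function (continued analytically to $(-\infty,1)$). Let $\nu\neq0$, $\rho\in(-1,1)$, $\bar\rho=\sqrt{1-\rho^2}$, $x_0\in\mathbb R$, $y_0>0$, put $v_t=\int_0^t e^{2\nu B^H_s}\,ds$, and let $(X_t,Y_t)$ be the lognormal fSABR model $$X_t=x_0+y_0\int_0^t e^{\nu B^H_s}\,(\rho\,dB_s+\bar\rho\,dW_s)-\frac{y_0^2}{2}\,v_t,\qquad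 Y_t=y_0\,e^{\nu B^H_t}$$ (equalities a.s. for each $t$; the stochastic integrals are Itô integrals). Then for every $t>0$ the law of $(X_t,Y_t)$ is absolutely continuous with respect to Lebesgue measure on $\mathbb R^2$. Moreover, its density $p(t;x,y)$ vanishes for almost every $(x,y)$ with $y\le 0$, and for almost every $(x,y)$ with $y>0$ it has the bridge representation $$p(t;x,y)=\frac{1}{y\sqrt{2\pi\nu^2t^{2H}}}\,e^{-\frac{(\ln(y/y_0))^2}{2\nu^2t^{2H}}}\times\frac1{2\pi}\int_{\mathbb R}\mathbb E\!\left[\left.e^{i\left(x-x_0-\rho y_0\int_0^t e^{\nu B^H_s}dB_s+\frac{y_0^2v_t}{2}\right)\xi}\;e^{-\frac{\bar\rho^2y_0^2v_t\xi^2}{2}}\,\right|\,B^H_t=\frac{\ln(y/y_0)}{\nu}\right]d\xi,$$ where the integral over $\xi$ converges absolutely and the conditional expectations are computed with a regular conditional distribution of $\left(\int_0^t e^{\nu B^H_s}dB_s,\,v_t\right)$ given $B^H_t$. -/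

import Mathlib

open MeasureTheory ProbabilityTheory Filter Topology
open scoped NNReal ENNReal

namespace FSABR

/-! ### Brownian motions on a filtered probability space -/

/-- `B` is a standard Brownian motion relative to the filtration `ℱ`: a Brownian motion with almost
surely continuous paths, adapted to `ℱ`, whose increments after time `s` are independent of
`ℱ s`. -/
structure IsFilteredBM {Ω : Type*} {mΩ : MeasurableSpace Ω} (ℱ : Filtration ℝ≥0 mΩ)
    (P : Measure Ω) (B : ℝ≥0 → Ω → ℝ) : Prop extends IsBrownianReal B P where
  adapted : Adapted ℱ B
  indep_increment : ∀ s t : ℝ≥0, s ≤ t →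
    Indep (ℱ s) (MeasurableSpace.comap (fun ω => B t ω - B s ω) inferInstance) P

/-! ### The Itô integral -/

/-- A simple adapted process `∑ i < n, coeff i * 1_{(time i, time (i + 1)]}`, with square-integrable
coefficients `coeff i` measurable with respect to `ℱ (time i)`. -/
structure SimpleProc {Ω : Type*} {mΩ : MeasurableSpace Ω} (ℱ : Filtration ℝ≥0 mΩ)
    (P : Measure Ω) where
  n : ℕ
  time : ℕ → ℝ≥0
  time_mono : Monotone time
  coeff : ℕ → Ω → ℝ
  coeff_meas : ∀ i, Measurable[ℱ (time i)] (coeff i)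
  coeff_sq : ∀ i, MemLp (coeff i) 2 P

/-- The value of a simple process at time `s` (a real number) and outcome `ω`. -/
noncomputable def SimpleProc.val {Ω : Type*} {mΩ : MeasurableSpace Ω} {ℱ : Filtration ℝ≥0 mΩ}
    {P : Measure Ω} (S : SimpleProc ℱ P) (s : ℝ) (ω : Ω) : ℝ :=
  ∑ i ∈ Finset.range S.n,
    Set.indicator (Set.Ioc (S.time i : ℝ) (S.time (i + 1) : ℝ)) (fun _ => S.coeff i ω) s

/-- The elementary stochastic integral over `[0, t]` of a simple process against `B`:
`∑ i < n, coeff i * (B (time (i + 1) ∧ t) - B (time i ∧ t))`. -/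
noncomputable def SimpleProc.integral {Ω : Type*} {mΩ : MeasurableSpace Ω}
    {ℱ : Filtration ℝ≥0 mΩ} {P : Measure Ω} (S : SimpleProc ℱ P) (B : ℝ≥0 → Ω → ℝ) (t : ℝ≥0)
    (ω : Ω) : ℝ :=
  ∑ i ∈ Finset.range S.n,
    S.coeff i ω * (B (min (S.time (i + 1)) t) ω - B (min (S.time i) t) ω)

/-- `I` is a version of the Itô integral `∫_0^t φ_s dB_s`: there are simple adapted processes
converging to `φ` in `L²([0, t] × Ω, ds ⊗ P)` whose elementary integrals converge to `I` in
`L²(P)`. When `B` is a Brownian motion relative to `ℱ`, the Itô isometry makes `I` unique up to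
almost sure equality. -/
def IsItoIntegral {Ω : Type*} {mΩ : MeasurableSpace Ω} (ℱ : Filtration ℝ≥0 mΩ) (P : Measure Ω)
    (B : ℝ≥0 → Ω → ℝ) (t : ℝ≥0) (φ : ℝ → Ω → ℝ) (I : Ω → ℝ) : Prop :=
  MemLp (fun z : ℝ × Ω => φ z.1 z.2) 2
      (((volume : Measure ℝ).restrict (Set.Icc 0 (t : ℝ))).prod P) ∧
  MemLp I 2 P ∧
  ∃ S : ℕ → SimpleProc ℱ P,
    Tendsto (fun k => eLpNorm (fun z : ℝ × Ω => (S k).val z.1 z.2 - φ z.1 z.2) 2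
      (((volume : Measure ℝ).restrict (Set.Icc 0 (t : ℝ))).prod P)) atTop (𝓝 0) ∧
    Tendsto (fun k => eLpNorm (fun ω => (S k).integral B t ω - I ω) 2 P) atTop (𝓝 0)

open Classical in
/-- The Itô integral `∫_0^t φ_s dB_s` (a chosen version; `0` if `φ` is not Itô integrable in
`L²`). -/
noncomputable def itoIntegral {Ω : Type*} {mΩ : MeasurableSpace Ω} (ℱ : Filtration ℝ≥0 mΩ)
    (P : Measure Ω) (B : ℝ≥0 → Ω → ℝ) (t : ℝ≥0) (φ : ℝ → Ω → ℝ) : Ω → ℝ :=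
  if h : ∃ I : Ω → ℝ, IsItoIntegral ℱ P B t φ I then h.choose else 0

/-! ### Fractional Brownian motion generated by `B` -/

/-- The Gauss hypergeometric function `F(a, b, c; z)` for real `z < 1`. On `|z| < 1` it is the
hypergeometric series; for `z ≤ -1` it is the analytic continuation of the series, given by
Pfaff's formula `F(a, b, c; z) = (1 - z)^(-a) F(a, c - b, c; z / (z - 1))`, whose right-hand side
is a convergent series because `z / (z - 1) ∈ [1/2, 1)`. -/
noncomputable def gaussF (a b c z : ℝ) : ℝ :=
  if |z| < 1 then ordinaryHypergeometric a b c z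
  else (1 - z) ^ (-a) * ordinaryHypergeometric a (c - b) c (z / (z - 1))

/-- The normalizing constant `c_H` of the Molchan–Golosov kernel. -/
noncomputable def mgConst (H : ℝ) : ℝ :=
  √(2 * H * Real.Gamma (3 / 2 - H) / (Real.Gamma (2 - 2 * H) * Real.Gamma (H + 1 / 2)))

/-- The Molchan–Golosov kernel `K_H(t, s)`. -/
noncomputable def mgKernel (H t s : ℝ) : ℝ :=
  if 0 ≤ s ∧ s ≤ t then
    mgConst H * (t - s) ^ (H - 1 / 2) * gaussF (H - 1 / 2) (1 / 2 - H) (H + 1 / 2) (1 - t / s)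
  else 0

/-- `BH` is the fractional Brownian motion with Hurst exponent `H` generated by `B`: its paths are
almost surely continuous and `BH t = ∫_0^t K_H(t, s) dB_s` almost surely, for every `t`. -/
structure IsFBMGeneratedBy {Ω : Type*} {mΩ : MeasurableSpace Ω} (ℱ : Filtration ℝ≥0 mΩ)
    (P : Measure Ω) (H : ℝ) (B BH : ℝ≥0 → Ω → ℝ) : Prop where
  cont : ∀ᵐ ω ∂P, Continuous fun t => BH t ω
  eq_integral : ∀ t : ℝ≥0, BH t =ᵐ[P] itoIntegral ℱ P B t (fun s _ => mgKernel H t s)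

/-! ### The lognormal fractional SABR model -/

/-- The stochastic integral `∫_0^t e^{ν B^H_s} dM_s`, for a Brownian motion `M`. -/
noncomputable def expIntegral {Ω : Type*} {mΩ : MeasurableSpace Ω} (ℱ : Filtration ℝ≥0 mΩ)
    (P : Measure Ω) (ν : ℝ) (BH M : ℝ≥0 → Ω → ℝ) (t : ℝ≥0) : Ω → ℝ :=
  itoIntegral ℱ P M t (fun s ω => Real.exp (ν * BH s.toNNReal ω))

/-- `v_t = ∫_0^t e^{2 ν B^H_s} ds`. -/
noncomputable def intVar {Ω : Type*} (ν : ℝ) (BH : ℝ≥0 → Ω → ℝ) (t : ℝ≥0) (ω : Ω) : ℝ :=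
  ∫ s in (0 : ℝ)..(t : ℝ), Real.exp (2 * ν * BH s.toNNReal ω)

/-- `(X, Y)` is the log-price and volatility of the lognormal fractional SABR model driven by the
Brownian motions `B`, `W` and the fractional Brownian motion `BH`:
`X_t = x₀ + y₀ ∫_0^t e^{ν B^H_s} (ρ dB_s + √(1 - ρ²) dW_s) - (y₀² / 2) ∫_0^t e^{2 ν B^H_s} ds` and
`Y_t = y₀ e^{ν B^H_t}`. -/
structure IsLognormalFSABR {Ω : Type*} {mΩ : MeasurableSpace Ω} (ℱ : Filtration ℝ≥0 mΩ)
    (P : Measure Ω) (B W BH : ℝ≥0 → Ω → ℝ) (ν ρ x₀ y₀ : ℝ) (X Y : ℝ≥0 → Ω → ℝ) : Prop where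
  logPrice : ∀ t : ℝ≥0, ∀ᵐ ω ∂P, X t ω =
    x₀ + y₀ * (ρ * expIntegral ℱ P ν BH B t ω + √(1 - ρ ^ 2) * expIntegral ℱ P ν BH W t ω)
      - y₀ ^ 2 / 2 * intVar ν BH t ω
  vol : ∀ t : ℝ≥0, ∀ᵐ ω ∂P, Y t ω = y₀ * Real.exp (ν * BH t ω)

/-! ### The ingredients of the bridge representation -/

/-- The conditional expectation `E[g(Z) | U = u]` of a function of a random vector `Z` in the plane
given the value `u` of a real random variable `U`, computed with the regular conditional
distribution of `Z` given `U`. -/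
noncomputable def condExpAt {Ω : Type*} {mΩ : MeasurableSpace Ω} (P : Measure Ω)
    [IsFiniteMeasure P] (Z : Ω → ℝ × ℝ) (U : Ω → ℝ) (g : ℝ × ℝ → ℂ) (u : ℝ) : ℂ :=
  ∫ z, g z ∂(condDistrib Z U P u)

/-- `y ↦ e^{-(ln (y / y₀))² / (2 ν² t^{2H})} / (y √(2 π ν² t^{2H}))`, the density of `Y_t` on
`y > 0`. -/
noncomputable def lognormalDensity (H ν y₀ t y : ℝ) : ℝ :=
  1 / (y * √(2 * Real.pi * ν ^ 2 * t ^ (2 * H))) *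
    Real.exp (-(Real.log (y / y₀)) ^ 2 / (2 * ν ^ 2 * t ^ (2 * H)))

/-- The conditional expectation, given `B^H_t = ln (y / y₀) / ν`, of
`exp(i (x - x₀ - ρ y₀ ∫_0^t e^{ν B^H_s} dB_s + y₀² v_t / 2) ξ) exp(-(1 - ρ²) y₀² v_t ξ² / 2)`. -/
noncomputable def bridgeCondExp {Ω : Type*} {mΩ : MeasurableSpace Ω} (ℱ : Filtration ℝ≥0 mΩ)
    (P : Measure Ω) [IsFiniteMeasure P] (B BH : ℝ≥0 → Ω → ℝ) (ν ρ x₀ y₀ : ℝ) (t : ℝ≥0)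
    (x y ξ : ℝ) : ℂ :=
  condExpAt P (fun ω => (expIntegral ℱ P ν BH B t ω, intVar ν BH t ω)) (BH t)
    (fun z =>
      Complex.exp (Complex.I * ((x - x₀ - ρ * y₀ * z.1 + y₀ ^ 2 * z.2 / 2 : ℝ) : ℂ) * (ξ : ℂ)) *
        Complex.exp ((-((1 - ρ ^ 2) * y₀ ^ 2 * z.2 * ξ ^ 2 / 2) : ℝ) : ℂ))
    (Real.log (y / y₀) / ν)

end FSABR

namespace FSABR

/-! ### The hypergeometric function `F(a, b, a + 1; y)` -/

/-! Condition on the whole path of B. The integrand e^{ν B^H} is a function of that path and W is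
independent of it, so the integral against W is conditionally centred Gaussian with variance v_t
(`IsFBMGeneratedBy.setIntegral_cexp_expIntegral`). Hence X_t is conditionally Gaussian, with mean
`condMean` and variance `condVar` read off from Z = (∫ e^{ν B^H} dB, v_t), while Y_t is a function
of B^H_t, whose law is N(0, t^{2H}). Disintegrating Z along B^H_t and substituting y = y₀ e^{νu}
gives the joint law a density: the lognormal density of y times a mixture of Gaussian densities in
x, mixed by the law of Z given B^H_t = ln(y/y₀)/ν (`IsLognormalFSABR.map_eq`). Absolute continuity
follows, and any other density agrees with this one almost everywhere.

The bridge formula comes from writing each Gaussian density in the mixture as the Fourier integral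
of its characteristic function and exchanging the integrals (`integral_integral_bridgeIntegrand`).
The modulus of the integrand has ξ-integral proportional to v_t^{-1/2}, so Fubini requires
E[v_t^{-1/2} | B^H_t = u] to be finite for almost every u. Jensen's inequality bounds v_t^{-1/2} by
a multiple of ∫_0^t e^{-ν B^H_s} ds, which is integrable
(`IsFBMGeneratedBy.integrable_inv_sqrt_intVar`).

Two foundations are needed. The variance t^{2H} is the L² norm of the Molchan–Golosov kernel: a
first-order differential equation for F(a, b, a + 1; ·) gives the kernel a closed form, and the
square of that form has an explicit antiderivative (`integral_sq_mgKernel`). The Itô integrals are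
identified through the isometry for simple processes and left-endpoint step approximations
(`IsFilteredBM.tendsto_itoIntegral`, `tendsto_stepProc`). The filtration need not contain the null
sets, so B^H itself need not be adapted; adaptedness and independence are always used through
versions measurable with respect to the path of B. -/

lemma one_le_radius_ordinaryHypergeometricSeries (a b c : ℝ) (hc : 0 < c) :
    1 ≤ (ordinaryHypergeometricSeries ℝ a b c).radius := by
  by_cases h : ∀ k : ℕ, (k : ℝ) ≠ -a ∧ (k : ℝ) ≠ -b ∧ (k : ℝ) ≠ -c
  · exact (ordinaryHypergeometricSeries_radius_eq_one ℝ a b c h).ge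
  · push Not at h
    -- This degenerate case does occur: for H = 1/2 the first parameter is 0 and the series
    -- terminates.
    obtain ⟨k, hk⟩ := h
    by_cases ha : (k : ℝ) = -a
    · obtain rfl : a = -(k : ℝ) := by linarith
      rw [ordinaryHypergeometric_radius_top_of_neg_nat₁]; exact le_top
    · by_cases hb : (k : ℝ) = -b
      · obtain rfl : b = -(k : ℝ) := by linarith
        rw [ordinaryHypergeometric_radius_top_of_neg_nat₂]; exact le_top
      · have := hk ha hb
        have : (0 : ℝ) ≤ k := k.cast_nonneg
        linarith

lemma hasFPowerSeriesOnBall_ordinaryHypergeometric (a b c : ℝ) (hc : 0 < c) :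
    HasFPowerSeriesOnBall (ordinaryHypergeometric a b c : ℝ → ℝ)
      (ordinaryHypergeometricSeries ℝ a b c) 0 1 :=
  ((ordinaryHypergeometricSeries ℝ a b c).hasFPowerSeriesOnBall
    (zero_lt_one.trans_le (one_le_radius_ordinaryHypergeometricSeries a b c hc))).mono
    zero_lt_one (one_le_radius_ordinaryHypergeometricSeries a b c hc)

lemma add_mul_ascPochhammer (a : ℝ) (n : ℕ) :
    (a + n) * (ascPochhammer ℝ n).eval a = a * (ascPochhammer ℝ n).eval (a + 1) := by
  have h1 := ascPochhammer_succ_eval (S := ℝ) n a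
  have h2 : (ascPochhammer ℝ (n + 1)).eval a = a * (ascPochhammer ℝ n).eval (a + 1) := by
    rw [ascPochhammer_succ_left]; simp
  rw [← h2, h1]; ring

lemma hasSum_one_sub_rpow (b y : ℝ) (hy : |y| < 1) :
    HasSum (fun n : ℕ => ((n.factorial : ℝ)⁻¹ * (ascPochhammer ℝ n).eval b) * y ^ n)
      ((1 - y) ^ (-b)) := by
  have h := (Real.one_add_rpow_hasFPowerSeriesOnBall_zero (a := -b)).hasSum (y := -y)
    (by simpa [enorm_eq_nnnorm, ← NNReal.coe_lt_coe] using! hy)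
  -- The parameter 1 stands both above and below in the hypergeometric series, so its Pochhammer
  -- symbols cancel; any positive value would do.
  rw [binomialSeries_eq_ordinaryHypergeometricSeries (b := (1 : ℝ))
    (fun k => by have : (0 : ℝ) ≤ k := k.cast_nonneg
                 linarith)] at h
  convert! h using 1
  · ext n
    simp only [FormalMultilinearSeries.compContinuousLinearMap_apply]
    have : (⇑(-ContinuousLinearMap.id ℝ ℝ) ∘ fun _ : Fin n => -y) = fun _ => y := by
      ext; simp
    rw [this, ordinaryHypergeometricSeries_apply_eq, neg_neg, smul_eq_mul]
    have h1 : (ascPochhammer ℝ n).eval 1 ≠ 0 := (ascPochhammer_pos n 1 one_pos).ne'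
    field_simp
  · simp [sub_eq_add_neg]

/-- The first-order equation `y f' + a f = a (1 - y)^(-b)` satisfied by `f = F(a, b, a + 1; ·)`. -/
lemma ordinaryHypergeometric_hasDerivAt (a b y : ℝ) (ha : 0 < a + 1) (hy : |y| < 1) :
    ∃ d, HasDerivAt (ordinaryHypergeometric a b (a + 1) : ℝ → ℝ) d y ∧
      y * d + a * ordinaryHypergeometric a b (a + 1) y = a * (1 - y) ^ (-b) := by
  have hb := hasFPowerSeriesOnBall_ordinaryHypergeometric a b (a + 1) ha
  have hy' : y ∈ Metric.eball (0 : ℝ) 1 := by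
    simpa [enorm_eq_nnnorm, ← NNReal.coe_lt_coe] using! hy
  have hd : DifferentiableAt ℝ (ordinaryHypergeometric a b (a + 1) : ℝ → ℝ) y :=
    (hb.analyticAt_of_mem hy').differentiableAt
  refine ⟨deriv (ordinaryHypergeometric a b (a + 1) : ℝ → ℝ) y, hd.hasDerivAt, ?_⟩
  have h1 := hb.hasSum (y := y) hy'
  have h2 := hb.fderiv.hasSum (y := y) hy'
  rw [zero_add] at h1 h2
  have h3 := h2.mapL (ContinuousLinearMap.apply ℝ ℝ y)
  have h4 : HasSum (fun n : ℕ => (n : ℝ) * (ordinaryHypergeometricSeries ℝ a b (a + 1) n fun _ => y))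
      (y * deriv (ordinaryHypergeometric a b (a + 1) : ℝ → ℝ) y) := by
    rw [← hasSum_nat_add_iff' 1]
    convert! h3 using 1
    · ext n
      simp only [ContinuousLinearMap.apply_apply]
      rw [FormalMultilinearSeries.derivSeries_apply_diag]
      simp
    · simp
  -- The operator y d/dy + a multiplies the n-th coefficient by n + a. Since (a + n)(a)_n = a (a +
  -- 1)_n, this cancels the denominator (a + 1)_n and leaves a times the binomial series.
  have h5 := h4.add (h1.mul_left a)
  have h6 := (hasSum_one_sub_rpow b y hy).mul_left a
  refine h5.unique ?_
  convert! h6 using 1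
  ext n
  rw [ordinaryHypergeometricSeries_apply_eq, smul_eq_mul]
  have hn := (ascPochhammer_pos n (a + 1) ha).ne'
  have := add_mul_ascPochhammer a n
  field_simp
  linear_combination (ascPochhammer ℝ n).eval b * y ^ n * this

end FSABR

namespace FSABR

/-! ### Elementary calculus for the kernel -/

lemma intervalIntegrable_one_sub_rpow_mul_rpow (a b : ℝ) (ha : -1 < a) (hb : -1 < b) :
    IntervalIntegrable (fun u : ℝ => (1 - u) ^ a * u ^ b) volume 0 1 := by
  have h := (Complex.betaIntegral_convergent (u := ((b + 1 : ℝ) : ℂ)) (v := ((a + 1 : ℝ) : ℂ))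
    (by simp; linarith) (by simp; linarith)).norm
  rw [intervalIntegrable_iff_integrableOn_Ioo_of_le zero_le_one] at h ⊢
  refine h.congr_fun (fun x hx => ?_) measurableSet_Ioo
  have h1 : (1 - (x : ℂ)) = ((1 - x : ℝ) : ℂ) := by push_cast; ring
  have h2 : ((b + 1 : ℝ) : ℂ) - 1 = (b : ℂ) := by push_cast; ring
  have h3 : ((a + 1 : ℝ) : ℂ) - 1 = (a : ℂ) := by push_cast; ring
  simp only [norm_mul, h1, h2, h3]
  rw [Complex.norm_cpow_eq_rpow_re_of_pos hx.1,
    Complex.norm_cpow_eq_rpow_re_of_pos (sub_pos.2 hx.2), Complex.ofReal_re, Complex.ofReal_re,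
    mul_comm]

lemma integral_one_sub_rpow_mul_rpow (a b : ℝ) (ha : -1 < a) (hb : -1 < b) :
    ∫ u in (0 : ℝ)..1, (1 - u) ^ a * u ^ b =
      Real.Gamma (a + 1) * Real.Gamma (b + 1) / Real.Gamma (a + b + 2) := by
  have h := beta_eq_betaIntegralReal (b + 1) (a + 1) (by linarith) (by linarith)
  have h4 : Complex.betaIntegral ((b + 1 : ℝ) : ℂ) ((a + 1 : ℝ) : ℂ) =
      ((∫ u in (0 : ℝ)..1, (1 - u) ^ a * u ^ b : ℝ) : ℂ) := by
    rw [Complex.betaIntegral, ← intervalIntegral.integral_ofReal,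
      intervalIntegral.integral_of_le zero_le_one, intervalIntegral.integral_of_le zero_le_one]
    refine setIntegral_congr_fun measurableSet_Ioc (fun x hx => ?_)
    have h2 : ((b + 1 : ℝ) : ℂ) - 1 = (b : ℂ) := by push_cast; ring
    have h3 : ((a + 1 : ℝ) : ℂ) - 1 = (a : ℂ) := by push_cast; ring
    simp only [h2, h3]
    rw [Complex.ofReal_mul, Complex.ofReal_cpow (sub_nonneg.2 hx.2), Complex.ofReal_cpow hx.1.le]
    push_cast; ring
  rw [h4, Complex.ofReal_re] at h
  rw [← h, beta, mul_comm]
  ring_nf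

/-- `∫_x^1 (1 - a) (1 - u)^a u^(-2a) du`. -/
noncomputable def kernelTail (a x : ℝ) : ℝ := (1 - a) * ∫ u in x..1, (1 - u) ^ a * u ^ (-2 * a)

/-- A closed form, on `(0, 1)`, of the Molchan–Golosov kernel with `t = 1`, up to the factor
`c_H s ^ a` where `a = H - 1 / 2`. -/
noncomputable def kernelFun (a x : ℝ) : ℝ :=
  (kernelTail a x + (1 - x) ^ a * x ^ (-2 * a) * (1 + x)) / 2

lemma hasDerivAt_kernelTail (a x : ℝ) (ha : -1 < a) (ha' : a < 1 / 2) (hx : x ∈ Set.Ioo (0 : ℝ) 1) :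
    HasDerivAt (kernelTail a) (-(1 - a) * ((1 - x) ^ a * x ^ (-2 * a))) x := by
  have hi := intervalIntegrable_one_sub_rpow_mul_rpow a (-2 * a) ha (by linarith)
  have hc : ContinuousOn (fun u : ℝ => (1 - u) ^ a * u ^ (-2 * a)) (Set.Ioo 0 1) := by
    intro u hu
    refine ContinuousAt.continuousWithinAt ?_
    refine ContinuousAt.mul ?_ ?_
    · exact ContinuousAt.rpow_const (by fun_prop) (Or.inl (sub_pos.2 hu.2).ne')
    · exact ContinuousAt.rpow_const (by fun_prop) (Or.inl hu.1.ne')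
  have h := intervalIntegral.integral_hasDerivAt_left
    (f := fun u : ℝ => (1 - u) ^ a * u ^ (-2 * a)) (a := x) (b := 1)
    (hi.mono_set (by
      rw [Set.uIcc_of_le hx.2.le, Set.uIcc_of_le zero_le_one]
      exact Set.Icc_subset_Icc_left hx.1.le))
    (hc.stronglyMeasurableAtFilter isOpen_Ioo x hx) (hc.continuousAt (isOpen_Ioo.mem_nhds hx))
  exact (h.const_mul (1 - a)).congr_deriv (by ring)

lemma continuousOn_kernelTail (a : ℝ) (ha : -1 < a) (ha' : a < 1 / 2) :
    ContinuousOn (kernelTail a) (Set.Icc 0 1) := by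
  have hi := intervalIntegrable_one_sub_rpow_mul_rpow a (-2 * a) ha (by linarith)
  have := intervalIntegral.continuousOn_primitive_interval_left (μ := volume) (a := (0 : ℝ)) (b := 1)
    (f := fun u : ℝ => (1 - u) ^ a * u ^ (-2 * a)) (by
      rw [Set.uIcc_of_le zero_le_one, integrableOn_Icc_iff_integrableOn_Ioc]
      exact (intervalIntegrable_iff_integrableOn_Ioc_of_le zero_le_one).1 hi)
  rw [Set.uIcc_of_le zero_le_one] at this
  exact continuousOn_const.mul this

lemma kernelTail_one (a : ℝ) : kernelTail a 1 = 0 := by simp [kernelTail]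

lemma kernelTail_zero (a : ℝ) (ha : -1 < a) (ha' : a < 1 / 2) :
    kernelTail a 0 = Real.Gamma (1 + a) * Real.Gamma (1 - 2 * a) / Real.Gamma (1 - a) := by
  rw [kernelTail, integral_one_sub_rpow_mul_rpow _ _ ha (by linarith)]
  have h : Real.Gamma (a + -2 * a + 2) = (1 - a) * Real.Gamma (1 - a) := by
    rw [← Real.Gamma_add_one (by linarith)]; ring_nf
  have h1 : (1 - a) ≠ 0 := by linarith
  have h2 : Real.Gamma (1 - a) ≠ 0 := (Real.Gamma_pos_of_pos (by linarith)).ne'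
  rw [h]
  field_simp
  ring_nf

lemma tendsto_kernelTail_one (a : ℝ) (ha : -1 < a) (ha' : a < 1 / 2) :
    Tendsto (kernelTail a) (𝓝[<] 1) (𝓝 0) := by
  have := ((continuousOn_kernelTail a ha ha') 1 (by simp)).tendsto
  rw [kernelTail_one] at this
  exact this.mono_left (nhdsWithin_le_of_mem (Icc_mem_nhdsLT zero_lt_one))

lemma tendsto_kernelTail_zero (a : ℝ) (ha : -1 < a) (ha' : a < 1 / 2) :
    Tendsto (kernelTail a) (𝓝[>] 0) (𝓝 (kernelTail a 0)) :=
  ((continuousOn_kernelTail a ha ha') 0 (by simp)).tendsto.mono_left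
    (nhdsWithin_le_of_mem (Icc_mem_nhdsGT zero_lt_one))

/-- A function vanishing to first order at `1` beats `(1 - x)^a` for `a > -1`. -/
lemma tendsto_one_sub_rpow_mul (a : ℝ) (ha : -1 < a) (φ : ℝ → ℝ) (hφ : DifferentiableAt ℝ φ 1)
    (h1 : φ 1 = 0) : Tendsto (fun x => (1 - x) ^ a * φ x) (𝓝[<] 1) (𝓝 0) := by
  have hO : φ =O[𝓝[<] 1] fun x => 1 - x := by
    have := hφ.hasDerivAt.isBigO_sub
    simp only [h1, sub_zero] at this
    refine (this.mono nhdsWithin_le_nhds).trans ?_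
    exact Asymptotics.IsBigO.of_bound 1 (Eventually.of_forall fun x => by
      rw [norm_sub_rev, one_mul])
  have hO2 : (fun x => (1 - x) ^ a * φ x) =O[𝓝[<] 1] fun x : ℝ => (1 - x) ^ (a + 1) := by
    refine ((Asymptotics.isBigO_refl (fun x : ℝ => (1 - x) ^ a) _).mul hO).congr' EventuallyEq.rfl ?_
    filter_upwards [self_mem_nhdsWithin] with x hx
    rw [Real.rpow_add_one (sub_pos.2 hx).ne']
  refine hO2.trans_tendsto ?_
  have : ContinuousAt (fun x : ℝ => (1 - x) ^ (a + 1)) 1 :=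
    ContinuousAt.rpow_const (by fun_prop) (Or.inr (by linarith))
  have h := this.tendsto
  simp only [sub_self, Real.zero_rpow (show a + 1 ≠ 0 by linarith)] at h
  exact h.mono_left nhdsWithin_le_nhds

lemma hasDerivAt_one_sub_rpow (p x : ℝ) (hx : x < 1) :
    HasDerivAt (fun y : ℝ => (1 - y) ^ p) (-p * (1 - x) ^ (p - 1)) x := by
  have := ((hasDerivAt_id x).const_sub 1).rpow_const (p := p) (Or.inl (sub_pos.2 hx).ne')
  refine this.congr_deriv ?_
  simp only [id]
  ring

/-- The integral of this derivative diverges at 1 for a < 0 and at 0 for a > 0. Integration by parts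
moves the singular part into a boundary term and leaves under the integral the exponents a and -2a,
both above -1; one formula then serves every H in (0, 1). -/
lemma hasDerivAt_kernelFun (a x : ℝ) (ha : -1 < a) (ha' : a < 1 / 2) (hx : x ∈ Set.Ioo (0 : ℝ) 1) :
    HasDerivAt (kernelFun a) (-a * (1 - x) ^ (a - 1) * x ^ (-1 - 2 * a)) x := by
  have h1 := hasDerivAt_one_sub_rpow a x hx.2
  have h2 := Real.hasDerivAt_rpow_const (x := x) (p := -2 * a) (Or.inl hx.1.ne')
  have h3 := (hasDerivAt_id x).const_add 1
  have h := ((hasDerivAt_kernelTail a x ha ha' hx).add ((h1.mul h2).mul h3)).div_const 2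
  refine h.congr_deriv ?_
  have e1 : (1 - x) ^ a = (1 - x) ^ (a - 1) * (1 - x) := by
    rw [← Real.rpow_add_one (sub_pos.2 hx.2).ne', sub_add_cancel]
  have e2 : x ^ (-2 * a) = x ^ (-1 - 2 * a) * x := by
    rw [← Real.rpow_add_one hx.1.ne']; ring_nf
  have e3 : x ^ (-2 * a - 1) = x ^ (-1 - 2 * a) := by ring_nf
  simp only [id, e1, e2, e3, Pi.mul_apply]
  ring

/-- A solution of the differential equation of `kernelFun` with the same behaviour at `1` is
`kernelFun`. -/
lemma eq_kernelFun (a l : ℝ) (ha : -1 / 2 < a) (ha' : a < 1 / 2) (hl : 0 ≤ l) (hl1 : l < 1)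
    (F φ : ℝ → ℝ)
    (hF : ∀ x ∈ Set.Ioo l 1, HasDerivAt F (-a * (1 - x) ^ (a - 1) * x ^ (-1 - 2 * a)) x)
    (hφ : ∀ x ∈ Set.Ioo l 1, F x = (1 - x) ^ a * φ x) (hd : DifferentiableAt ℝ φ 1)
    (h1 : φ 1 = 1) : ∀ x ∈ Set.Ioo l 1, F x = kernelFun a x := by
  have hsub : Set.Ioo l 1 ⊆ Set.Ioo (0 : ℝ) 1 := Set.Ioo_subset_Ioo_left hl
  have hD : ∀ x ∈ Set.Ioo l 1, HasDerivAt (fun y => F y - kernelFun a y) 0 x := fun x hx =>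
    ((hF x hx).fun_sub (hasDerivAt_kernelFun a x (by linarith) ha' (hsub hx))).congr_deriv (sub_self _)
  obtain ⟨c, hc⟩ := isOpen_Ioo.exists_is_const_of_deriv_eq_zero isPreconnected_Ioo
    (fun x hx => (hD x hx).differentiableAt.differentiableWithinAt)
    (fun x hx => (hD x hx).deriv)
  -- The leading singularities (1 - x)^a agree at 1, so the difference is (1 - x)^a times a function
  -- vanishing there to first order, minus half the tail integral. This fixes the constant of
  -- integration.
  have hlim : Tendsto (fun y => F y - kernelFun a y) (𝓝[<] 1) (𝓝 0) := by
    have hψ : DifferentiableAt ℝ (fun x : ℝ => φ x - x ^ (-2 * a) * (1 + x) / 2) 1 := by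
      refine hd.sub (((DifferentiableAt.mul ?_ (by fun_prop))).div_const 2)
      exact (Real.hasDerivAt_rpow_const (Or.inl one_ne_zero)).differentiableAt
    have h2 := (tendsto_one_sub_rpow_mul a (by linarith) _ hψ (by simp [h1])).sub
      ((tendsto_kernelTail_one a (by linarith) ha').div_const 2)
    simp only [zero_div, sub_zero] at h2
    refine h2.congr' ?_
    filter_upwards [Ioo_mem_nhdsLT hl1] with x hx
    rw [hφ x hx, kernelFun]
    ring
  have hlim2 : Tendsto (fun y => F y - kernelFun a y) (𝓝[<] 1) (𝓝 c) := by
    refine tendsto_const_nhds.congr' ?_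
    filter_upwards [Ioo_mem_nhdsLT hl1] with x hx
    exact (hc x hx).symm
  have := tendsto_nhds_unique hlim2 hlim
  intro x hx
  have h3 := hc x hx
  linarith

/-- Treats the continued branch of `gaussF`: with z = 1 - 1/x, the Pfaff argument z / (z - 1) is 1 -
x and a + 1 - (-a) is 1 + 2a. The first-order equation gives the derivative required by
`eq_kernelFun`. -/
lemma one_sub_rpow_mul_ordinaryHypergeometric (a x : ℝ) (ha : -1 / 2 < a) (ha' : a < 1 / 2)
    (hx : x ∈ Set.Ioo (0 : ℝ) 1) :
    (1 - x) ^ a * ordinaryHypergeometric a (1 + 2 * a) (a + 1) (1 - x) = kernelFun a x := by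
  have hda : ∀ y : ℝ, |1 - y| < 1 → _ := fun y hy =>
    ordinaryHypergeometric_hasDerivAt a (1 + 2 * a) (1 - y) (by linarith) hy
  refine eq_kernelFun a 0 ha ha' le_rfl zero_lt_one _
    (fun x => ordinaryHypergeometric a (1 + 2 * a) (a + 1) (1 - x)) ?_ (fun _ _ => rfl) ?_ (by simp)
    x hx
  · intro y hy
    obtain ⟨d, hd, he⟩ := hda y (by rw [abs_lt]; constructor <;> linarith [hy.1, hy.2])
    have h := (hasDerivAt_one_sub_rpow a y hy.2).mul
      (HasDerivAt.comp y hd ((hasDerivAt_id y).const_sub 1))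
    refine h.congr_deriv ?_
    have e1 : (1 - y) ^ a = (1 - y) ^ (a - 1) * (1 - y) := by
      rw [← Real.rpow_add_one (sub_pos.2 hy.2).ne', sub_add_cancel]
    have e2 : y ^ (-1 - 2 * a) = (1 - (1 - y)) ^ (-(1 + 2 * a)) := by ring_nf
    rw [e2, e1]
    simp only [Function.comp_apply]
    linear_combination -(1 - y) ^ (a - 1) * he
  · obtain ⟨d, hd, -⟩ := hda 1 (by simp)
    exact (HasDerivAt.comp (1 : ℝ) hd ((hasDerivAt_id (1 : ℝ)).const_sub 1)).differentiableAt

/-- Treats the series branch of `gaussF`; the bound x > 1/2 is the condition |1 - 1/x| < 1. The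
factor x^{-a} makes the product satisfy the same differential equation, with the same behaviour at
1, as the Pfaff branch. -/
lemma rpow_mul_ordinaryHypergeometric_neg (a x : ℝ) (ha : -1 / 2 < a) (ha' : a < 1 / 2)
    (hx : x ∈ Set.Ioo (1 / 2 : ℝ) 1) :
    (1 - x) ^ a * (x ^ (-a) * ordinaryHypergeometric a (-a) (a + 1) (1 - 1 / x)) =
      kernelFun a x := by
  have hda : ∀ y : ℝ, 1 / 2 < y → y ≤ 1 → _ := fun y hy hy1 =>
    ordinaryHypergeometric_hasDerivAt a (-a) (1 - 1 / y) (by linarith) (by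
      have h1 : 1 ≤ 1 / y := by rw [le_div_iff₀ (by linarith)]; linarith
      have h2 : 1 / y < 2 := by rw [div_lt_iff₀ (by linarith)]; linarith
      rw [abs_lt]; constructor <;> linarith)
  have hinv : ∀ y : ℝ, 0 < y → HasDerivAt (fun z : ℝ => 1 - 1 / z) (1 / y ^ 2) y := fun y hy => by
    have := (hasDerivAt_inv hy.ne').const_sub 1
    simp only [one_div]
    refine this.congr_deriv ?_
    simp
  have hpart : ∀ y : ℝ, 0 < y → ∀ d, HasDerivAt (ordinaryHypergeometric a (-a) (a + 1) : ℝ → ℝ) d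
      (1 - 1 / y) → _ := fun y hy d hd =>
    (Real.hasDerivAt_rpow_const (x := y) (p := -a) (Or.inl hy.ne')).mul
      (HasDerivAt.comp y hd (hinv y hy))
  refine eq_kernelFun a (1 / 2) ha ha' (by norm_num) (by norm_num) _
    (fun x => x ^ (-a) * ordinaryHypergeometric a (-a) (a + 1) (1 - 1 / x)) ?_ (fun _ _ => rfl) ?_
    (by simp) x hx
  · intro y hy
    have hy0 : 0 < y := by linarith [hy.1]
    obtain ⟨d, hd, he⟩ := hda y hy.1 hy.2.le
    have h := (hasDerivAt_one_sub_rpow a y hy.2).mul (hpart y hy0 d hd)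
    refine h.congr_deriv ?_
    have e1 : (1 - y) ^ a = (1 - y) ^ (a - 1) * (1 - y) := by
      rw [← Real.rpow_add_one (sub_pos.2 hy.2).ne', sub_add_cancel]
    have e2 : (1 - (1 - 1 / y)) ^ (-(-a)) = y ^ (-a) := by
      rw [sub_sub_cancel, one_div, Real.inv_rpow hy0.le, neg_neg, Real.rpow_neg hy0.le]
    have e3 : y ^ (-1 - 2 * a) = y ^ (-a - 1) * y ^ (-a) := by
      rw [← Real.rpow_add hy0]; ring_nf
    have e4 : y ^ (-a) = y ^ (-a - 1) * y := by
      rw [← Real.rpow_add_one hy0.ne', sub_add_cancel]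
    rw [e2] at he
    simp only [Function.comp_apply, Pi.mul_apply]
    rw [e3, e1]
    have h5 : (1 - 1 / y) * y = -(1 - y) := by field_simp; ring
    have h6 : 1 / y ^ 2 * y = 1 / y := by field_simp
    have h7 : y * (1 / y) = 1 := by field_simp
    generalize ordinaryHypergeometric a (-a) (a + 1) (1 - 1 / y) = f at *
    have h8 : y ^ (-a) * (d * (1 / y ^ 2)) = y ^ (-a - 1) * (d * (1 / y)) := by
      rw [e4, mul_assoc, ← h6]; ring
    rw [h8]
    generalize hA : y ^ (-a) = A at *
    generalize y ^ (-a - 1) = B at *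
    generalize (1 - y) ^ (a - 1) = C at *
    generalize 1 / y = w at *
    have hA2 : -a * C * A * f = -a * C * (B * y) * f := by rw [← e4]
    linear_combination hA2 - C * B * he - C * B * d * h7
  · obtain ⟨d, hd, -⟩ := hda 1 (by norm_num) le_rfl
    exact (hpart 1 one_pos d hd).differentiableAt

end FSABR

/-! ### Closed form and L² norm of the Molchan–Golosov kernel -/

namespace FSABR

/-- By homogeneity the kernel depends on x = s/t up to the power t^{H - 1/2}. Both branches of
`gaussF` were matched to `kernelFun` separately, so Pfaff's identity itself is never needed. -/
lemma mgKernel_eq (H t s : ℝ) (hH : 0 < H ∧ H < 1) (hs : 0 < s) (hst : s < t) :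
    mgKernel H t s = mgConst H * t ^ (H - 1 / 2) *
      ((s / t) ^ (H - 1 / 2) * kernelFun (H - 1 / 2) (s / t)) := by
  have ht : 0 < t := hs.trans hst
  obtain ⟨a, rfl⟩ : ∃ a, H = a + 1 / 2 := ⟨H - 1 / 2, by ring⟩
  have ha : -1 / 2 < a := by linarith [hH.1]
  have ha' : a < 1 / 2 := by linarith [hH.2]
  set x := s / t with hx
  have hx0 : 0 < x := div_pos hs ht
  have hx1 : x < 1 := (div_lt_one ht).2 hst
  have hts : t / s = 1 / x := by rw [hx, one_div_div]
  have hsub : t - s = t * (1 - x) := by rw [hx]; field_simp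
  rw [mgKernel, if_pos ⟨hs.le, hst.le⟩, hts, hsub, Real.mul_rpow ht.le (sub_nonneg.2 hx1.le)]
  have e1 : a + 1 / 2 - 1 / 2 = a := by ring
  have e2 : 1 / 2 - (a + 1 / 2) = -a := by ring
  have e3 : a + 1 / 2 + 1 / 2 = a + 1 := by ring
  rw [e1, e2, e3]
  suffices h : (1 - x) ^ a * gaussF a (-a) (a + 1) (1 - 1 / x) = x ^ a * kernelFun a x by
    rw [← h]; ring
  rw [gaussF]
  by_cases h2 : 1 / 2 < x
  · rw [if_pos, ← rpow_mul_ordinaryHypergeometric_neg a x ha ha' ⟨h2, hx1⟩]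
    · have : x ^ a * x ^ (-a) = 1 := by rw [← Real.rpow_add hx0]; simp
      linear_combination -(1 - x) ^ a * ordinaryHypergeometric a (-a) (a + 1) (1 - 1 / x) * this
    · have h1 : 1 ≤ 1 / x := by rw [le_div_iff₀ hx0]; linarith
      have h3 : 1 / x < 2 := by rw [div_lt_iff₀ hx0]; linarith
      rw [abs_lt]; constructor <;> linarith
  · rw [if_neg, ← one_sub_rpow_mul_ordinaryHypergeometric a x ha ha' ⟨hx0, hx1⟩]
    · have e4 : a + 1 - -a = 1 + 2 * a := by ring
      have e5 : (1 - 1 / x) / (1 - 1 / x - 1) = 1 - x := by field_simp; ring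
      have e6 : (1 - (1 - 1 / x)) ^ (-a) = x ^ a := by
        rw [sub_sub_cancel, one_div, Real.inv_rpow hx0.le, Real.rpow_neg hx0.le, inv_inv]
      rw [e4, e5, e6]; ring
    · have h3 : 2 ≤ 1 / x := by rw [le_div_iff₀ hx0]; linarith
      rw [abs_lt]; intro h; linarith [h.1]

/-- For a nonnegative derivative, finite one-sided limits of the antiderivative already force
integrability, even if the derivative blows up at the endpoints. The antiderivative is extended
continuously to the closed interval. -/
lemma integrableOn_and_integral_of_hasDerivAt_nonneg {f f' : ℝ → ℝ} {a b fa fb : ℝ} (hab : a < b)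
    (hf : ∀ x ∈ Set.Ioo a b, HasDerivAt f (f' x) x) (hf' : ∀ x ∈ Set.Ioo a b, 0 ≤ f' x)
    (ha : Tendsto f (𝓝[>] a) (𝓝 fa)) (hb : Tendsto f (𝓝[<] b) (𝓝 fb)) :
    IntervalIntegrable f' volume a b ∧ ∫ x in a..b, f' x = fb - fa := by
  have hc : ContinuousOn f (Set.Ioo a b) := fun x hx =>
    (hf x hx).continuousAt.continuousWithinAt
  have hI : IntervalIntegrable f' volume a b := by
    refine intervalIntegral.intervalIntegrable_deriv_of_nonneg
      (g := extendFrom (Set.Ioo a b) f) ?_ ?_ ?_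
    · rw [Set.uIcc_of_le hab.le]
      exact continuousOn_Icc_extendFrom_Ioo hc ha hb
    · rw [min_eq_left hab.le, max_eq_right hab.le]
      intro x hx
      refine (hf x hx).congr_of_eventuallyEq ?_
      filter_upwards [isOpen_Ioo.mem_nhds hx] with y hy
      exact extendFrom_eq (subset_closure hy) ((hf y hy).continuousAt.continuousWithinAt)
    · rwa [min_eq_left hab.le, max_eq_right hab.le]
  exact ⟨hI, intervalIntegral.integral_eq_sub_of_hasDerivAt_of_tendsto hab hf hI ha hb⟩

/-- An antiderivative of `(2a + 1) x^(2a) (kernelFun a x)²`. -/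
noncomputable def kernelPrim (a x : ℝ) : ℝ :=
  x ^ (2 * a + 1) * kernelFun a x ^ 2 - 2 * (1 - x) ^ a * kernelFun a x +
    (1 - x) ^ (2 * a) * x ^ (-2 * a)

lemma hasDerivAt_kernelPrim (a x : ℝ) (ha : -1 / 2 < a) (ha' : a < 1 / 2)
    (hx : x ∈ Set.Ioo (0 : ℝ) 1) :
    HasDerivAt (kernelPrim a) ((2 * a + 1) * (x ^ a * kernelFun a x) ^ 2) x := by
  have hG := hasDerivAt_kernelFun a x (by linarith) ha' hx
  have h1 := hasDerivAt_one_sub_rpow a x hx.2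
  have h2 := hasDerivAt_one_sub_rpow (2 * a) x hx.2
  have h3 := Real.hasDerivAt_rpow_const (x := x) (p := 2 * a + 1) (Or.inl hx.1.ne')
  have h4 := Real.hasDerivAt_rpow_const (x := x) (p := -2 * a) (Or.inl hx.1.ne')
  have h := ((h3.fun_mul (hG.fun_pow 2)).fun_sub ((h1.const_mul 2).fun_mul hG)).fun_add
    (h2.fun_mul h4)
  have hy : 0 < 1 - x := sub_pos.2 hx.2
  refine h.congr_deriv ?_
  have e1 : (1 - x) ^ a = (1 - x) ^ (a - 1) * (1 - x) := by
    rw [← Real.rpow_add_one hy.ne', sub_add_cancel]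
  have e2 : (1 - x) ^ (2 * a) = (1 - x) ^ (a - 1) * (1 - x) ^ (a - 1) * (1 - x) ^ 2 := by
    rw [← Real.rpow_natCast, ← Real.rpow_add hy, ← Real.rpow_add hy]; congr 1; push_cast; ring
  have e3 : (1 - x) ^ (2 * a - 1) = (1 - x) ^ (a - 1) * (1 - x) ^ (a - 1) * (1 - x) := by
    rw [← Real.rpow_add hy, ← Real.rpow_add_one hy.ne']; congr 1; ring
  have e4 : x ^ (-2 * a) = x ^ (-1 - 2 * a) * x := by
    rw [← Real.rpow_add_one hx.1.ne']; congr 1; ring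
  have e5 : x ^ (-2 * a - 1) = x ^ (-1 - 2 * a) := by congr 1; ring
  have e6 : x ^ (2 * a + 1) = (x ^ a) ^ 2 * x := by
    rw [← Real.rpow_natCast, ← Real.rpow_mul hx.1.le, ← Real.rpow_add_one hx.1.ne']
    congr 1; push_cast; ring
  have e7 : x ^ (2 * a + 1 - 1) = (x ^ a) ^ 2 := by
    rw [← Real.rpow_natCast, ← Real.rpow_mul hx.1.le]; congr 1; push_cast; ring
  have e8 : (x ^ a) ^ 2 * x * x ^ (-1 - 2 * a) = 1 := by
    rw [← e6, ← Real.rpow_add hx.1]; ring_nf; simp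
  simp only [e1, e2, e3, e4, e5, e6, e7]
  push_cast
  -- Write G for `kernelFun a`. Since x^{2a+1} G' = -a (1 - x)^{a-1}, the terms linear in G cancel.
  -- The terms free of G cancel because -2 (1 - x)^a G' is minus the derivative of (1 - x)^{2a}
  -- x^{-2a}.
  linear_combination (-2 * a * (1 - x) ^ (a - 1) * kernelFun a x) * e8

/-- For a < 0 the individual terms blow up like (1 - x)^{2a}, but their coefficients at 1 sum to 1 -
2 + 1 = 0. As 2a > -1, first-order vanishing is enough; the remaining terms carry the tail integral
or a second such cancellation. -/
lemma tendsto_kernelPrim_one (a : ℝ) (ha : -1 / 2 < a) (ha' : a < 1 / 2) :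
    Tendsto (kernelPrim a) (𝓝[<] 1) (𝓝 0) := by
  have hQ := tendsto_kernelTail_one a (by linarith) ha'
  have hdp : ∀ p : ℝ, DifferentiableAt ℝ (fun x : ℝ => x ^ p) 1 := fun p =>
    (Real.hasDerivAt_rpow_const (Or.inl one_ne_zero)).differentiableAt
  have hψ : DifferentiableAt ℝ (fun x : ℝ => x ^ (-2 * a) * (1 + x) / 2) 1 :=
    (((hdp (-2 * a)).mul (by fun_prop))).div_const 2
  have h1 := tendsto_one_sub_rpow_mul (2 * a) (by linarith)
    (fun x => x ^ (2 * a + 1) * (x ^ (-2 * a) * (1 + x) / 2) ^ 2 -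
      2 * (x ^ (-2 * a) * (1 + x) / 2) + x ^ (-2 * a))
    ((((hdp _).mul (hψ.pow 2)).sub (hψ.const_mul 2)).add (hdp _)) (by norm_num)
  have h2 := tendsto_one_sub_rpow_mul a (by linarith)
    (fun x => x ^ (2 * a + 1) * (x ^ (-2 * a) * (1 + x) / 2) - 1)
    (((hdp _).mul hψ).sub (differentiableAt_const _)) (by norm_num)
  have h3 : Tendsto (fun x : ℝ => x ^ (2 * a + 1)) (𝓝[<] 1) (𝓝 1) := by
    simpa using (hdp (2 * a + 1)).continuousAt.tendsto.mono_left nhdsWithin_le_nhds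
  have h4 := (h1.add (hQ.mul h2)).add ((h3.mul (hQ.pow 2)).div_const 4)
  simp only [add_zero, ne_eq, OfNat.ofNat_ne_zero, not_false_eq_true, zero_pow, mul_zero,
    zero_div] at h4
  refine h4.congr' ?_
  filter_upwards [Ioo_mem_nhdsLT zero_lt_one] with x hx
  have e : (1 - x) ^ (2 * a) = ((1 - x) ^ a) ^ 2 := by
    rw [← Real.rpow_natCast, ← Real.rpow_mul (sub_nonneg.2 hx.2.le)]; congr 1; push_cast; ring
  rw [kernelPrim, kernelFun, e]
  ring

lemma tendsto_rpow_nhdsGT_zero (p : ℝ) (hp : 0 < p) :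
    Tendsto (fun x : ℝ => x ^ p) (𝓝[>] 0) (𝓝 0) := by
  have := (Real.continuousAt_rpow_const 0 p (Or.inr hp.le)).tendsto
  rw [Real.zero_rpow hp.ne'] at this
  exact this.mono_left nhdsWithin_le_nhds

/-- For a > 0 two terms diverge like x^{-2a}; their sum is -(1 - x)^{2a} x^{1-2a}, which tends to 0.
Only the term -(1 - x)^a times the tail integral survives, and its limit is a Beta value. -/
lemma tendsto_kernelPrim_zero (a : ℝ) (ha : -1 / 2 < a) (ha' : a < 1 / 2) :
    Tendsto (kernelPrim a) (𝓝[>] 0) (𝓝 (-kernelTail a 0)) := by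
  have hQ := tendsto_kernelTail_zero a (by linarith) ha'
  have hc : ∀ p : ℝ, Tendsto (fun x : ℝ => (1 - x) ^ p) (𝓝[>] 0) (𝓝 1) := fun p => by
    have : ContinuousAt (fun x : ℝ => (1 - x) ^ p) 0 :=
      ContinuousAt.rpow_const (by fun_prop) (Or.inl (by norm_num))
    simpa using this.tendsto.mono_left nhdsWithin_le_nhds
  have h1 : Tendsto (fun x : ℝ => 1 + x) (𝓝[>] 0) (𝓝 1) := by
    have : ContinuousAt (fun x : ℝ => 1 + x) 0 := by fun_prop
    simpa using this.tendsto.mono_left nhdsWithin_le_nhds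
  have h2 := ((((tendsto_rpow_nhdsGT_zero (a + 1 / 2) (by linarith)).mul hQ).add
    (((hc a).mul (tendsto_rpow_nhdsGT_zero (1 / 2 - a) (by linarith))).mul h1)).div_const 2).pow 2
  have h3 := (h2.sub ((hc a).mul hQ)).sub
    ((hc (2 * a)).mul (tendsto_rpow_nhdsGT_zero (1 - 2 * a) (by linarith)))
  norm_num at h3
  refine h3.congr' ?_
  filter_upwards [Ioo_mem_nhdsGT zero_lt_one] with x hx
  have e : (1 - x) ^ (2 * a) = ((1 - x) ^ a) ^ 2 := by
    rw [← Real.rpow_natCast, ← Real.rpow_mul (sub_nonneg.2 hx.2.le)]; congr 1; push_cast; ring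
  have e1 : x ^ (2 * a + 1) = (x ^ (a + 1 / 2)) ^ 2 := by
    rw [← Real.rpow_natCast, ← Real.rpow_mul hx.1.le]; congr 1; push_cast; ring
  have e2 : x ^ (1 / 2 - a) = x ^ (a + 1 / 2) * x ^ (-2 * a) := by
    rw [← Real.rpow_add hx.1]; congr 1; ring
  have e3 : x ^ (1 - 2 * a) = x ^ (-2 * a) * x := by
    rw [← Real.rpow_add_one hx.1.ne']; congr 1; ring
  rw [kernelPrim, kernelFun, e, e1, e2, e3]
  ring

lemma integral_sq_kernelFun (a : ℝ) (ha : -1 / 2 < a) (ha' : a < 1 / 2) :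
    IntervalIntegrable (fun x => (x ^ a * kernelFun a x) ^ 2) volume 0 1 ∧
    ∫ x in (0 : ℝ)..1, (x ^ a * kernelFun a x) ^ 2 =
      Real.Gamma (1 + a) * Real.Gamma (1 - 2 * a) / ((2 * a + 1) * Real.Gamma (1 - a)) := by
  have h0 : 2 * a + 1 ≠ 0 := by linarith
  obtain ⟨h1, h2⟩ := integrableOn_and_integral_of_hasDerivAt_nonneg zero_lt_one
    (fun x hx => hasDerivAt_kernelPrim a x ha ha' hx)
    (fun x _ => mul_nonneg (by linarith) (sq_nonneg _))
    (tendsto_kernelPrim_zero a ha ha') (tendsto_kernelPrim_one a ha ha')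
  refine ⟨?_, ?_⟩
  · have := h1.const_mul (2 * a + 1)⁻¹
    simpa [inv_mul_cancel_left₀ h0] using this
  · rw [intervalIntegral.integral_const_mul, kernelTail_zero a (by linarith) ha'] at h2
    have h3 : Real.Gamma (1 - a) ≠ 0 := (Real.Gamma_pos_of_pos (by linarith)).ne'
    rw [sub_neg_eq_add, zero_add] at h2
    field_simp at h2 ⊢
    linarith

lemma mgConst_sq (H : ℝ) (hH : 0 < H ∧ H < 1) :
    mgConst H ^ 2 * (Real.Gamma (1 + (H - 1 / 2)) * Real.Gamma (1 - 2 * (H - 1 / 2)) /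
      ((2 * (H - 1 / 2) + 1) * Real.Gamma (1 - (H - 1 / 2)))) = 1 := by
  have h1 : 0 < Real.Gamma (3 / 2 - H) := Real.Gamma_pos_of_pos (by linarith [hH.2])
  have h2 : 0 < Real.Gamma (2 - 2 * H) := Real.Gamma_pos_of_pos (by linarith [hH.2])
  have h3 : 0 < Real.Gamma (H + 1 / 2) := Real.Gamma_pos_of_pos (by linarith [hH.1])
  have hH0 := hH.1
  rw [mgConst, Real.sq_sqrt (by positivity)]
  have e1 : 1 + (H - 1 / 2) = H + 1 / 2 := by ring
  have e2 : 1 - 2 * (H - 1 / 2) = 2 - 2 * H := by ring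
  have e3 : 1 - (H - 1 / 2) = 3 / 2 - H := by ring
  have e4 : 2 * (H - 1 / 2) + 1 = 2 * H := by ring
  rw [e1, e2, e3, e4]
  generalize Real.Gamma (3 / 2 - H) = x at *
  generalize Real.Gamma (2 - 2 * H) = y at *
  generalize Real.Gamma (H + 1 / 2) = z at *
  field_simp

/-- The normalization of the Molchan–Golosov kernel: `∫_0^t K_H(t, s)² ds = t^(2H)`. -/
lemma integral_sq_mgKernel (H t : ℝ) (hH : 0 < H ∧ H < 1) (ht : 0 < t) :
    IntervalIntegrable (fun s => mgKernel H t s ^ 2) volume 0 t ∧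
    ∫ s in (0 : ℝ)..t, mgKernel H t s ^ 2 = t ^ (2 * H) := by
  obtain ⟨h1, h2⟩ := integral_sq_kernelFun (H - 1 / 2) (by linarith [hH.1]) (by linarith [hH.2])
  have hEq : Set.EqOn (fun s => mgKernel H t s ^ 2) (fun s => (mgConst H * t ^ (H - 1 / 2)) ^ 2 *
      ((s / t) ^ (H - 1 / 2) * kernelFun (H - 1 / 2) (s / t)) ^ 2) (Set.Ioo 0 t) := fun s hs => by
    simp only [mgKernel_eq H t s hH hs.1 hs.2]; ring
  have h3 : IntervalIntegrable (fun s => (mgConst H * t ^ (H - 1 / 2)) ^ 2 *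
      ((s / t) ^ (H - 1 / 2) * kernelFun (H - 1 / 2) (s / t)) ^ 2) volume 0 t := by
    have := (h1.comp_mul_left (c := t⁻¹)).const_mul ((mgConst H * t ^ (H - 1 / 2)) ^ 2)
    simpa [div_eq_inv_mul] using this
  refine ⟨?_, ?_⟩
  · rw [intervalIntegrable_iff_integrableOn_Ioo_of_le ht.le] at h3 ⊢
    exact h3.congr_fun hEq.symm measurableSet_Ioo
  · rw [intervalIntegral.integral_of_le ht.le, integral_Ioc_eq_integral_Ioo,
      setIntegral_congr_fun measurableSet_Ioo hEq, ← integral_Ioc_eq_integral_Ioo,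
      ← intervalIntegral.integral_of_le ht.le, intervalIntegral.integral_const_mul,
      intervalIntegral.integral_comp_div
        (fun x => (x ^ (H - 1 / 2) * kernelFun (H - 1 / 2) x) ^ 2) ht.ne', zero_div,
      div_self ht.ne', h2, smul_eq_mul]
    have e : t ^ (2 * H) = t * (t ^ (H - 1 / 2)) ^ 2 := by
      rw [← Real.rpow_natCast, ← Real.rpow_mul ht.le, mul_comm t, ← Real.rpow_add_one ht.ne']
      congr 1; push_cast; ring
    rw [e]
    linear_combination t * (t ^ (H - 1 / 2)) ^ 2 * mgConst_sq H hH

lemma memLp_mgKernel (H t : ℝ) (hH : 0 < H ∧ H < 1) (ht : 0 ≤ t) :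
    MemLp (mgKernel H t) 2 (volume.restrict (Set.Icc 0 t)) := by
  rcases ht.eq_or_lt with rfl | ht
  · simp
  obtain ⟨h1, -⟩ := integral_sq_mgKernel H t hH ht
  -- The closed form is available only for 0 < s < t; the values at the endpoints are immaterial.
  rw [Measure.restrict_congr_set Ioo_ae_eq_Icc.symm]
  have hm : AEStronglyMeasurable (mgKernel H t) (volume.restrict (Set.Ioo 0 t)) := by
    have hc : ContinuousOn (fun s => mgConst H * t ^ (H - 1 / 2) *
        ((s / t) ^ (H - 1 / 2) * kernelFun (H - 1 / 2) (s / t))) (Set.Ioo 0 t) := by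
      intro s hs
      refine ContinuousAt.continuousWithinAt (continuousAt_const.mul (ContinuousAt.mul ?_ ?_))
      · exact ContinuousAt.rpow_const (by fun_prop) (Or.inl (div_pos hs.1 ht).ne')
      · exact ContinuousAt.comp (f := fun s => s / t)
          (hasDerivAt_kernelFun (H - 1 / 2) (s / t) (by linarith [hH.1]) (by linarith [hH.2])
            ⟨div_pos hs.1 ht, (div_lt_one ht).2 hs.2⟩).continuousAt (by fun_prop)
    refine (hc.aestronglyMeasurable measurableSet_Ioo).congr ?_
    filter_upwards [ae_restrict_mem measurableSet_Ioo] with s hs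
    exact (mgKernel_eq H t s hH hs.1 hs.2).symm
  rw [memLp_two_iff_integrable_sq hm]
  exact (intervalIntegrable_iff_integrableOn_Ioo_of_le ht.le).1 h1

lemma setIntegral_sq_mgKernel (H t : ℝ) (hH : 0 < H ∧ H < 1) (ht : 0 ≤ t) :
    ∫ s in Set.Icc 0 t, mgKernel H t s ^ 2 = t ^ (2 * H) := by
  rcases ht.eq_or_lt with rfl | ht
  · rw [Real.zero_rpow (by linarith [hH.1])]; simp
  · rw [integral_Icc_eq_integral_Ioc, ← intervalIntegral.integral_of_le ht.le]
    exact (integral_sq_mgKernel H t hH ht).2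

end FSABR

namespace FSABR

/-! ### The Itô isometry -/

section Ito

variable {Ω : Type*} {mΩ : MeasurableSpace Ω} {P : Measure Ω} {ℱ : Filtration ℝ≥0 mΩ}
  {M : ℝ≥0 → Ω → ℝ}

lemma IsFilteredBM.measurable (hM : IsFilteredBM ℱ P M) (t : ℝ≥0) : Measurable (M t) :=
  (hM.adapted t).mono (ℱ.le t) le_rfl

lemma IsFilteredBM.measurable_inc (hM : IsFilteredBM ℱ P M) {s t : ℝ≥0} (hst : s ≤ t) :
    Measurable[ℱ t] (fun ω => M t ω - M s ω) :=
  (hM.adapted t).sub ((hM.adapted s).mono (ℱ.mono hst) le_rfl)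

lemma IsFilteredBM.hasLaw_inc (hM : IsFilteredBM ℱ P M) {s t : ℝ≥0} (hst : s ≤ t) :
    HasLaw (fun ω => M t ω - M s ω) (gaussianReal 0 (t - s)) P := by
  have h := hM.toIsPreBrownianReal.hasLaw_sub t s
  have e : nndist t.1 s.1 = t - s := by
    ext
    rw [coe_nndist, Real.dist_eq, NNReal.coe_sub hst, abs_of_nonneg]
    · rfl
    · exact sub_nonneg.2 hst
  rwa [e] at h

lemma IsFilteredBM.memLp_inc (hM : IsFilteredBM ℱ P M) {s t : ℝ≥0} (hst : s ≤ t) :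
    MemLp (fun ω => M t ω - M s ω) 2 P :=
  (hM.hasLaw_inc hst).hasGaussianLaw.memLp_two

lemma IsFilteredBM.integral_inc (hM : IsFilteredBM ℱ P M) {s t : ℝ≥0} (hst : s ≤ t) :
    ∫ ω, (M t ω - M s ω) ∂P = 0 := by
  rw [(hM.hasLaw_inc hst).integral_eq, integral_id_gaussianReal]

lemma IsFilteredBM.integral_inc_sq (hM : IsFilteredBM ℱ P M) {s t : ℝ≥0} (hst : s ≤ t) :
    ∫ ω, (M t ω - M s ω) ^ 2 ∂P = t - s := by
  have h := (hM.hasLaw_inc hst).variance_eq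
  rw [variance_id_gaussianReal, variance_of_integral_eq_zero (hM.hasLaw_inc hst).aemeasurable
    (hM.integral_inc hst), NNReal.coe_sub hst] at h
  exact h

lemma IsFilteredBM.indepFun_inc (hM : IsFilteredBM ℱ P M) {s t : ℝ≥0} (hst : s ≤ t)
    {β : Type*} [MeasurableSpace β] {G : Ω → β} (hG : Measurable[ℱ s] G) :
    IndepFun G (fun ω => M t ω - M s ω) P := by
  rw [IndepFun_iff_Indep]
  exact indep_of_indep_of_le_left (hM.indep_increment s t hst) hG.comap_le

lemma IsFilteredBM.integral_mul_inc (hM : IsFilteredBM ℱ P M) {s t : ℝ≥0} (hst : s ≤ t)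
    {G : Ω → ℝ} (hG : Measurable[ℱ s] G) : ∫ ω, G ω * (M t ω - M s ω) ∂P = 0 := by
  rw [(hM.indepFun_inc hst hG).integral_fun_mul_eq_mul_integral
    (hG.mono (ℱ.le s) le_rfl).aestronglyMeasurable
    (hM.memLp_inc hst).aestronglyMeasurable, hM.integral_inc hst, mul_zero]

lemma IsFilteredBM.integral_mul_inc_sq (hM : IsFilteredBM ℱ P M) {s t : ℝ≥0} (hst : s ≤ t)
    {G : Ω → ℝ} (hG : Measurable[ℱ s] G) :
    ∫ ω, G ω * (M t ω - M s ω) ^ 2 ∂P = (∫ ω, G ω ∂P) * (t - s) := by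
  have h := (hM.indepFun_inc hst hG).comp measurable_id (measurable_id.pow_const 2)
  have := h.integral_fun_mul_eq_mul_integral
    (hG.mono (ℱ.le s) le_rfl).aestronglyMeasurable
    ((hM.memLp_inc hst).aestronglyMeasurable.pow 2)
  simp only [Function.comp_apply, id] at this
  rw [this, hM.integral_inc_sq hst]

lemma IsFilteredBM.memLp_mul_inc (hM : IsFilteredBM ℱ P M) {s t : ℝ≥0} (hst : s ≤ t)
    {G : Ω → ℝ} (hG : Measurable[ℱ s] G) (hG2 : MemLp G 2 P) :
    MemLp (fun ω => G ω * (M t ω - M s ω)) 2 P := by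
  refine (memLp_two_iff_integrable_sq
    (hG2.aestronglyMeasurable.mul (hM.memLp_inc hst).aestronglyMeasurable)).2 ?_
  have h := ((hM.indepFun_inc hst hG).comp (measurable_id.pow_const 2)
    (measurable_id.pow_const 2)).integrable_mul hG2.integrable_sq (hM.memLp_inc hst).integrable_sq
  refine h.congr (Eventually.of_forall fun ω => ?_)
  simp [mul_pow]

/-- The covariance of two weighted Brownian increments. -/
lemma IsFilteredBM.integral_mul_inc_mul_inc (hM : IsFilteredBM ℱ P M) {a b c d : ℝ≥0}
    (hab : a ≤ b) (hcd : c ≤ d) (hac : a ≤ c) {G K : Ω → ℝ}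
    (hG : Measurable[ℱ a] G) (hG2 : MemLp G 2 P) (hK : Measurable[ℱ c] K) (hK2 : MemLp K 2 P) :
    ∫ ω, (G ω * (M b ω - M a ω)) * (K ω * (M d ω - M c ω)) ∂P =
      (∫ ω, G ω * K ω ∂P) * max (min (b : ℝ) d - c) 0 := by
  have meas : ∀ {u v : ℝ≥0}, u ≤ v → v ≤ c → Measurable[ℱ c] (fun ω => M v ω - M u ω) :=
    fun huv hvc => (hM.measurable_inc huv).mono (ℱ.mono hvc) le_rfl
  have hGc : Measurable[ℱ c] G := hG.mono (ℱ.mono hac) le_rfl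
  rcases le_total b c with hbc | hcb
  · have e : max (min (b : ℝ) d - c) 0 = 0 := max_eq_right (by
      have : (b : ℝ) ≤ c := hbc
      linarith [min_le_left (b : ℝ) d])
    rw [e, mul_zero, ← hM.integral_mul_inc hcd (G := fun ω => G ω * (M b ω - M a ω) * K ω)
      ((hGc.mul (meas hab hbc)).mul hK)]
    exact integral_congr_ae (Eventually.of_forall fun ω => by simp only; ring)
  -- Intervals with a common right end m: split the longer one at c. The piece before c is known at
  -- time c, so its product with the later increment has mean zero. The remaining cases reduce to
  -- this one by cutting at the smaller right end.
  have key : ∀ m : ℝ≥0, c ≤ m → ∫ ω, (G ω * (M m ω - M a ω)) * (K ω * (M m ω - M c ω)) ∂P =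
      (∫ ω, G ω * K ω ∂P) * (m - c) := fun m hcm => by
    have i1 : Integrable (fun ω => (G ω * (M c ω - M a ω)) * (K ω * (M m ω - M c ω))) P :=
      (hM.memLp_mul_inc hac hG hG2).integrable_mul (hM.memLp_mul_inc hcm hK hK2)
    have i2 : Integrable (fun ω => (G ω * (M m ω - M c ω)) * (K ω * (M m ω - M c ω))) P :=
      (hM.memLp_mul_inc hcm hGc hG2).integrable_mul (hM.memLp_mul_inc hcm hK hK2)
    have e : ∀ ω, (G ω * (M m ω - M a ω)) * (K ω * (M m ω - M c ω)) =
        (G ω * (M c ω - M a ω)) * (K ω * (M m ω - M c ω)) +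
        (G ω * (M m ω - M c ω)) * (K ω * (M m ω - M c ω)) := fun ω => by ring
    simp only [e]
    rw [integral_add i1 i2, ← hM.integral_mul_inc_sq hcm (G := fun ω => G ω * K ω)
      (hGc.mul hK)]
    have z := hM.integral_mul_inc hcm (G := fun ω => G ω * (M c ω - M a ω) * K ω)
      ((hGc.mul (meas hac le_rfl)).mul hK)
    simp only [mul_assoc] at z ⊢
    rw [z, zero_add]
    exact integral_congr_ae (Eventually.of_forall fun ω => by simp only; ring)
  rcases le_total b d with hbd | hdb
  · have e : max (min (b : ℝ) d - c) 0 = b - c := by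
      rw [min_eq_left (NNReal.coe_le_coe.2 hbd), max_eq_left (sub_nonneg.2 (NNReal.coe_le_coe.2 hcb))]
    have hKb : Measurable[ℱ b] K := hK.mono (ℱ.mono hcb) le_rfl
    have i1 : Integrable (fun ω => (G ω * (M b ω - M a ω)) * (K ω * (M b ω - M c ω))) P :=
      (hM.memLp_mul_inc hab hG hG2).integrable_mul (hM.memLp_mul_inc hcb hK hK2)
    have i2 : Integrable (fun ω => (G ω * (M b ω - M a ω)) * (K ω * (M d ω - M b ω))) P :=
      (hM.memLp_mul_inc hab hG hG2).integrable_mul (hM.memLp_mul_inc hbd hKb hK2)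
    have e2 : ∀ ω, (G ω * (M b ω - M a ω)) * (K ω * (M d ω - M c ω)) =
        (G ω * (M b ω - M a ω)) * (K ω * (M b ω - M c ω)) +
        (G ω * (M b ω - M a ω)) * (K ω * (M d ω - M b ω)) := fun ω => by ring
    simp only [e2]
    rw [integral_add i1 i2, key b hcb, e]
    have z := hM.integral_mul_inc hbd (G := fun ω => G ω * (M b ω - M a ω) * K ω)
      (((hG.mono (ℱ.mono hab) le_rfl).mul (hM.measurable_inc hab)).mul hKb)
    simp only [mul_assoc] at z ⊢
    rw [z, add_zero]
  · have e : max (min (b : ℝ) d - c) 0 = d - c := by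
      rw [min_eq_right (NNReal.coe_le_coe.2 hdb), max_eq_left (sub_nonneg.2 (NNReal.coe_le_coe.2 hcd))]
    have had : a ≤ d := hac.trans hcd
    have hGd : Measurable[ℱ d] G := hG.mono (ℱ.mono had) le_rfl
    have hKd : Measurable[ℱ d] K := hK.mono (ℱ.mono hcd) le_rfl
    have i1 : Integrable (fun ω => (G ω * (M d ω - M a ω)) * (K ω * (M d ω - M c ω))) P :=
      (hM.memLp_mul_inc had hG hG2).integrable_mul (hM.memLp_mul_inc hcd hK hK2)
    have i2 : Integrable (fun ω => (G ω * (M b ω - M d ω)) * (K ω * (M d ω - M c ω))) P :=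
      (hM.memLp_mul_inc hdb hGd hG2).integrable_mul (hM.memLp_mul_inc hcd hK hK2)
    have e2 : ∀ ω, (G ω * (M b ω - M a ω)) * (K ω * (M d ω - M c ω)) =
        (G ω * (M d ω - M a ω)) * (K ω * (M d ω - M c ω)) +
        (G ω * (M b ω - M d ω)) * (K ω * (M d ω - M c ω)) := fun ω => by ring
    simp only [e2]
    rw [integral_add i1 i2, key d hcd, e]
    have z := hM.integral_mul_inc hdb (G := fun ω => G ω * (K ω * (M d ω - M c ω)))
      (hGd.mul (hKd.mul (hM.measurable_inc hcd)))
    have z' : ∫ ω, (G ω * (M b ω - M d ω)) * (K ω * (M d ω - M c ω)) ∂P = 0 := by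
      rw [← z]
      exact integral_congr_ae (Eventually.of_forall fun ω => by simp only; ring)
    rw [z', add_zero]

/-- The measure `ds ⊗ P` on `[0, t] × Ω`. -/
noncomputable abbrev prodMeasure (P : Measure Ω) (t : ℝ≥0) : Measure (ℝ × Ω) :=
  ((volume : Measure ℝ).restrict (Set.Icc 0 (t : ℝ))).prod P

lemma memLp_indicator_Ioc [IsProbabilityMeasure P] (t a b : ℝ≥0) {G : Ω → ℝ} (hG2 : MemLp G 2 P) :
    MemLp (fun z : ℝ × Ω => Set.indicator (Set.Ioc (a : ℝ) b) (fun _ => G z.2) z.1) 2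
      (prodMeasure P t) := by
  have e : (fun z : ℝ × Ω => Set.indicator (Set.Ioc (a : ℝ) b) (fun _ => G z.2) z.1) =
      (Prod.fst ⁻¹' Set.Ioc (a : ℝ) b).indicator (fun z : ℝ × Ω => G z.2) := by
    ext z
    by_cases h : z.1 ∈ Set.Ioc (a : ℝ) b <;> simp [h, Set.indicator]
  rw [e]
  exact (hG2.comp_snd _).indicator (measurable_fst measurableSet_Ioc)

lemma IsFilteredBM.isometry_term [IsProbabilityMeasure P] (hM : IsFilteredBM ℱ P M)
    (t : ℝ≥0) {a b c d : ℝ≥0} (hab : a ≤ b) (hcd : c ≤ d) (hac : a ≤ c) {G K : Ω → ℝ}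
    (hG : Measurable[ℱ a] G) (hG2 : MemLp G 2 P) (hK : Measurable[ℱ c] K) (hK2 : MemLp K 2 P) :
    ∫ ω, (G ω * (M (min b t) ω - M (min a t) ω)) * (K ω * (M (min d t) ω - M (min c t) ω)) ∂P =
    ∫ z, Set.indicator (Set.Ioc (a : ℝ) b) (fun _ => G z.2) z.1 *
      Set.indicator (Set.Ioc (c : ℝ) d) (fun _ => K z.2) z.1 ∂(prodMeasure P t) := by
  have hR : ∫ z, Set.indicator (Set.Ioc (a : ℝ) b) (fun _ => G z.2) z.1 *
      Set.indicator (Set.Ioc (c : ℝ) d) (fun _ => K z.2) z.1 ∂(prodMeasure P t) =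
      (∫ ω, G ω * K ω ∂P) * max (min (min (b : ℝ) d) t - c) 0 := by
    have e : ∀ z : ℝ × Ω, Set.indicator (Set.Ioc (a : ℝ) b) (fun _ => G z.2) z.1 *
      Set.indicator (Set.Ioc (c : ℝ) d) (fun _ => K z.2) z.1 =
      Set.indicator (Set.Ioc (c : ℝ) (min b d)) (fun _ => (1 : ℝ)) z.1 * (G z.2 * K z.2) :=
      fun z => by
        have hac' : (a : ℝ) ≤ c := hac
        have : Set.Ioc (c : ℝ) (min b d) = Set.Ioc (a : ℝ) b ∩ Set.Ioc (c : ℝ) d := by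
          rw [Set.Ioc_inter_Ioc, max_eq_right hac']
        rw [this]
        by_cases h : z.1 ∈ Set.Ioc (a : ℝ) b <;> by_cases h' : z.1 ∈ Set.Ioc (c : ℝ) d <;>
          simp [h, h', Set.indicator]
    simp only [e]
    rw [integral_prod_mul (Set.indicator (Set.Ioc (c : ℝ) (min b d)) fun _ => (1 : ℝ))
      (fun ω => G ω * K ω), integral_indicator_const _ measurableSet_Ioc,
      measureReal_restrict_apply measurableSet_Ioc, mul_comm, smul_eq_mul, mul_one]
    congr 1
    have e2 : Set.Ioc (c : ℝ) (min b d) ∩ Set.Icc 0 (t : ℝ) =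
        Set.Ioc (c : ℝ) (min (min b d) t) := by
      ext x
      simp only [Set.mem_inter_iff, Set.mem_Ioc, Set.mem_Icc, le_min_iff]
      have := c.2
      constructor
      · rintro ⟨⟨h1, h2, h3⟩, h4, h5⟩; exact ⟨h1, ⟨h2, h3⟩, h5⟩
      · rintro ⟨h1, ⟨h2, h3⟩, h5⟩; exact ⟨⟨h1, h2, h3⟩, (this.trans_lt h1).le, h5⟩
    rw [e2, Measure.real, Real.volume_Ioc, ENNReal.toReal_ofReal']
  rw [hR]
  rcases le_total t c with htc | hct
  · have e : max (min (min (b : ℝ) d) t - c) 0 = 0 := max_eq_right (by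
      have : (t : ℝ) ≤ c := htc
      linarith [min_le_right (min (b : ℝ) d) t])
    rw [e, min_eq_right htc, min_eq_right (htc.trans hcd)]
    simp
  · rw [min_eq_left hct, min_eq_left (hac.trans hct), hM.integral_mul_inc_mul_inc
      (le_min hab (hac.trans hct)) (le_min hcd hct) hac hG hG2 hK hK2]
    push_cast
    congr 3
    rw [min_min_min_comm, min_self]

lemma IsFilteredBM.isometry_term' [IsProbabilityMeasure P] (hM : IsFilteredBM ℱ P M)
    (t : ℝ≥0) {a b c d : ℝ≥0} (hab : a ≤ b) (hcd : c ≤ d) {G K : Ω → ℝ}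
    (hG : Measurable[ℱ a] G) (hG2 : MemLp G 2 P) (hK : Measurable[ℱ c] K) (hK2 : MemLp K 2 P) :
    ∫ ω, (G ω * (M (min b t) ω - M (min a t) ω)) * (K ω * (M (min d t) ω - M (min c t) ω)) ∂P =
    ∫ z, Set.indicator (Set.Ioc (a : ℝ) b) (fun _ => G z.2) z.1 *
      Set.indicator (Set.Ioc (c : ℝ) d) (fun _ => K z.2) z.1 ∂(prodMeasure P t) := by
  rcases le_total a c with hac | hca
  · exact hM.isometry_term t hab hcd hac hG hG2 hK hK2
  · have := hM.isometry_term t hcd hab hca hK hK2 hG hG2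
    simpa only [mul_comm] using this

lemma IsFilteredBM.memLp_term [IsProbabilityMeasure P] (hM : IsFilteredBM ℱ P M)
    (t : ℝ≥0) {a b : ℝ≥0} (hab : a ≤ b) {G : Ω → ℝ}
    (hG : Measurable[ℱ a] G) (hG2 : MemLp G 2 P) :
    MemLp (fun ω => G ω * (M (min b t) ω - M (min a t) ω)) 2 P := by
  rcases le_total t a with hta | hat
  · rw [min_eq_right hta, min_eq_right (hta.trans hab)]
    simp
  · rw [min_eq_left hat]
    exact hM.memLp_mul_inc (le_min hab hat) hG hG2

lemma IsFilteredBM.memLp_integral [IsProbabilityMeasure P] (hM : IsFilteredBM ℱ P M)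
    (S : SimpleProc ℱ P) (t : ℝ≥0) : MemLp (S.integral M t) 2 P :=
  memLp_finsetSum _ fun i _ =>
    hM.memLp_term t (S.time_mono i.le_succ) (S.coeff_meas i) (S.coeff_sq i)

lemma SimpleProc.memLp_val [IsProbabilityMeasure P] (S : SimpleProc ℱ P) (t : ℝ≥0) :
    MemLp (fun z : ℝ × Ω => S.val z.1 z.2) 2 (prodMeasure P t) :=
  memLp_finsetSum _ fun i _ => memLp_indicator_Ioc t _ _ (S.coeff_sq i)

/-- The isometry in bilinear form. Overlaps are treated term by term for arbitrary pairs of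
intervals, so the two partitions need no common refinement. -/
lemma IsFilteredBM.integral_mul_integral [IsProbabilityMeasure P] (hM : IsFilteredBM ℱ P M)
    (S T : SimpleProc ℱ P) (t : ℝ≥0) :
    ∫ ω, S.integral M t ω * T.integral M t ω ∂P =
      ∫ z, S.val z.1 z.2 * T.val z.1 z.2 ∂(prodMeasure P t) := by
  simp only [SimpleProc.integral, SimpleProc.val, Finset.sum_mul_sum]
  rw [integral_finsetSum, integral_finsetSum]
  · refine Finset.sum_congr rfl fun i _ => ?_
    rw [integral_finsetSum, integral_finsetSum]
    · refine Finset.sum_congr rfl fun j _ => ?_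
      exact hM.isometry_term' t (S.time_mono i.le_succ) (T.time_mono j.le_succ) (S.coeff_meas i)
        (S.coeff_sq i) (T.coeff_meas j) (T.coeff_sq j)
    · exact fun j _ => (memLp_indicator_Ioc t _ _ (S.coeff_sq i)).integrable_mul
        (memLp_indicator_Ioc t _ _ (T.coeff_sq j))
    · exact fun j _ => (hM.memLp_term t (S.time_mono i.le_succ) (S.coeff_meas i)
        (S.coeff_sq i)).integrable_mul (hM.memLp_term t (T.time_mono j.le_succ) (T.coeff_meas j)
        (T.coeff_sq j))
  · exact fun i _ => integrable_finsetSum _ fun j _ =>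
      (memLp_indicator_Ioc t _ _ (S.coeff_sq i)).integrable_mul
        (memLp_indicator_Ioc t _ _ (T.coeff_sq j))
  · exact fun i _ => integrable_finsetSum _ fun j _ =>
      (hM.memLp_term t (S.time_mono i.le_succ) (S.coeff_meas i)
        (S.coeff_sq i)).integrable_mul (hM.memLp_term t (T.time_mono j.le_succ) (T.coeff_meas j)
        (T.coeff_sq j))

lemma eLpNorm_two_eq {α : Type*} {m : MeasurableSpace α} {μ : Measure α} {f : α → ℝ}
    (hf : MemLp f 2 μ) : eLpNorm f 2 μ = ENNReal.ofReal ((∫ x, f x ^ 2 ∂μ) ^ (2 : ℝ)⁻¹) := by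
  rw [hf.eLpNorm_eq_integral_rpow_norm two_ne_zero ENNReal.ofNat_ne_top]
  simp

/-- The Itô isometry for the difference of two simple processes. -/
lemma IsFilteredBM.eLpNorm_integral_sub [IsProbabilityMeasure P] (hM : IsFilteredBM ℱ P M)
    (S T : SimpleProc ℱ P) (t : ℝ≥0) :
    eLpNorm (S.integral M t - T.integral M t) 2 P =
      eLpNorm ((fun z : ℝ × Ω => S.val z.1 z.2) - fun z => T.val z.1 z.2) 2
        (prodMeasure P t) := by
  have hs := hM.memLp_integral S t
  have ht := hM.memLp_integral T t
  have hs' := S.memLp_val t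
  have ht' := T.memLp_val t
  rw [eLpNorm_two_eq (hs.sub ht), eLpNorm_two_eq (hs'.sub ht')]
  congr 2
  have e : ∀ x y : ℝ, (x - y) ^ 2 = x * x - 2 * (x * y) + y * y := fun x y => by ring
  simp only [Pi.sub_apply, e]
  rw [integral_add, integral_sub, integral_const_mul, integral_add, integral_sub,
    integral_const_mul, hM.integral_mul_integral, hM.integral_mul_integral,
    hM.integral_mul_integral]
  · exact hs'.integrable_mul hs'
  · exact (hs'.integrable_mul ht').const_mul 2
  · exact (hs'.integrable_mul hs').sub ((hs'.integrable_mul ht').const_mul 2)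
  · exact ht'.integrable_mul ht'
  · exact hs.integrable_mul hs
  · exact (hs.integrable_mul ht).const_mul 2
  · exact (hs.integrable_mul hs).sub ((hs.integrable_mul ht).const_mul 2)
  · exact ht.integrable_mul ht

/-- Simple processes converging in `L²([0, t] × Ω)` have convergent elementary integrals. -/
lemma IsFilteredBM.exists_isItoIntegral [IsProbabilityMeasure P] (hM : IsFilteredBM ℱ P M)
    (t : ℝ≥0) {φ : ℝ → Ω → ℝ} (hφ : MemLp (fun z : ℝ × Ω => φ z.1 z.2) 2 (prodMeasure P t))
    (S : ℕ → SimpleProc ℱ P)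
    (hS : Tendsto (fun k => eLpNorm (fun z : ℝ × Ω => (S k).val z.1 z.2 - φ z.1 z.2) 2
      (prodMeasure P t)) atTop (𝓝 0)) :
    ∃ I : Ω → ℝ, IsItoIntegral ℱ P M t φ I := by
  have hv := (Lp.tendsto_Lp_iff_tendsto_eLpNorm'' (fun k (z : ℝ × Ω) => (S k).val z.1 z.2)
    (fun k => (S k).memLp_val t) _ hφ).2 hS
  have hc := hv.cauchySeq
  -- By the isometry the distances between integrals equal those between integrands, so the Cauchy
  -- property transfers and completeness of L² gives the limit.
  have hc' : CauchySeq (fun k => (hM.memLp_integral (S k) t).toLp) := by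
    rw [EMetric.cauchySeq_iff] at hc ⊢
    simp only [Lp.edist_toLp_toLp] at hc ⊢
    simpa only [hM.eLpNorm_integral_sub] using! hc
  obtain ⟨J, hJ⟩ := cauchySeq_tendsto_of_complete hc'
  refine ⟨J, hφ, Lp.memLp J, S, hS, ?_⟩
  have := (Lp.tendsto_Lp_iff_tendsto_eLpNorm'' (fun k => (S k).integral M t)
    (fun k => hM.memLp_integral (S k) t) J (Lp.memLp J)).1 (by rwa [Lp.toLp_coeFn])
  exact this

lemma tendsto_eLpNorm_sub_of_tendsto {α : Type*} {m : MeasurableSpace α} {μ : Measure α}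
    {f g : ℕ → α → ℝ} {h : α → ℝ} (hf : ∀ k, MemLp (f k) 2 μ) (hg : ∀ k, MemLp (g k) 2 μ)
    (hh : MemLp h 2 μ) (hfh : Tendsto (fun k => eLpNorm (fun x => f k x - h x) 2 μ) atTop (𝓝 0))
    (hgf : Tendsto (fun k => eLpNorm (g k - f k) 2 μ) atTop (𝓝 0)) :
    Tendsto (fun k => eLpNorm (fun x => g k x - h x) 2 μ) atTop (𝓝 0) := by
  have hs := hgf.add hfh
  rw [add_zero] at hs
  refine tendsto_of_tendsto_of_tendsto_of_le_of_le tendsto_const_nhds hs (fun _ => zero_le)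
    fun k => ?_
  have := eLpNorm_add_le (μ := μ) (p := 2) ((hg k).sub (hf k)).aestronglyMeasurable
    ((hf k).sub hh).aestronglyMeasurable (by norm_num)
  rwa [sub_add_sub_cancel] at this

/-- The Itô integral is the `L²`-limit of the elementary integrals of any approximating sequence of
simple processes. -/
theorem IsFilteredBM.tendsto_itoIntegral [IsProbabilityMeasure P] (hM : IsFilteredBM ℱ P M)
    (t : ℝ≥0) {φ : ℝ → Ω → ℝ} (hφ : MemLp (fun z : ℝ × Ω => φ z.1 z.2) 2 (prodMeasure P t))
    (S : ℕ → SimpleProc ℱ P)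
    (hS : Tendsto (fun k => eLpNorm (fun z : ℝ × Ω => (S k).val z.1 z.2 - φ z.1 z.2) 2
      (prodMeasure P t)) atTop (𝓝 0)) :
    MemLp (itoIntegral ℱ P M t φ) 2 P ∧
    Tendsto (fun k => eLpNorm (fun ω => (S k).integral M t ω - itoIntegral ℱ P M t φ ω) 2 P)
      atTop (𝓝 0) := by
  have hex := hM.exists_isItoIntegral t hφ S hS
  have hI : IsItoIntegral ℱ P M t φ (itoIntegral ℱ P M t φ) := by
    rw [itoIntegral, dif_pos hex]
    exact hex.choose_spec
  obtain ⟨-, hI2, T, hT, hTI⟩ := hI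
  refine ⟨hI2, tendsto_eLpNorm_sub_of_tendsto (fun k => hM.memLp_integral (T k) t)
    (fun k => hM.memLp_integral (S k) t) hI2 hTI ?_⟩
  -- T is the sequence attached to the chosen version of the integral. Both S and T approximate φ,
  -- so by the isometry their integrals have the same limit.
  simp only [hM.eLpNorm_integral_sub]
  have hs := hS.add hT
  rw [add_zero] at hs
  refine tendsto_of_tendsto_of_tendsto_of_le_of_le tendsto_const_nhds hs (fun _ => zero_le)
    fun k => ?_
  have hTm := ((T k).memLp_val t).sub hφ
  have hSm := ((S k).memLp_val t).sub hφ
  have := eLpNorm_sub_le (μ := prodMeasure P t) (p := 2) hSm.aestronglyMeasurable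
    hTm.aestronglyMeasurable (by norm_num)
  rwa [sub_sub_sub_cancel_right] at this

end Ito
end FSABR

namespace FSABR

/-! ### Convergence in `L²` -/

section L2

variable {α : Type*} {m : MeasurableSpace α} {μ : Measure α}

lemma tendsto_integral_sq_of_tendsto_eLpNorm {f : ℕ → α → ℝ} {g : α → ℝ}
    (hf : ∀ k, MemLp (f k) 2 μ) (hg : MemLp g 2 μ)
    (h : Tendsto (fun k => eLpNorm (fun x => f k x - g x) 2 μ) atTop (𝓝 0)) :
    Tendsto (fun k => ∫ x, f k x ^ 2 ∂μ) atTop (𝓝 (∫ x, g x ^ 2 ∂μ)) := by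
  have h1 := ((Lp.tendsto_Lp_iff_tendsto_eLpNorm'' f hf g hg).2 h).norm.pow 2
  have e : ∀ {u : α → ℝ} (hu : MemLp u 2 μ), ‖hu.toLp‖ ^ 2 = ∫ x, u x ^ 2 ∂μ := fun {u} hu => by
    have h0 : 0 ≤ ∫ x, u x ^ 2 ∂μ := integral_nonneg fun x => sq_nonneg _
    rw [Lp.norm_toLp, eLpNorm_two_eq hu, ENNReal.toReal_ofReal (by positivity),
      ← Real.rpow_natCast, ← Real.rpow_mul h0]
    norm_num
  simpa only [e] using h1

lemma exists_subseq_tendsto_ae {f : ℕ → α → ℝ} {g : α → ℝ}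
    (hf : ∀ k, MemLp (f k) 2 μ) (hg : MemLp g 2 μ)
    (h : Tendsto (fun k => eLpNorm (fun x => f k x - g x) 2 μ) atTop (𝓝 0)) :
    ∃ ns : ℕ → ℕ, StrictMono ns ∧ ∀ᵐ x ∂μ, Tendsto (fun k => f (ns k) x) atTop (𝓝 (g x)) :=
  (tendstoInMeasure_of_tendsto_eLpNorm two_ne_zero (fun k => (hf k).aestronglyMeasurable)
    hg.aestronglyMeasurable h).exists_seq_tendsto_ae

/-- A sequence bounded in `L⁴` that converges almost everywhere converges in `L²`. -/
lemma tendsto_eLpNorm_two_of_bounded_four [IsFiniteMeasure μ] {f : ℕ → α → ℝ} {g : α → ℝ}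
    (hf : ∀ k, AEStronglyMeasurable (f k) μ) (C : ℝ≥0) (hC : ∀ k, eLpNorm (f k) 4 μ ≤ C)
    (hfg : ∀ᵐ x ∂μ, Tendsto (fun k => f k x) atTop (𝓝 (g x))) :
    MemLp g 2 μ ∧ Tendsto (fun k => eLpNorm (fun x => f k x - g x) 2 μ) atTop (𝓝 0) := by
  have hg : MemLp g 2 μ := by
    have hgm := aestronglyMeasurable_of_tendsto_ae atTop hf hfg
    have h4 : MemLp g 4 μ := ⟨hgm, by
      refine (Lp.eLpNorm_lim_le_liminf_eLpNorm hf g hfg).trans_lt ?_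
      refine lt_of_le_of_lt ?_ (ENNReal.coe_lt_top (r := C))
      exact liminf_le_of_le (by isBoundedDefault) fun b hb => by
        obtain ⟨k, hk⟩ := hb.exists
        exact hk.trans (hC k)⟩
    exact h4.mono_exponent (by norm_num)
  refine ⟨hg, ?_⟩
  refine tendsto_Lp_finite_of_tendsto_ae (by norm_num) (by norm_num) hf hg ?_ hfg
  refine unifIntegrable_of (by norm_num) (by norm_num) hf fun ε hε => ?_
  -- Where |f| ≥ D one has |f| ≤ |f|²/D, so the tail has L² norm at most C²/D ≤ ε. The added 1 keeps
  -- D positive when C = 0.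
  refine ⟨(C ^ 2 + 1) / ε.toNNReal, fun k => ?_⟩
  set D : ℝ≥0 := (C ^ 2 + 1) / ε.toNNReal with hD
  have hε' : 0 < ε.toNNReal := Real.toNNReal_pos.2 hε
  have hDpos : 0 < D := by positivity
  have h1 : eLpNorm ({x | D ≤ ‖f k x‖₊}.indicator (f k)) 2 μ ≤
      eLpNorm ((D : ℝ)⁻¹ • fun x => ‖f k x‖ ^ (2 : ℝ)) 2 μ := by
    refine eLpNorm_mono fun x => ?_
    by_cases hx : D ≤ ‖f k x‖₊
    · have hx' : (D : ℝ) ≤ ‖f k x‖ := hx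
      have hDpos' : (0 : ℝ) < D := hDpos
      rw [Set.indicator_of_mem (by exact hx)]
      simp only [Pi.smul_apply, smul_eq_mul, Real.rpow_ofNat]
      rw [Real.norm_of_nonneg (r := (D : ℝ)⁻¹ * ‖f k x‖ ^ 2) (by positivity), inv_mul_eq_div,
        le_div_iff₀ hDpos']
      nlinarith [norm_nonneg (f k x)]
    · rw [Set.indicator_of_notMem (by exact hx), norm_zero]
      exact norm_nonneg _
  refine h1.trans ?_
  rw [eLpNorm_const_smul, eLpNorm_norm_rpow _ (by norm_num)]
  have e : (2 : ℝ≥0∞) * ENNReal.ofReal 2 = 4 := by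
    rw [ENNReal.ofReal_ofNat]; norm_num
  rw [e]
  have h2 : eLpNorm (f k) 4 μ ^ (2 : ℝ) ≤ (C : ℝ≥0∞) ^ 2 := by
    rw [ENNReal.rpow_ofNat]
    exact pow_le_pow_left₀ zero_le (hC k) 2
  have h3 : ‖(D : ℝ)⁻¹‖ₑ = ((D⁻¹ : ℝ≥0) : ℝ≥0∞) := by
    rw [← NNReal.coe_inv]
    exact enorm_eq_nnnorm _ |>.trans (by simp)
  rw [h3]
  refine (mul_le_mul_right h2 _).trans ?_
  rw [ENNReal.ofReal, ← ENNReal.coe_pow, ← ENNReal.coe_mul, ENNReal.coe_le_coe, hD, inv_div,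
    div_mul_eq_mul_div, div_le_iff₀ (by positivity)]
  gcongr
  exact le_self_add

end L2

/-! ### Uniform step approximations -/

section Step

variable {Ω : Type*} {mΩ : MeasurableSpace Ω} {P : Measure Ω} {ℱ : Filtration ℝ≥0 mΩ}

/-- The point `t j / n` of the uniform grid on `[0, t]`. -/
noncomputable def grid (t : ℝ≥0) (n j : ℕ) : ℝ≥0 := t * (j / n)

/-- The index of the grid interval `(t j / n, t (j + 1) / n]` containing `s`. -/
noncomputable def gridIdx (t : ℝ≥0) (n : ℕ) (s : ℝ) : ℕ := ⌈s * n / t⌉₊ - 1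

lemma monotone_grid (t : ℝ≥0) (n : ℕ) : Monotone (grid t n) := fun i j hij => by
  unfold grid
  gcongr

lemma coe_grid (t : ℝ≥0) (n j : ℕ) : (grid t n j : ℝ) = t * (j / n) := by simp [grid]

lemma mem_Ioc_grid_iff (t : ℝ≥0) (ht : 0 < t) {n : ℕ} (hn : 0 < n) {s : ℝ} (hs : 0 < s) (j : ℕ) :
    s ∈ Set.Ioc (grid t n j : ℝ) (grid t n (j + 1)) ↔ j = gridIdx t n s := by
  have ht' : (0 : ℝ) < t := ht
  have hn' : (0 : ℝ) < n := by exact_mod_cast hn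
  -- Positivity makes the truncated subtraction in `gridIdx` exact.
  have hpos : 0 < ⌈s * n / t⌉₊ := Nat.ceil_pos.2 (by positivity)
  have e1 : (grid t n j : ℝ) < s ↔ (j : ℝ) < s * n / t := by
    rw [coe_grid, lt_div_iff₀ ht', mul_div_assoc', div_lt_iff₀ hn', mul_comm (t : ℝ)]
  have e2 : s ≤ grid t n (j + 1) ↔ s * n / t ≤ ((j + 1 : ℕ) : ℝ) := by
    rw [coe_grid, div_le_iff₀ ht', mul_div_assoc', le_div_iff₀ hn', mul_comm (t : ℝ)]
  rw [Set.mem_Ioc, e1, e2, ← Nat.lt_ceil, ← Nat.ceil_le, gridIdx]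
  omega

lemma gridIdx_lt (t : ℝ≥0) (ht : 0 < t) {n : ℕ} (hn : 0 < n) {s : ℝ} (hs : s ∈ Set.Ioc 0 (t : ℝ)) :
    gridIdx t n s < n := by
  have ht' : (0 : ℝ) < t := ht
  have hn' : (0 : ℝ) < n := by exact_mod_cast hn
  have h : ⌈s * n / t⌉₊ ≤ n := Nat.ceil_le.2 (by
    rw [div_le_iff₀ ht', mul_comm]
    exact mul_le_mul_of_nonneg_left hs.2 hn'.le)
  unfold gridIdx
  omega

lemma grid_gridIdx_le (t : ℝ≥0) (ht : 0 < t) {n : ℕ} (hn : 0 < n) {s : ℝ}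
    (hs : s ∈ Set.Ioc 0 (t : ℝ)) : grid t n (gridIdx t n s) ≤ t := by
  have h := ((mem_Ioc_grid_iff t ht hn hs.1 _).2 rfl).1
  exact NNReal.coe_le_coe.1 (h.le.trans hs.2)

lemma tendsto_grid_gridIdx (t : ℝ≥0) (ht : 0 < t) {s : ℝ} (hs : s ∈ Set.Ioc 0 (t : ℝ)) :
    Tendsto (fun n => grid t (n + 1) (gridIdx t (n + 1) s)) atTop (𝓝 s.toNNReal) := by
  rw [← NNReal.tendsto_coe, Real.coe_toNNReal _ hs.1.le]
  have hlim : Tendsto (fun n : ℕ => s - t * (1 / ((n : ℝ) + 1))) atTop (𝓝 s) := by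
    have := (tendsto_one_div_add_atTop_nhds_zero_nat (𝕜 := ℝ)).const_mul (t : ℝ)
    simpa using tendsto_const_nhds.sub this
  refine tendsto_of_tendsto_of_tendsto_of_le_of_le hlim tendsto_const_nhds (fun n => ?_)
    (fun n => ?_)
  · have h := ((mem_Ioc_grid_iff t ht n.succ_pos hs.1 _).2 rfl).2
    rw [coe_grid] at h ⊢
    simp only [Nat.succ_eq_add_one] at h
    push_cast at h ⊢
    have e : (t : ℝ) * (((gridIdx t (n + 1) s : ℝ) + 1) / (n + 1)) =
      t * (gridIdx t (n + 1) s / (n + 1)) + t * (1 / (n + 1)) := by ring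
    linarith
  · exact ((mem_Ioc_grid_iff t ht n.succ_pos hs.1 _).2 rfl).1.le

/-- The step process with value `X (t j / n)` on `(t j / n, t (j + 1) / n]`. -/
noncomputable def stepProc (t : ℝ≥0) {X : ℝ≥0 → Ω → ℝ} (hX : Adapted ℱ X)
    (hX2 : ∀ s, MemLp (X s) 2 P) (n : ℕ) : SimpleProc ℱ P where
  n := n
  time := grid t n
  time_mono := monotone_grid t n
  coeff := fun i => X (grid t n i)
  coeff_meas := fun i => hX (grid t n i)
  coeff_sq := fun i => hX2 (grid t n i)

lemma stepProc_val (t : ℝ≥0) (ht : 0 < t) {X : ℝ≥0 → Ω → ℝ} (hX : Adapted ℱ X)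
    (hX2 : ∀ s, MemLp (X s) 2 P) {n : ℕ} (hn : 0 < n) {s : ℝ} (hs : s ∈ Set.Ioc 0 (t : ℝ)) (ω : Ω) :
    (stepProc t hX hX2 n).val s ω = X (grid t n (gridIdx t n s)) ω := by
  unfold SimpleProc.val stepProc
  simp only
  rw [Finset.sum_eq_single (gridIdx t n s)]
  · rw [Set.indicator_of_mem ((mem_Ioc_grid_iff t ht hn hs.1 _).2 rfl)]
  · intro j _ hj
    rw [Set.indicator_of_notMem (fun h => hj ((mem_Ioc_grid_iff t ht hn hs.1 _).1 h))]
  · intro h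
    exact absurd (Finset.mem_range.2 (gridIdx_lt t ht hn hs)) h

lemma ae_prodMeasure_mem_Ioc (P : Measure Ω) [IsProbabilityMeasure P] (t : ℝ≥0) :
    ∀ᵐ z ∂(prodMeasure P t), z.1 ∈ Set.Ioc 0 (t : ℝ) := by
  have h : ∀ᵐ s ∂(volume : Measure ℝ).restrict (Set.Icc 0 (t : ℝ)), s ∈ Set.Ioc 0 (t : ℝ) := by
    rw [Measure.restrict_congr_set Ioc_ae_eq_Icc.symm]
    exact ae_restrict_mem measurableSet_Ioc
  exact Measure.quasiMeasurePreserving_fst.ae h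

/-- If `X` is bounded in `L⁴` on `[0, t]` and has almost surely continuous paths, its step
approximations converge in `L²([0, t] × Ω)`. -/
lemma tendsto_stepProc [IsProbabilityMeasure P] (t : ℝ≥0) (ht : 0 < t) {X Z : ℝ≥0 → Ω → ℝ}
    (hX : Adapted ℱ X) (hX2 : ∀ s, MemLp (X s) 2 P) (C : ℝ≥0)
    (hC : ∀ s ≤ t, ∫⁻ ω, ‖X s ω‖ₑ ^ (4 : ℝ) ∂P ≤ C) (hXZ : ∀ s, X s =ᵐ[P] Z s)
    (hZ : ∀ᵐ ω ∂P, Continuous fun s => Z s ω) :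
    MemLp (fun z : ℝ × Ω => Z z.1.toNNReal z.2) 2 (prodMeasure P t) ∧
    Tendsto (fun n => eLpNorm (fun z : ℝ × Ω => (stepProc t hX hX2 (n + 1)).val z.1 z.2 -
      Z z.1.toNNReal z.2) 2 (prodMeasure P t)) atTop (𝓝 0) := by
  have hval : ∀ n : ℕ, ∀ᵐ z ∂(prodMeasure P t), (stepProc t hX hX2 (n + 1)).val z.1 z.2 =
      X (grid t (n + 1) (gridIdx t (n + 1) z.1)) z.2 := fun n => by
    filter_upwards [ae_prodMeasure_mem_Ioc P t] with z hz
    exact stepProc_val t ht hX hX2 n.succ_pos hz z.2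
  -- X is adapted but possibly irregular, Z is continuous but possibly not adapted. Only countably
  -- many grid points occur, so one null set suffices for the steps of X to follow the path of Z.
  have hXZ' : ∀ᵐ ω ∂P, ∀ n j : ℕ, X (grid t n j) ω = Z (grid t n j) ω :=
    ae_all_iff.2 fun n => ae_all_iff.2 fun j => hXZ _
  have hconv : ∀ᵐ z ∂(prodMeasure P t), Tendsto
      (fun n => (stepProc t hX hX2 (n + 1)).val z.1 z.2) atTop (𝓝 (Z z.1.toNNReal z.2)) := by
    filter_upwards [ae_prodMeasure_mem_Ioc P t, ae_all_iff.2 hval,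
      Measure.quasiMeasurePreserving_snd.ae (hXZ'.and hZ)] with z hz h1 h2
    simp only [h1, h2.1]
    exact (h2.2.tendsto _).comp (tendsto_grid_gridIdx t ht hz)
  refine tendsto_eLpNorm_two_of_bounded_four
    (fun n => ((stepProc t hX hX2 (n + 1)).memLp_val t).aestronglyMeasurable)
    ((t * C) ^ (4 : ℝ)⁻¹) (fun n => ?_) hconv
  have hm : AEMeasurable (fun z : ℝ × Ω => (stepProc t hX hX2 (n + 1)).val z.1 z.2)
    (prodMeasure P t) := ((stepProc t hX hX2 (n + 1)).memLp_val t).aestronglyMeasurable.aemeasurable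
  rw [eLpNorm_eq_lintegral_rpow_enorm_toReal (by norm_num) (by norm_num)]
  rw [show (4 : ℝ≥0∞).toReal = 4 by simp, one_div,
    ENNReal.coe_rpow_of_nonneg _ (by norm_num : (0 : ℝ) ≤ (4 : ℝ)⁻¹)]
  refine ENNReal.rpow_le_rpow ?_ (by norm_num)
  rw [lintegral_prod _ (hm.enorm.pow_const _)]
  have h2 : ∀ᵐ s ∂(volume : Measure ℝ).restrict (Set.Icc 0 (t : ℝ)),
      ∫⁻ ω, ‖(stepProc t hX hX2 (n + 1)).val s ω‖ₑ ^ (4 : ℝ) ∂P ≤ C := by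
    rw [Measure.restrict_congr_set Ioc_ae_eq_Icc.symm]
    filter_upwards [ae_restrict_mem measurableSet_Ioc] with s hs
    simp only [stepProc_val t ht hX hX2 n.succ_pos hs]
    exact hC _ (grid_gridIdx_le t ht n.succ_pos hs)
  refine (lintegral_mono_ae h2).trans ?_
  rw [lintegral_const, Measure.restrict_apply_univ, Real.volume_Icc, sub_zero, mul_comm]
  simp

end Step
end FSABR

namespace FSABR

/-! ### Characteristic functions of elementary integrals -/

section Wiener

variable {Ω : Type*} {mΩ : MeasurableSpace Ω} {P : Measure Ω} {ℱ : Filtration ℝ≥0 mΩ}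
  {M : ℝ≥0 → Ω → ℝ}

/-- Induction on n: the last increment is independent of ℱ (τ n), which contains all the earlier
ones, and contributes one Gaussian factor. -/
lemma IsFilteredBM.integral_cexp_sum [IsProbabilityMeasure P] (hM : IsFilteredBM ℱ P M)
    (a : ℕ → ℝ) {τ : ℕ → ℝ≥0} (hτ : Monotone τ) (n : ℕ) :
    ∫ ω, Complex.exp ((∑ i ∈ Finset.range n, a i * (M (τ (i + 1)) ω - M (τ i) ω) : ℝ) *
      Complex.I) ∂P =
      Complex.exp ((-(∑ i ∈ Finset.range n, a i ^ 2 * ((τ (i + 1) : ℝ) - τ i)) / 2 : ℝ)) := by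
  induction n with
  | zero => simp
  | succ n ih =>
    have hle := hτ n.le_succ
    have hm : Measurable[ℱ (τ n)]
        (fun ω => ∑ i ∈ Finset.range n, a i * (M (τ (i + 1)) ω - M (τ i) ω)) := by
      refine Finset.measurable_sum _ fun i hi => Measurable.const_mul ?_ _
      have h1 : i + 1 ≤ n := Finset.mem_range.1 hi
      exact (hM.measurable_inc (hτ i.le_succ)).mono (ℱ.mono (hτ h1)) le_rfl
    have hind := (hM.indepFun_inc hle hm).comp
      (φ := fun x : ℝ => Complex.exp (x * Complex.I))
      (ψ := fun x : ℝ => Complex.exp ((a n * x : ℝ) * Complex.I)) (by fun_prop) (by fun_prop)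
    have hmul := hind.integral_fun_mul_eq_mul_integral
      ((by fun_prop : Measurable fun x : ℝ => Complex.exp (x * Complex.I)).comp
        (hm.mono (ℱ.le _) le_rfl)).aestronglyMeasurable
      ((by fun_prop : Measurable fun x : ℝ => Complex.exp ((a n * x : ℝ) * Complex.I)).comp
        ((hM.measurable _).sub (hM.measurable _))).aestronglyMeasurable
    simp only [Function.comp_apply] at hmul
    have hlaw := (hM.hasLaw_inc hle).integral_comp
      (f := fun x : ℝ => Complex.exp ((a n * x : ℝ) * Complex.I))
      (Measurable.aestronglyMeasurable (by fun_prop))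
    simp only [Function.comp_apply] at hlaw
    have hcf := charFun_gaussianReal (μ := 0) (v := τ (n + 1) - τ n) (a n)
    rw [charFun_apply_real] at hcf
    have e : ∀ ω, Complex.exp ((∑ i ∈ Finset.range (n + 1),
        a i * (M (τ (i + 1)) ω - M (τ i) ω) : ℝ) * Complex.I) =
        Complex.exp ((∑ i ∈ Finset.range n, a i * (M (τ (i + 1)) ω - M (τ i) ω) : ℝ) *
          Complex.I) *
        Complex.exp ((a n * (M (τ (n + 1)) ω - M (τ n) ω) : ℝ) * Complex.I) := fun ω => by
      rw [← Complex.exp_add, Finset.sum_range_succ, ← add_mul]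
      push_cast; rfl
    simp only [e]
    rw [hmul, ih, hlaw]
    simp only [Complex.ofReal_mul, Nat.succ_eq_add_one] at hcf ⊢
    rw [hcf, ← Complex.exp_add, Finset.sum_range_succ, NNReal.coe_sub hle]
    congr 1
    push_cast
    ring

/-- The law of `∑ i < n, a i (M (τ (i + 1)) - M (τ i))` is Gaussian. -/
lemma IsFilteredBM.hasLaw_sum [IsProbabilityMeasure P] (hM : IsFilteredBM ℱ P M)
    (a : ℕ → ℝ) {τ : ℕ → ℝ≥0} (hτ : Monotone τ) (n : ℕ) :
    HasLaw (fun ω => ∑ i ∈ Finset.range n, a i * (M (τ (i + 1)) ω - M (τ i) ω))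
      (gaussianReal 0 (∑ i ∈ Finset.range n, a i ^ 2 * ((τ (i + 1) : ℝ) - τ i)).toNNReal) P := by
  have hm : Measurable (fun ω => ∑ i ∈ Finset.range n, a i * (M (τ (i + 1)) ω - M (τ i) ω)) :=
    Finset.measurable_sum _ fun i _ => ((hM.measurable _).sub (hM.measurable _)).const_mul _
  refine ⟨hm.aemeasurable, ?_⟩
  have : IsProbabilityMeasure (P.map fun ω =>
      ∑ i ∈ Finset.range n, a i * (M (τ (i + 1)) ω - M (τ i) ω)) :=
    Measure.isProbabilityMeasure_map hm.aemeasurable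
  refine Measure.ext_of_charFun (funext fun ξ => ?_)
  have h0 : 0 ≤ ∑ i ∈ Finset.range n, a i ^ 2 * ((τ (i + 1) : ℝ) - τ i) :=
    Finset.sum_nonneg fun i _ => mul_nonneg (sq_nonneg _)
      (sub_nonneg.2 (NNReal.coe_le_coe.2 (hτ i.le_succ)))
  rw [charFun_gaussianReal, charFun_apply_real, integral_map hm.aemeasurable
    (Measurable.aestronglyMeasurable (by fun_prop))]
  have h := hM.integral_cexp_sum (fun i => ξ * a i) hτ n
  have e : ∀ ω, ((∑ i ∈ Finset.range n, ξ * a i * (M (τ (i + 1)) ω - M (τ i) ω) : ℝ) : ℂ) =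
      ξ * ((∑ i ∈ Finset.range n, a i * (M (τ (i + 1)) ω - M (τ i) ω) : ℝ) : ℂ) := fun ω => by
    rw [← Complex.ofReal_mul, Finset.mul_sum]
    simp only [mul_assoc]
  have e2 : ∑ i ∈ Finset.range n, (ξ * a i) ^ 2 * ((τ (i + 1) : ℝ) - τ i) =
      ξ ^ 2 * ∑ i ∈ Finset.range n, a i ^ 2 * ((τ (i + 1) : ℝ) - τ i) := by
    rw [Finset.mul_sum]
    exact Finset.sum_congr rfl fun i _ => by ring
  simp only [e, e2] at h
  rw [h, Real.coe_toNNReal _ h0]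
  congr 1
  push_cast
  ring

end Wiener

section Conditional

variable {Ω : Type*} {𝒢 mΩ : MeasurableSpace Ω} {P : Measure Ω} {ℱ : Filtration ℝ≥0 mΩ}
  {M : ℝ≥0 → Ω → ℝ}

/-- The conditional characteristic function of a sum of increments weighted by coefficients that
are independent of the Brownian motion. -/
lemma IsFilteredBM.setIntegral_cexp_sum [IsProbabilityMeasure P] (hM : IsFilteredBM ℱ P M)
    (h𝒢 : 𝒢 ≤ mΩ)
    (hind : Indep 𝒢 (MeasurableSpace.comap (fun ω t => M t ω) inferInstance) P)
    {c : ℕ → Ω → ℝ} (hc : ∀ i, Measurable[𝒢] (c i)) {A : Set Ω} (hA : MeasurableSet[𝒢] A)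
    {τ : ℕ → ℝ≥0} (hτ : Monotone τ) (n : ℕ) :
    ∫ ω in A, Complex.exp ((∑ i ∈ Finset.range n, c i ω * (M (τ (i + 1)) ω - M (τ i) ω) : ℝ) *
      Complex.I) ∂P =
    ∫ ω in A, Complex.exp
      ((-(∑ i ∈ Finset.range n, c i ω ^ 2 * ((τ (i + 1) : ℝ) - τ i)) / 2 : ℝ)) ∂P := by
  -- The indicator of A is bundled with the coefficients. Since U is independent of the path V,
  -- Fubini freezes U and leaves the deterministic-coefficient formula
  -- `IsFilteredBM.integral_cexp_sum`.
  let U : Ω → (ℕ → ℝ) × ℝ := fun ω => (fun i => c i ω, A.indicator (fun _ => 1) ω)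
  let V : Ω → (ℝ≥0 → ℝ) := fun ω t => M t ω
  have hind1 : Measurable[𝒢] (A.indicator fun _ => (1 : ℝ)) :=
    (@measurable_const _ _ _ 𝒢 1).indicator hA
  have hU𝒢 : Measurable[𝒢] U := Measurable.prodMk
    (@measurable_pi_lambda _ _ _ 𝒢 _ _ hc) hind1
  have hU : Measurable U := hU𝒢.mono h𝒢 le_rfl
  have hV : Measurable V := measurable_pi_lambda _ fun t => hM.measurable t
  have hUV : IndepFun U V P := by
    rw [IndepFun_iff_Indep]
    exact indep_of_indep_of_le_left hind hU𝒢.comap_le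
  have hprod := (indepFun_iff_map_prod_eq_prod_map_map hU.aemeasurable hV.aemeasurable).1 hUV
  have : IsProbabilityMeasure (P.map U) := Measure.isProbabilityMeasure_map hU.aemeasurable
  have : IsProbabilityMeasure (P.map V) := Measure.isProbabilityMeasure_map hV.aemeasurable
  let F : ((ℕ → ℝ) × ℝ) × (ℝ≥0 → ℝ) → ℂ := fun z => (z.1.2 : ℂ) *
    Complex.exp ((∑ i ∈ Finset.range n, z.1.1 i * (z.2 (τ (i + 1)) - z.2 (τ i)) : ℝ) * Complex.I)
  have hF : Measurable F := by fun_prop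
  have h1 : ∀ ω, A.indicator (fun ω => Complex.exp ((∑ i ∈ Finset.range n,
      c i ω * (M (τ (i + 1)) ω - M (τ i) ω) : ℝ) * Complex.I)) ω = F (U ω, V ω) := fun ω => by
    by_cases h : ω ∈ A <;> simp [h, F, U, V]
  have h2 : ∀ ω, A.indicator (fun ω => Complex.exp
      ((-(∑ i ∈ Finset.range n, c i ω ^ 2 * ((τ (i + 1) : ℝ) - τ i)) / 2 : ℝ))) ω =
      ((U ω).2 : ℂ) * Complex.exp
      ((-(∑ i ∈ Finset.range n, (U ω).1 i ^ 2 * ((τ (i + 1) : ℝ) - τ i)) / 2 : ℝ)) := fun ω => by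
    by_cases h : ω ∈ A <;> simp [h, U]
  have hA' := h𝒢 A hA
  rw [← integral_indicator hA', ← integral_indicator hA', integral_congr_ae (ae_of_all _ h1),
    integral_congr_ae (ae_of_all _ h2),
    ← integral_map (φ := fun ω => (U ω, V ω)) (hU.prodMk hV).aemeasurable hF.aestronglyMeasurable,
    hprod]
  have hFint : Integrable F ((P.map U).prod (P.map V)) := by
    rw [← hprod]
    refine (integrable_map_measure hF.aestronglyMeasurable (hU.prodMk hV).aemeasurable).2 ?_
    refine Integrable.of_bound (C := 1) (hF.comp (hU.prodMk hV)).aestronglyMeasurable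
      (ae_of_all _ fun ω => ?_)
    simp only [Function.comp_apply, F, norm_mul, Complex.norm_exp_ofReal_mul_I, mul_one, U]
    by_cases h : ω ∈ A <;> simp [h]
  rw [integral_prod _ hFint, integral_map hU.aemeasurable hFint.integral_prod_left.aestronglyMeasurable]
  refine integral_congr_ae (ae_of_all _ fun ω => ?_)
  simp only [F]
  rw [integral_const_mul, ← hM.integral_cexp_sum (U ω).1 hτ n,
    integral_map hV.aemeasurable (Measurable.aestronglyMeasurable (by fun_prop))]

end Conditional

section Wiener

variable {Ω : Type*} {mΩ : MeasurableSpace Ω} {P : Measure Ω} {ℱ : Filtration ℝ≥0 mΩ}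
  {M : ℝ≥0 → Ω → ℝ}

/-! ### Wiener integrals of deterministic functions -/

/-- A deterministic simple process. -/
def SimpleProc.IsDeterministic (S : SimpleProc ℱ P) : Prop := ∃ a : ℕ → ℝ, ∀ i ω, S.coeff i ω = a i

/-- The kernel may be singular at the ends of [0, t], so f is first replaced by a continuous
compactly supported g within ε/2 in L². The step approximations of g then account for the other
half. -/
lemma exists_deterministic_approx [IsProbabilityMeasure P] (ℱ : Filtration ℝ≥0 mΩ)
    (t : ℝ≥0) (ht : 0 < t) {f : ℝ → ℝ} (hf : MemLp f 2 (volume.restrict (Set.Icc 0 (t : ℝ)))) :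
    ∃ S : ℕ → SimpleProc ℱ P, (∀ k, (S k).IsDeterministic) ∧
      Tendsto (fun k => eLpNorm (fun z : ℝ × Ω => (S k).val z.1 z.2 - f z.1) 2 (prodMeasure P t))
        atTop (𝓝 0) := by
  have key : ∀ ε : ℝ≥0∞, ε ≠ 0 → ∃ S : SimpleProc ℱ P, S.IsDeterministic ∧
      eLpNorm (fun z : ℝ × Ω => S.val z.1 z.2 - f z.1) 2 (prodMeasure P t) ≤ ε := by
    intro ε hε
    obtain ⟨g, -, hg, hgc, hgm⟩ := hf.exists_hasCompactSupport_eLpNorm_sub_le (by norm_num)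
      (ε := ε / 2) (by simpa using hε)
    obtain ⟨D, hD⟩ := (isCompact_Icc (a := (0 : ℝ)) (b := t)).exists_bound_of_continuousOn
      hgc.continuousOn
    have hX : Adapted ℱ (fun (s : ℝ≥0) (_ : Ω) => g s) := fun s => measurable_const
    have hX2 : ∀ s : ℝ≥0, MemLp (fun _ : Ω => g s) 2 P := fun s => memLp_const _
    obtain ⟨-, h⟩ := tendsto_stepProc (P := P) t ht hX hX2 (D.toNNReal ^ (4 : ℝ)) (fun s hs => by
      rw [lintegral_const, measure_univ, mul_one, ENNReal.coe_rpow_of_nonneg _ (by norm_num)]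
      refine ENNReal.rpow_le_rpow ?_ (by norm_num)
      have := hD s ⟨s.2, hs⟩
      rw [← ofReal_norm, ENNReal.ofReal]
      exact ENNReal.coe_le_coe.2 (Real.toNNReal_le_toNNReal this))
      (fun s => EventuallyEq.rfl) (ae_of_all _ fun ω => hgc.comp NNReal.continuous_coe)
    have h' := h.eventually (ge_mem_nhds (show (0 : ℝ≥0∞) < ε / 2 by
      exact ENNReal.half_pos hε))
    obtain ⟨n, hn⟩ := h'.exists
    refine ⟨stepProc t hX hX2 (n + 1), ⟨fun i => g (grid t (n + 1) i), fun i ω => rfl⟩, ?_⟩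
    have hS := ((stepProc t hX hX2 (n + 1)).memLp_val t)
    have hgp : MemLp (fun z : ℝ × Ω => g z.1) 2 (prodMeasure P t) := hgm.comp_fst P
    have hfp : MemLp (fun z : ℝ × Ω => f z.1) 2 (prodMeasure P t) := hf.comp_fst P
    have hgc' : ∀ᵐ z ∂(prodMeasure P t), g ((z.1.toNNReal : ℝ≥0) : ℝ) = g z.1 := by
      filter_upwards [ae_prodMeasure_mem_Ioc P t] with z hz
      rw [Real.coe_toNNReal _ hz.1.le]
    have h1 : eLpNorm (fun z : ℝ × Ω => (stepProc t hX hX2 (n + 1)).val z.1 z.2 - g z.1) 2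
        (prodMeasure P t) ≤ ε / 2 := by
      refine le_trans (le_of_eq (eLpNorm_congr_ae ?_)) hn
      filter_upwards [hgc'] with z hz
      rw [hz]
    have h2 : eLpNorm (fun z : ℝ × Ω => g z.1 - f z.1) 2 (prodMeasure P t) ≤ ε / 2 := by
      have hfg : eLpNorm (g - f) 2 (volume.restrict (Set.Icc 0 (t : ℝ))) ≤ ε / 2 := by
        rw [eLpNorm_sub_comm]; exact hg
      refine le_trans (le_of_eq ?_) hfg
      exact eLpNorm_comp_measurePreserving (g := g - f) (hgm.sub hf).aestronglyMeasurable
        (measurePreserving_fst (μ := volume.restrict (Set.Icc 0 (t : ℝ))) (ν := P))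
    have := eLpNorm_add_le (μ := prodMeasure P t) (p := 2) (hS.sub hgp).aestronglyMeasurable
      (hgp.sub hfp).aestronglyMeasurable (by norm_num)
    rw [sub_add_sub_cancel] at this
    refine this.trans ((add_le_add h1 h2).trans (ENNReal.add_halves ε).le)
  choose S hS hSε using fun k : ℕ => key ((k : ℝ≥0∞) + 1)⁻¹ (by simp)
  refine ⟨S, hS, tendsto_of_tendsto_of_tendsto_of_le_of_le tendsto_const_nhds ?_
    (fun _ => zero_le) hSε⟩
  have := (ENNReal.tendsto_inv_nat_nhds_zero).comp (tendsto_add_atTop_nat 1)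
  refine this.congr fun k => ?_
  simp

end Wiener
end FSABR

namespace FSABR

/-! ### Convergence of Riemann sums along the uniform grid -/

section Riemann

lemma grid_le (t : ℝ≥0) {n j : ℕ} (hj : j ≤ n) : grid t n j ≤ t := by
  rcases n.eq_zero_or_pos with rfl | hn
  · simp [grid]
  · have : (j : ℝ≥0) / n ≤ 1 := div_le_one_of_le₀ (by exact_mod_cast hj) zero_le
    calc grid t n j = t * (j / n) := rfl
      _ ≤ t * 1 := by gcongr
      _ = t := mul_one t

lemma sum_indicator_grid (t : ℝ≥0) (ht : 0 < t) (x : ℝ≥0 → ℝ) {n : ℕ} (hn : 0 < n) {s : ℝ}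
    (hs : s ∈ Set.Ioc 0 (t : ℝ)) :
    ∑ i ∈ Finset.range n, Set.indicator (Set.Ioc (grid t n i : ℝ) (grid t n (i + 1)))
      (fun _ => x (grid t n i)) s = x (grid t n (gridIdx t n s)) := by
  rw [Finset.sum_eq_single (gridIdx t n s)]
  · rw [Set.indicator_of_mem ((mem_Ioc_grid_iff t ht hn hs.1 _).2 rfl)]
  · intro j _ hj
    rw [Set.indicator_of_notMem (fun h => hj ((mem_Ioc_grid_iff t ht hn hs.1 _).1 h))]
  · intro h
    exact absurd (Finset.mem_range.2 (gridIdx_lt t ht hn hs)) h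

/-- Riemann sums of a continuous function converge to its integral. -/
lemma tendsto_riemannSum (t : ℝ≥0) (ht : 0 < t) {x : ℝ≥0 → ℝ} (hx : Continuous x) :
    Tendsto (fun n : ℕ => ∑ i ∈ Finset.range (n + 1), x (grid t (n + 1) i) *
      ((grid t (n + 1) (i + 1) : ℝ) - grid t (n + 1) i)) atTop
      (𝓝 (∫ s in (0 : ℝ)..t, x s.toNNReal)) := by
  have hsum : ∀ n : ℕ, ∑ i ∈ Finset.range (n + 1), x (grid t (n + 1) i) *
      ((grid t (n + 1) (i + 1) : ℝ) - grid t (n + 1) i) =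
      ∫ s in Set.Ioc 0 (t : ℝ), x (grid t (n + 1) (gridIdx t (n + 1) s)) := fun n => by
    rw [← setIntegral_congr_fun measurableSet_Ioc
      (fun s hs => sum_indicator_grid t ht x n.succ_pos hs), integral_finsetSum]
    · refine Finset.sum_congr rfl fun i hi => ?_
      rw [integral_indicator measurableSet_Ioc, Measure.restrict_restrict measurableSet_Ioc,
        Set.inter_eq_left.2, setIntegral_const, smul_eq_mul, mul_comm, Measure.real,
        Real.volume_Ioc, ENNReal.toReal_ofReal]
      · exact sub_nonneg.2 (NNReal.coe_le_coe.2 (monotone_grid t (n + 1) i.le_succ))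
      · exact Set.Ioc_subset_Ioc (NNReal.coe_nonneg _)
          (NNReal.coe_le_coe.2 (grid_le t (Finset.mem_range.1 hi)))
    · intro i _
      exact (integrable_const _).indicator measurableSet_Ioc
  simp only [hsum]
  rw [intervalIntegral.integral_of_le (show (0 : ℝ) ≤ t from t.2)]
  obtain ⟨D, hD⟩ := (isCompact_Icc (a := (0 : ℝ≥0)) (b := t)).exists_bound_of_continuousOn
    hx.continuousOn
  refine tendsto_integral_of_dominated_convergence (fun _ => D) (fun n => ?_)
    (integrable_const _) (fun n => ?_) ?_
  · have hm : Measurable (fun s : ℝ => ∑ i ∈ Finset.range (n + 1),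
        Set.indicator (Set.Ioc (grid t (n + 1) i : ℝ) (grid t (n + 1) (i + 1)))
          (fun _ => x (grid t (n + 1) i)) s) :=
      Finset.measurable_sum _ fun i _ => measurable_const.indicator measurableSet_Ioc
    refine hm.aestronglyMeasurable.congr ?_
    filter_upwards [ae_restrict_mem measurableSet_Ioc] with s hs
    exact sum_indicator_grid t ht x n.succ_pos hs
  · filter_upwards [ae_restrict_mem measurableSet_Ioc] with s hs
    exact hD _ ⟨zero_le, grid_gridIdx_le t ht n.succ_pos hs⟩
  · filter_upwards [ae_restrict_mem measurableSet_Ioc] with s hs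
    exact (hx.tendsto _).comp (tendsto_grid_gridIdx t ht hs)

end Riemann

/-! ### Measurable versions of almost sure limits -/

section Limits

/-- An almost everywhere limit of `m`-measurable functions has an `m`-measurable version, for any
sub-σ-algebra `m`. -/
lemma exists_measurable_ae_eq_of_tendsto {Ω : Type*} {m mΩ : MeasurableSpace Ω} {P : Measure Ω}
    {f : ℕ → Ω → ℝ} {g : Ω → ℝ} (hf : ∀ k, Measurable[m] (f k))
    (hfg : ∀ᵐ ω ∂P, Tendsto (fun k => f k ω) atTop (𝓝 (g ω))) :
    ∃ g' : Ω → ℝ, Measurable[m] g' ∧ g =ᵐ[P] g' :=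
  -- The limsup is m-measurable everywhere, without adding null sets to m.
  ⟨fun ω => limsup (fun k => f k ω) atTop, Measurable.limsup hf, by
    filter_upwards [hfg] with ω hω
    exact hω.limsup_eq.symm⟩

end Limits

/-! ### Wiener integrals are Gaussian -/

section Gaussian

variable {Ω : Type*} {mΩ : MeasurableSpace Ω} {P : Measure Ω} {ℱ : Filtration ℝ≥0 mΩ}
  {M : ℝ≥0 → Ω → ℝ}

lemma exists_deterministic_approx_of_nonneg [IsProbabilityMeasure P] (ℱ : Filtration ℝ≥0 mΩ)
    (t : ℝ≥0) {f : ℝ → ℝ} (hf : MemLp f 2 (volume.restrict (Set.Icc 0 (t : ℝ)))) :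
    ∃ S : ℕ → SimpleProc ℱ P, (∀ k, (S k).IsDeterministic) ∧
      Tendsto (fun k => eLpNorm (fun z : ℝ × Ω => (S k).val z.1 z.2 - f z.1) 2 (prodMeasure P t))
        atTop (𝓝 0) := by
  rcases eq_or_ne t 0 with rfl | ht
  · refine ⟨fun _ => stepProc 0 (X := fun _ _ => 0) (fun _ => measurable_const)
      (fun _ => memLp_const _) 0, fun _ => ⟨fun _ => 0, fun _ _ => rfl⟩, ?_⟩
    have : prodMeasure P 0 = 0 := by simp [prodMeasure]
    simp [this]
  · exact exists_deterministic_approx ℱ t (pos_iff_ne_zero.2 ht) hf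

/-- The σ-algebra generated by the path of `M` up to time `t`. -/
abbrev past (M : ℝ≥0 → Ω → ℝ) (t : ℝ≥0) : MeasurableSpace Ω :=
  ⨆ s : Set.Iic t, MeasurableSpace.comap (M s) inferInstance

lemma measurable_past (M : ℝ≥0 → Ω → ℝ) {s t : ℝ≥0} (hst : s ≤ t) : Measurable[past M t] (M s) := by
  rw [measurable_iff_comap_le]
  exact le_iSup (fun s : Set.Iic t => MeasurableSpace.comap (M s) inferInstance) ⟨s, hst⟩

lemma IsFilteredBM.past_le (hM : IsFilteredBM ℱ P M) (t : ℝ≥0) : past M t ≤ ℱ t :=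
  iSup_le fun s => measurable_iff_comap_le.1 ((hM.adapted s).mono (ℱ.mono s.2) le_rfl)

lemma past_le_comap (M : ℝ≥0 → Ω → ℝ) (t : ℝ≥0) :
    past M t ≤ MeasurableSpace.comap (fun ω t => M t ω) inferInstance :=
  iSup_le fun s => by
    rintro _ ⟨A, hA, rfl⟩
    exact ⟨(fun w : ℝ≥0 → ℝ => w s) ⁻¹' A, measurable_pi_apply _ hA, rfl⟩

/-- The Wiener integral of a deterministic function `f` is centred Gaussian with variance `∫ f²`,
and depends only on the past of the Brownian motion. -/
theorem IsFilteredBM.hasLaw_itoIntegral [IsProbabilityMeasure P] (hM : IsFilteredBM ℱ P M)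
    (t : ℝ≥0) {f : ℝ → ℝ} (hf : MemLp f 2 (volume.restrict (Set.Icc 0 (t : ℝ)))) :
    HasLaw (itoIntegral ℱ P M t fun s _ => f s)
      (gaussianReal 0 (∫ s in Set.Icc 0 (t : ℝ), f s ^ 2).toNNReal) P ∧
    ∃ g : Ω → ℝ, Measurable[past M t] g ∧ (itoIntegral ℱ P M t fun s _ => f s) =ᵐ[P] g := by
  obtain ⟨S, hSd, hS⟩ := exists_deterministic_approx_of_nonneg (P := P) ℱ t hf
  have hfp : MemLp (fun z : ℝ × Ω => f z.1) 2 (prodMeasure P t) := hf.comp_fst P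
  obtain ⟨hI2, hI⟩ := hM.tendsto_itoIntegral t (φ := fun s _ => f s) hfp S hS
  obtain ⟨ns, hns, hae⟩ := exists_subseq_tendsto_ae (fun k => hM.memLp_integral (S k) t) hI2 hI
  choose a ha using hSd
  have hmono : ∀ k, Monotone (fun i => min ((S k).time i) t) := fun k i j hij =>
    min_le_min_right t ((S k).time_mono hij)
  have hint : ∀ k, (S k).integral M t = fun ω => ∑ i ∈ Finset.range (S k).n,
      a k i * (M (min ((S k).time (i + 1)) t) ω - M (min ((S k).time i) t) ω) := fun k => by
    ext ω
    simp only [SimpleProc.integral, ha]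
  refine ⟨⟨hI2.aestronglyMeasurable.aemeasurable, ?_⟩, ?_⟩
  · have : IsProbabilityMeasure (P.map (itoIntegral ℱ P M t fun s _ => f s)) :=
      Measure.isProbabilityMeasure_map hI2.aestronglyMeasurable.aemeasurable
    refine Measure.ext_of_charFun (funext fun ξ => ?_)
    rw [charFun_gaussianReal, charFun_apply_real, integral_map
      hI2.aestronglyMeasurable.aemeasurable (Measurable.aestronglyMeasurable (by fun_prop))]
    set V : ℕ → ℝ := fun k => ∑ i ∈ Finset.range (S k).n, a k i ^ 2 *
      (((min ((S k).time (i + 1)) t : ℝ≥0) : ℝ) - (min ((S k).time i) t : ℝ≥0)) with hV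
    have hV0 : ∀ k, 0 ≤ V k := fun k => Finset.sum_nonneg fun i _ => mul_nonneg (sq_nonneg _)
      (sub_nonneg.2 (NNReal.coe_le_coe.2 (hmono k i.le_succ)))
    have hlaw : ∀ k, HasLaw ((S k).integral M t) (gaussianReal 0 (V k).toNNReal) P := fun k => by
      rw [hint k]
      exact hM.hasLaw_sum (a k) (hmono k) _
    -- V k is the variance of the elementary integral, which the isometry equates with the squared
    -- norm of the integrand. L² convergence then yields V k → ∫ f².
    have hVeq : ∀ k, V k = ∫ z, (S k).val z.1 z.2 ^ 2 ∂(prodMeasure P t) := fun k => by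
      have h1 := (hlaw k).variance_eq
      have h2 := (hlaw k).integral_eq
      rw [integral_id_gaussianReal] at h2
      rw [variance_id_gaussianReal, variance_of_integral_eq_zero (hlaw k).aemeasurable h2,
        Real.coe_toNNReal _ (hV0 k)] at h1
      rw [← h1]
      simpa only [pow_two] using hM.integral_mul_integral (S k) (S k) t
    have hVlim : Tendsto V atTop (𝓝 (∫ s in Set.Icc 0 (t : ℝ), f s ^ 2)) := by
      have h := tendsto_integral_sq_of_tendsto_eLpNorm (fun k => (S k).memLp_val t) hfp hS
      have e : ∫ z : ℝ × Ω, f z.1 ^ 2 ∂(prodMeasure P t) = ∫ s in Set.Icc 0 (t : ℝ), f s ^ 2 := by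
        rw [integral_fun_fst (fun s => f s ^ 2)]
        simp
      rw [e] at h
      exact h.congr fun k => (hVeq k).symm
    have hlim1 : Tendsto (fun k => ∫ ω, Complex.exp (ξ * (S (ns k)).integral M t ω * Complex.I) ∂P)
        atTop (𝓝 (∫ ω, Complex.exp (ξ * (itoIntegral ℱ P M t fun s _ => f s) ω * Complex.I) ∂P)) := by
      refine tendsto_integral_of_dominated_convergence (fun _ => 1) (fun k => ?_)
        (integrable_const _) (fun k => ae_of_all _ fun ω => ?_) ?_
      · exact (by fun_prop : Measurable fun x : ℝ => Complex.exp (ξ * x * Complex.I)).comp_aemeasurable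
          (hlaw (ns k)).aemeasurable |>.aestronglyMeasurable
      · rw [← Complex.ofReal_mul, Complex.norm_exp_ofReal_mul_I]
      · filter_upwards [hae] with ω hω
        exact ((by fun_prop : Continuous fun x : ℝ =>
          Complex.exp (ξ * x * Complex.I)).tendsto _).comp hω
    have hval : ∀ k, ∫ ω, Complex.exp (ξ * (S k).integral M t ω * Complex.I) ∂P =
        Complex.exp ((-(V k) * ξ ^ 2 / 2 : ℝ)) := fun k => by
      have h := (hlaw k).integral_comp (f := fun x : ℝ => Complex.exp (ξ * x * Complex.I))
        (Measurable.aestronglyMeasurable (by fun_prop))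
      simp only [Function.comp_apply] at h
      rw [h, ← charFun_apply_real, charFun_gaussianReal, Real.coe_toNNReal _ (hV0 k)]
      congr 1
      push_cast
      ring
    simp only [hval] at hlim1
    have hlim2 : Tendsto (fun k => Complex.exp ((-(V (ns k)) * ξ ^ 2 / 2 : ℝ))) atTop
        (𝓝 (Complex.exp ((-(∫ s in Set.Icc 0 (t : ℝ), f s ^ 2) * ξ ^ 2 / 2 : ℝ)))) :=
      ((by fun_prop : Continuous fun v : ℝ => Complex.exp ((-v * ξ ^ 2 / 2 : ℝ))).tendsto _).comp
        (hVlim.comp hns.tendsto_atTop)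
    rw [tendsto_nhds_unique hlim1 hlim2, Real.coe_toNNReal _ (integral_nonneg fun s => sq_nonneg _)]
    congr 1
    push_cast
    ring
  · refine exists_measurable_ae_eq_of_tendsto (fun k => ?_) hae
    rw [hint]
    exact Finset.measurable_sum _ fun i _ => Measurable.const_mul
      ((measurable_past M (min_le_right _ _)).sub (measurable_past M (min_le_right _ _))) _

/-! ### Fractional Brownian motion -/

variable {H : ℝ} {B BH : ℝ≥0 → Ω → ℝ}

lemma IsFBMGeneratedBy.hasLaw [IsProbabilityMeasure P] (hBH : IsFBMGeneratedBy ℱ P H B BH)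
    (hB : IsFilteredBM ℱ P B) (hH : 0 < H ∧ H < 1) (t : ℝ≥0) :
    HasLaw (BH t) (gaussianReal 0 ((t : ℝ) ^ (2 * H)).toNNReal) P := by
  have h := (hB.hasLaw_itoIntegral t (memLp_mgKernel H t hH t.2)).1
  rw [setIntegral_sq_mgKernel H t hH t.2] at h
  exact h.congr (hBH.eq_integral t)

/-- A version of the fractional Brownian motion that depends only on the past of `B`. -/
lemma IsFBMGeneratedBy.exists_version [IsProbabilityMeasure P] (hBH : IsFBMGeneratedBy ℱ P H B BH)
    (hB : IsFilteredBM ℱ P B) (hH : 0 < H ∧ H < 1) :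
    ∃ U : ℝ≥0 → Ω → ℝ, (∀ t, Measurable[past B t] (U t)) ∧ ∀ t, U t =ᵐ[P] BH t := by
  choose U hU hU' using fun t : ℝ≥0 =>
    (hB.hasLaw_itoIntegral t (memLp_mgKernel H t hH t.2)).2
  exact ⟨U, hU, fun t => ((hBH.eq_integral t).trans (hU' t)).symm⟩

end Gaussian
end FSABR

namespace FSABR

/-! ### The stochastic integrals of the exponential of the fractional Brownian motion -/

section Model

variable {Ω : Type*} {mΩ : MeasurableSpace Ω} {P : Measure Ω} {ℱ : Filtration ℝ≥0 mΩ}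
  {B W M BH : ℝ≥0 → Ω → ℝ} {H : ℝ}

lemma integral_exp_mul_of_hasLaw {X : Ω → ℝ} {v : ℝ≥0} (hX : HasLaw X (gaussianReal 0 v) P)
    (p : ℝ) : Integrable (fun ω => Real.exp (p * X ω)) P ∧
      ∫ ω, Real.exp (p * X ω) ∂P = Real.exp (v * p ^ 2 / 2) := by
  constructor
  · have h := integrable_exp_mul_gaussianReal (μ := 0) (v := v) p
    rw [← hX.map_eq, integrable_map_measure (Measurable.aestronglyMeasurable (by fun_prop))
      hX.aemeasurable] at h
    exact h
  · have := mgf_gaussianReal hX.map_eq p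
    rw [mgf, zero_mul, zero_add] at this
    exact this

lemma memLp_exp_mul_of_hasLaw {X : Ω → ℝ} {v : ℝ≥0} (hX : HasLaw X (gaussianReal 0 v) P)
    (p : ℝ) : MemLp (fun ω => Real.exp (p * X ω)) 2 P := by
  refine (memLp_two_iff_integrable_sq ?_).2 ?_
  · exact ((by fun_prop : Measurable fun x : ℝ => Real.exp (p * x)).comp_aemeasurable
      hX.aemeasurable).aestronglyMeasurable
  · refine (integral_exp_mul_of_hasLaw hX (2 * p)).1.congr (ae_of_all _ fun ω => ?_)
    simp only
    rw [← Real.exp_nat_mul]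
    congr 1; push_cast; ring

lemma lintegral_exp_mul_four_of_hasLaw {X : Ω → ℝ} {v : ℝ≥0} (hX : HasLaw X (gaussianReal 0 v) P)
    (p : ℝ) : ∫⁻ ω, ‖Real.exp (p * X ω)‖ₑ ^ (4 : ℝ) ∂P =
      ENNReal.ofReal (Real.exp (v * (4 * p) ^ 2 / 2)) := by
  obtain ⟨h1, h2⟩ := integral_exp_mul_of_hasLaw hX (4 * p)
  rw [← h2, ofReal_integral_eq_lintegral_ofReal h1 (ae_of_all _ fun ω => (Real.exp_pos _).le)]
  refine lintegral_congr fun ω => ?_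
  rw [← ofReal_norm, Real.norm_of_nonneg (Real.exp_pos _).le,
    ENNReal.ofReal_rpow_of_nonneg (Real.exp_pos _).le (by norm_num), ← Real.exp_mul]
  congr 2; ring

/-- The exponential of `ν B^H` has a version adapted to `B` whose step approximations converge. -/
lemma IsFBMGeneratedBy.exists_stepProc [IsProbabilityMeasure P]
    (hBH : IsFBMGeneratedBy ℱ P H B BH) (hB : IsFilteredBM ℱ P B) (hH : 0 < H ∧ H < 1) (ν : ℝ)
    (t : ℝ≥0) (ht : 0 < t) :
    ∃ X : ℝ≥0 → Ω → ℝ, (∀ s, Measurable[past B s] (X s)) ∧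
      (∀ s, X s =ᵐ[P] fun ω => Real.exp (ν * BH s ω)) ∧
      MemLp (fun z : ℝ × Ω => Real.exp (ν * BH z.1.toNNReal z.2)) 2 (prodMeasure P t) ∧
      ∃ (hX : Adapted ℱ X) (hX2 : ∀ s, MemLp (X s) 2 P),
        ∀ M, IsFilteredBM ℱ P M → MemLp (expIntegral ℱ P ν BH M t) 2 P ∧
          Tendsto (fun n => eLpNorm (fun ω => (stepProc t hX hX2 (n + 1)).integral M t ω -
            expIntegral ℱ P ν BH M t ω) 2 P) atTop (𝓝 0) := by
  obtain ⟨U, hU, hUBH⟩ := hBH.exists_version hB hH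
  have hUlaw : ∀ s : ℝ≥0, HasLaw (U s) (gaussianReal 0 ((s : ℝ) ^ (2 * H)).toNNReal) P := fun s =>
    (hBH.hasLaw hB hH s).congr (hUBH s)
  have hXm : ∀ s, Measurable[past B s] (fun ω => Real.exp (ν * U s ω)) := fun s =>
    (by fun_prop : Measurable fun x : ℝ => Real.exp (ν * x)).comp (hU s)
  have hX : Adapted ℱ (fun s ω => Real.exp (ν * U s ω)) := fun s =>
    (hXm s).mono (hB.past_le s) le_rfl
  have hX2 : ∀ s, MemLp (fun ω => Real.exp (ν * U s ω)) 2 P := fun s =>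
    memLp_exp_mul_of_hasLaw (hUlaw s) ν
  have hXZ : ∀ s, (fun ω => Real.exp (ν * U s ω)) =ᵐ[P] fun ω => Real.exp (ν * BH s ω) := fun s => by
    filter_upwards [hUBH s] with ω hω
    rw [hω]
  obtain ⟨h1, h2⟩ := tendsto_stepProc t ht hX hX2
    (Z := fun s ω => Real.exp (ν * BH s ω))
    (Real.exp (((t : ℝ) ^ (2 * H)) * (4 * ν) ^ 2 / 2)).toNNReal (fun s hs => by
      rw [lintegral_exp_mul_four_of_hasLaw (hUlaw s) ν, ENNReal.ofReal]
      refine ENNReal.coe_le_coe.2 (Real.toNNReal_le_toNNReal (Real.exp_le_exp.2 ?_))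
      rw [Real.coe_toNNReal _ (Real.rpow_nonneg (NNReal.coe_nonneg s) _)]
      have : (s : ℝ) ^ (2 * H) ≤ (t : ℝ) ^ (2 * H) :=
        Real.rpow_le_rpow s.2 hs (by linarith [hH.1])
      gcongr)
    hXZ (by
      filter_upwards [hBH.cont] with ω hω
      fun_prop)
  exact ⟨_, hXm, hXZ, h1, hX, hX2, fun M hM =>
    hM.tendsto_itoIntegral t (φ := fun s ω => Real.exp (ν * BH s.toNNReal ω)) h1 _ h2⟩

lemma stepProc_integral (t : ℝ≥0) {X : ℝ≥0 → Ω → ℝ} (hX : Adapted ℱ X)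
    (hX2 : ∀ s, MemLp (X s) 2 P) (n : ℕ) (M : ℝ≥0 → Ω → ℝ) (ω : Ω) :
    (stepProc t hX hX2 n).integral M t ω = ∑ i ∈ Finset.range n, X (grid t n i) ω *
      (M (grid t n (i + 1)) ω - M (grid t n i) ω) := by
  refine Finset.sum_congr rfl fun i hi => ?_
  have hi' := Finset.mem_range.1 hi
  simp only [stepProc]
  rw [min_eq_left (grid_le t hi'.le), min_eq_left (grid_le t hi')]

/-- `v_t` as an almost sure limit of Riemann sums. -/
lemma tendsto_intVar (hcont : ∀ᵐ ω ∂P, Continuous fun t => BH t ω) (ν : ℝ) (t : ℝ≥0) (ht : 0 < t)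
    {X : ℝ≥0 → Ω → ℝ} (hX : ∀ s, X s =ᵐ[P] fun ω => Real.exp (ν * BH s ω)) :
    ∀ᵐ ω ∂P, Tendsto (fun n : ℕ => ∑ i ∈ Finset.range (n + 1), X (grid t (n + 1) i) ω ^ 2 *
      ((grid t (n + 1) (i + 1) : ℝ) - grid t (n + 1) i)) atTop (𝓝 (intVar ν BH t ω)) := by
  have hX' : ∀ᵐ ω ∂P, ∀ n j : ℕ, X (grid t n j) ω = Real.exp (ν * BH (grid t n j) ω) :=
    ae_all_iff.2 fun n => ae_all_iff.2 fun j => hX _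
  filter_upwards [hcont, hX'] with ω hω hXω
  have h := tendsto_riemannSum t ht (x := fun s => Real.exp (2 * ν * BH s ω)) (by fun_prop)
  refine h.congr fun n => Finset.sum_congr rfl fun i _ => ?_
  rw [hXω, ← Real.exp_nat_mul]
  congr 2; push_cast; ring

/-- A version that is a function of the path of B alone, as required for conditioning on B. It is
obtained as a limit of Riemann sums of the adapted version X. -/
lemma IsFBMGeneratedBy.intVar_ae_eq [IsProbabilityMeasure P]
    (hBH : IsFBMGeneratedBy ℱ P H B BH) (hB : IsFilteredBM ℱ P B) (hH : 0 < H ∧ H < 1) (ν : ℝ)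
    (t : ℝ≥0) (ht : 0 < t) :
    ∃ V : Ω → ℝ, Measurable[MeasurableSpace.comap (fun ω t => B t ω) inferInstance] V ∧
      intVar ν BH t =ᵐ[P] V := by
  obtain ⟨X, hXm, hXe, -, hX, hX2, hlim⟩ := hBH.exists_stepProc hB hH ν t ht
  refine exists_measurable_ae_eq_of_tendsto (fun n => ?_) (tendsto_intVar hBH.cont ν t ht hXe)
  exact Finset.measurable_sum _ fun i _ => (((hXm _).mono (past_le_comap B _) le_rfl).pow_const 2).mul_const _

lemma measurable_comap_path (B : ℝ≥0 → Ω → ℝ) (s : ℝ≥0) :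
    Measurable[MeasurableSpace.comap (fun ω t => B t ω) inferInstance] (B s) :=
  (measurable_past B le_rfl).mono (past_le_comap B s) le_rfl

/-- The elementary integrals involve only the path of B, and a subsequence of them converges almost
surely to the Itô integral. -/
lemma IsFBMGeneratedBy.expIntegral_ae_eq [IsProbabilityMeasure P]
    (hBH : IsFBMGeneratedBy ℱ P H B BH) (hB : IsFilteredBM ℱ P B) (hH : 0 < H ∧ H < 1) (ν : ℝ)
    (t : ℝ≥0) (ht : 0 < t) :
    ∃ V : Ω → ℝ, Measurable[MeasurableSpace.comap (fun ω t => B t ω) inferInstance] V ∧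
      expIntegral ℱ P ν BH B t =ᵐ[P] V := by
  obtain ⟨X, hXm, hXe, -, hX, hX2, hlim⟩ := hBH.exists_stepProc hB hH ν t ht
  obtain ⟨h2, hl⟩ := hlim B hB
  obtain ⟨ns, -, hae⟩ := exists_subseq_tendsto_ae
    (fun n => hB.memLp_integral (stepProc t hX hX2 (n + 1)) t) h2 hl
  refine exists_measurable_ae_eq_of_tendsto (fun n => ?_) hae
  exact Finset.measurable_sum _ fun i _ => ((hXm _).mono (past_le_comap B _) le_rfl).mul
    ((measurable_comap_path B _).sub (measurable_comap_path B _))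

lemma IsFBMGeneratedBy.aemeasurable_expIntegral [IsProbabilityMeasure P]
    (hBH : IsFBMGeneratedBy ℱ P H B BH) (hB : IsFilteredBM ℱ P B) (hM : IsFilteredBM ℱ P M)
    (hH : 0 < H ∧ H < 1) (ν : ℝ) (t : ℝ≥0) (ht : 0 < t) :
    AEMeasurable (expIntegral ℱ P ν BH M t) P := by
  obtain ⟨X, hXm, hXe, -, hX, hX2, hlim⟩ := hBH.exists_stepProc hB hH ν t ht
  exact (hlim M hM).1.aestronglyMeasurable.aemeasurable

/-- Conditionally on `B`, the integral of `e^{ν B^H}` against the independent Brownian motion `W`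
is centred Gaussian with variance `v_t`. -/
theorem IsFBMGeneratedBy.setIntegral_cexp_expIntegral [IsProbabilityMeasure P]
    (hBH : IsFBMGeneratedBy ℱ P H B BH) (hB : IsFilteredBM ℱ P B) (hW : IsFilteredBM ℱ P W)
    (hBW : IndepFun (fun ω t => B t ω) (fun ω t => W t ω) P)
    (hH : 0 < H ∧ H < 1) (ν : ℝ) (t : ℝ≥0) (ht : 0 < t) {A : Set Ω}
    (hA : MeasurableSet[MeasurableSpace.comap (fun ω t => B t ω) inferInstance] A) (ξ : ℝ) :
    ∫ ω in A, Complex.exp (ξ * expIntegral ℱ P ν BH W t ω * Complex.I) ∂P =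
      ∫ ω in A, Complex.exp ((-(intVar ν BH t ω * ξ ^ 2 / 2) : ℝ)) ∂P := by
  obtain ⟨X, hXm, hXe, -, hX, hX2, hlim⟩ := hBH.exists_stepProc hB hH ν t ht
  obtain ⟨h2, hl⟩ := hlim W hW
  obtain ⟨ns, hns, hae⟩ := exists_subseq_tendsto_ae
    (fun n => hW.memLp_integral (stepProc t hX hX2 (n + 1)) t) h2 hl
  have hv := tendsto_intVar hBH.cont ν t ht hXe
  have h𝒢 : MeasurableSpace.comap (fun ω t => B t ω) inferInstance ≤ mΩ :=
    measurable_iff_comap_le.1 (measurable_pi_lambda _ fun s => hB.measurable s)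
  have hlim1 : Tendsto (fun k => ∫ ω in A,
      Complex.exp (ξ * (stepProc t hX hX2 (ns k + 1)).integral W t ω * Complex.I) ∂P)
      atTop (𝓝 (∫ ω in A, Complex.exp (ξ * expIntegral ℱ P ν BH W t ω * Complex.I) ∂P)) := by
    refine tendsto_integral_of_dominated_convergence (fun _ => 1) (fun k => ?_)
      (integrable_const _) (fun k => ae_of_all _ fun ω => ?_) (ae_restrict_of_ae ?_)
    · exact ((by fun_prop : Measurable fun x : ℝ => Complex.exp (ξ * x * Complex.I)).comp_aemeasurable
        (hW.memLp_integral _ t).aestronglyMeasurable.aemeasurable).aestronglyMeasurable.restrict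
    · rw [← Complex.ofReal_mul, Complex.norm_exp_ofReal_mul_I]
    · filter_upwards [hae] with ω hω
      exact ((by fun_prop : Continuous fun x : ℝ =>
        Complex.exp (ξ * x * Complex.I)).tendsto _).comp hω
  have hlim2 : Tendsto (fun k => ∫ ω in A, Complex.exp ((-((∑ i ∈ Finset.range (ns k + 1),
      X (grid t (ns k + 1) i) ω ^ 2 *
      ((grid t (ns k + 1) (i + 1) : ℝ) - grid t (ns k + 1) i)) * ξ ^ 2 / 2) : ℝ)) ∂P)
      atTop (𝓝 (∫ ω in A, Complex.exp ((-(intVar ν BH t ω * ξ ^ 2 / 2) : ℝ)) ∂P)) := by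
    refine tendsto_integral_of_dominated_convergence (fun _ => 1) (fun k => ?_)
      (integrable_const _) (fun k => ae_of_all _ fun ω => ?_) (ae_restrict_of_ae ?_)
    · have hm : Measurable (fun ω => ∑ i ∈ Finset.range (ns k + 1), X (grid t (ns k + 1) i) ω ^ 2 *
          ((grid t (ns k + 1) (i + 1) : ℝ) - grid t (ns k + 1) i)) :=
        Finset.measurable_sum _ fun i _ =>
          (((hX _).mono (ℱ.le _) le_rfl).pow_const 2).mul_const _
      exact ((by fun_prop : Measurable fun x : ℝ => Complex.exp ((-(x * ξ ^ 2 / 2) : ℝ))).comp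
        hm).aestronglyMeasurable
    · rw [← Complex.ofReal_exp, Complex.norm_real, Real.norm_of_nonneg (Real.exp_pos _).le,
        Real.exp_le_one_iff, neg_nonpos]
      have : 0 ≤ ∑ i ∈ Finset.range (ns k + 1), X (grid t (ns k + 1) i) ω ^ 2 *
          ((grid t (ns k + 1) (i + 1) : ℝ) - grid t (ns k + 1) i) :=
        Finset.sum_nonneg fun i _ => mul_nonneg (sq_nonneg _)
          (sub_nonneg.2 (NNReal.coe_le_coe.2 (monotone_grid t _ i.le_succ)))
      positivity
    · filter_upwards [hv] with ω hω
      exact ((by fun_prop : Continuous fun x : ℝ =>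
        Complex.exp ((-(x * ξ ^ 2 / 2) : ℝ))).tendsto _).comp (hω.comp hns.tendsto_atTop)
  refine tendsto_nhds_unique hlim1 (hlim2.congr fun k => ?_)
  -- For step integrands the conditional characteristic function is exact, with the Riemann sum of
  -- v_t in place of v_t. Absorbing ξ into the coefficients produces the factor ξ².
  have h := hW.setIntegral_cexp_sum h𝒢 ((IndepFun_iff_Indep _ _ _).1 hBW)
    (c := fun i ω => ξ * X (grid t (ns k + 1) i) ω)
    (fun i => ((hXm _).mono (past_le_comap B _) le_rfl).const_mul _) hA
    (monotone_grid t (ns k + 1)) (ns k + 1)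
  have e1 : ∀ ω, ((∑ i ∈ Finset.range (ns k + 1), ξ * X (grid t (ns k + 1) i) ω *
      (W (grid t (ns k + 1) (i + 1)) ω - W (grid t (ns k + 1) i) ω) : ℝ) : ℂ) =
      ξ * ((stepProc t hX hX2 (ns k + 1)).integral W t ω : ℂ) := fun ω => by
    rw [stepProc_integral, ← Complex.ofReal_mul, Finset.mul_sum]
    simp only [mul_assoc]
  have e2 : ∀ ω, ∑ i ∈ Finset.range (ns k + 1), (ξ * X (grid t (ns k + 1) i) ω) ^ 2 *
      ((grid t (ns k + 1) (i + 1) : ℝ) - grid t (ns k + 1) i) =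
      (∑ i ∈ Finset.range (ns k + 1), X (grid t (ns k + 1) i) ω ^ 2 *
      ((grid t (ns k + 1) (i + 1) : ℝ) - grid t (ns k + 1) i)) * ξ ^ 2 := fun ω => by
    rw [Finset.sum_mul]
    exact Finset.sum_congr rfl fun i _ => by ring
  simp only [e1, e2, neg_div] at h
  exact h.symm

end Model
end FSABR

namespace FSABR

/-! ### Integrability of v_t^{-1/2} -/

section InverseMoment

variable {Ω : Type*} {mΩ : MeasurableSpace Ω} {P : Measure Ω} {ℱ : Filtration ℝ≥0 mΩ}
  {B BH : ℝ≥0 → Ω → ℝ} {H : ℝ}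

lemma intVar_pos {ν : ℝ} {t : ℝ≥0} (ht : 0 < t) {ω : Ω} (hω : Continuous fun s => BH s ω) :
    0 < intVar ν BH t ω :=
  intervalIntegral.intervalIntegral_pos_of_pos
    ((by fun_prop : Continuous fun s : ℝ => Real.exp (2 * ν * BH s.toNNReal ω)).intervalIntegrable
      _ _) (fun _ => Real.exp_pos _) ht

/-- Jensen's inequality for `x ↦ x ^ (-1 / 2)`. -/
lemma mul_sqrt_div_intVar_le {ν : ℝ} {t : ℝ≥0} (ht : 0 < t) {ω : Ω}
    (hω : Continuous fun s => BH s ω) :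
    t * √(t / intVar ν BH t ω) ≤ ∫ s in (0 : ℝ)..t, Real.exp (-ν * BH s.toNNReal ω) := by
  have hv := intVar_pos (ν := ν) ht hω
  have ht' : (0 : ℝ) < t := ht
  set v := intVar ν BH t ω with hvdef
  set q := √(t / v) with hq
  have hq2 : q ^ 2 * v = t := by
    rw [hq, Real.sq_sqrt (by positivity)]; field_simp
  -- The left side is the tangent line of x ↦ x^{-1/2} at the mean v/t, where q = (v/t)^{-1/2}. With
  -- y = x^{-1/2} the inequality becomes (y - q)² (2y + q) ≥ 0. Integrating over [0, t] makes the
  -- tangent line contribute exactly t q.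
  have hpt : ∀ s : ℝ, 3 / 2 * q - 1 / 2 * q ^ 3 * Real.exp (2 * ν * BH s.toNNReal ω) ≤
      Real.exp (-ν * BH s.toNNReal ω) := fun s => by
    set y := Real.exp (-ν * BH s.toNNReal ω) with hy
    have hy0 : 0 < y := Real.exp_pos _
    have hx : Real.exp (2 * ν * BH s.toNNReal ω) * y ^ 2 = 1 := by
      rw [hy, ← Real.exp_nat_mul, ← Real.exp_add, Real.exp_eq_one_iff]; push_cast; ring
    have hx' : Real.exp (2 * ν * BH s.toNNReal ω) = 1 / y ^ 2 := by
      rw [eq_div_iff (by positivity)]; exact hx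
    rw [hx']
    have hq0 : 0 ≤ q := Real.sqrt_nonneg _
    have h3 : 0 ≤ (y - q) ^ 2 * (2 * y + q) := by positivity
    have h4 : 3 / 2 * q - 1 / 2 * q ^ 3 * (1 / y ^ 2) = (3 * q * y ^ 2 - q ^ 3) / (2 * y ^ 2) := by
      field_simp
    rw [h4, div_le_iff₀ (by positivity)]
    nlinarith
  have hc : Continuous fun s : ℝ => Real.exp (2 * ν * BH s.toNNReal ω) := by fun_prop
  have hint := intervalIntegral.integral_mono_on (μ := volume) ht'.le
    ((by fun_prop : Continuous fun s : ℝ => 3 / 2 * q - 1 / 2 * q ^ 3 *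
      Real.exp (2 * ν * BH s.toNNReal ω)).intervalIntegrable 0 (t : ℝ))
    ((by fun_prop : Continuous fun s : ℝ => Real.exp (-ν * BH s.toNNReal ω)).intervalIntegrable
      0 (t : ℝ)) (fun s _ => hpt s)
  refine le_trans (le_of_eq ?_) hint
  rw [intervalIntegral.integral_sub intervalIntegrable_const
    ((hc.const_mul _).intervalIntegrable _ _), intervalIntegral.integral_const,
    intervalIntegral.integral_const_mul]
  change _ = _ - 1 / 2 * q ^ 3 * v
  rw [smul_eq_mul, sub_zero]
  linear_combination (1 / 2 * q) * hq2

lemma IsFBMGeneratedBy.integrable_inv_sqrt_intVar [IsProbabilityMeasure P]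
    (hBH : IsFBMGeneratedBy ℱ P H B BH) (hB : IsFilteredBM ℱ P B) (hH : 0 < H ∧ H < 1) (ν : ℝ)
    (t : ℝ≥0) (ht : 0 < t) : Integrable (fun ω => (√(intVar ν BH t ω))⁻¹) P := by
  -- Used with -ν only for the square integrability of e^{-ν B^H} on [0, t] × Ω, which makes the
  -- right side of the Jensen bound integrable.
  obtain ⟨-, -, -, hL, -⟩ := hBH.exists_stepProc hB hH (-ν) t ht
  obtain ⟨V, hVm, hV⟩ := hBH.intVar_ae_eq hB hH ν t ht
  have h𝒢 : MeasurableSpace.comap (fun ω t => B t ω) inferInstance ≤ mΩ :=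
    measurable_iff_comap_le.1 (measurable_pi_lambda _ fun s => hB.measurable s)
  have hm : AEMeasurable (intVar ν BH t) P := ⟨V, hVm.mono h𝒢 le_rfl, hV⟩
  have ht' : (0 : ℝ) < t := ht
  have hi := (hL.integrable (by norm_num)).integral_prod_right.const_mul (t * √t)⁻¹
  refine hi.mono' (hm.sqrt.inv).aestronglyMeasurable ?_
  filter_upwards [hBH.cont] with ω hω
  have h := mul_sqrt_div_intVar_le (ν := ν) ht hω
  have hv := intVar_pos (ν := ν) ht hω
  rw [Real.norm_of_nonneg (by positivity), integral_Icc_eq_integral_Ioc,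
    ← intervalIntegral.integral_of_le ht'.le, inv_mul_eq_div, le_div_iff₀ (by positivity)]
  refine le_trans (le_of_eq ?_) h
  rw [Real.sqrt_div ht'.le]
  ring

end InverseMoment

end FSABR

namespace FSABR

/-! ### Mixtures of Gaussians -/

/-- If, conditionally on `𝒢`, `N` is centred Gaussian with variance `h V`, then `(N, V)` has the
law of `(√(h V) G, V)` with `G` standard normal and independent of `V`. -/
theorem lintegral_of_condGaussian {Ω β : Type*} {𝒢 mΩ : MeasurableSpace Ω} [MeasurableSpace β]
    {P : Measure Ω} [IsProbabilityMeasure P] (h𝒢 : 𝒢 ≤ mΩ) {V : Ω → β} (hV : Measurable[𝒢] V)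
    {N : Ω → ℝ} (hN : AEMeasurable N P) {h : β → ℝ} (hh : Measurable h)
    (h0 : ∀ᵐ ω ∂P, 0 ≤ h (V ω))
    (hcf : ∀ A, MeasurableSet[𝒢] A → ∀ ξ : ℝ, ∫ ω in A, Complex.exp (ξ * N ω * Complex.I) ∂P =
      ∫ ω in A, Complex.exp ((-(h (V ω) * ξ ^ 2 / 2) : ℝ)) ∂P)
    {f : ℝ × β → ℝ≥0∞} (hf : Measurable f) :
    ∫⁻ ω, f (N ω, V ω) ∂P =
      ∫⁻ ω, ∫⁻ n, f (√(h (V ω)) * n, V ω) ∂(gaussianReal 0 1) ∂P := by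
  have hVm : Measurable V := hV.mono h𝒢 le_rfl
  have hNV : AEMeasurable (fun ω => (N ω, V ω)) P := hN.prodMk hVm.aemeasurable
  have hT : Measurable (fun z : Ω × ℝ => (√(h (V z.1)) * z.2, V z.1)) := by fun_prop
  have key : P.map (fun ω => (N ω, V ω)) =
      (P.prod (gaussianReal 0 1)).map (fun z : Ω × ℝ => (√(h (V z.1)) * z.2, V z.1)) := by
    have : IsProbabilityMeasure (P.map (fun ω => (N ω, V ω))) :=
      Measure.isProbabilityMeasure_map hNV
    refine Measure.ext_prod fun {E S} hE hS => ?_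
    have hA : MeasurableSet[𝒢] (V ⁻¹' S) := hV hS
    have hA' : MeasurableSet (V ⁻¹' S) := h𝒢 _ hA
    have hT1 : Measurable (fun z : Ω × ℝ => √(h (V z.1)) * z.2) := by fun_prop
    -- Equality on rectangles E × S suffices. For fixed S both sides are finite measures in E, and
    -- the hypothesis on 𝒢-measurable sets says that their characteristic functions agree.
    have hμ : (P.restrict (V ⁻¹' S)).map N =
        ((P.restrict (V ⁻¹' S)).prod (gaussianReal 0 1)).map
          (fun z : Ω × ℝ => √(h (V z.1)) * z.2) := by
      refine Measure.ext_of_charFun (funext fun ξ => ?_)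
      have hc : Continuous fun x : ℝ => Complex.exp (ξ * x * Complex.I) := by fun_prop
      rw [charFun_apply_real, charFun_apply_real, integral_map hN.restrict
        hc.aestronglyMeasurable, integral_map hT1.aemeasurable hc.aestronglyMeasurable,
        hcf _ hA ξ, integral_prod]
      · refine integral_congr_ae ?_
        filter_upwards [ae_restrict_of_ae h0] with ω hω
        have hg := charFun_gaussianReal (μ := 0) (v := 1) (ξ * √(h (V ω)))
        rw [charFun_apply_real] at hg
        have e : ∀ n : ℝ, Complex.exp (ξ * ((√(h (V ω)) * n : ℝ) : ℂ) * Complex.I) =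
            Complex.exp (((ξ * √(h (V ω)) : ℝ) : ℂ) * n * Complex.I) := fun n => by
          push_cast; ring_nf
        simp only [e]
        rw [hg, ← Complex.ofReal_pow, mul_pow, Real.sq_sqrt hω]
        congr 1
        push_cast
        ring
      · refine Integrable.of_bound (C := 1) (hc.measurable.comp hT1).aestronglyMeasurable
          (ae_of_all _ fun z => ?_)
        rw [← Complex.ofReal_mul, Complex.norm_exp_ofReal_mul_I]
    have h1 := DFunLike.congr_fun hμ E
    rw [Measure.map_apply_of_aemeasurable hN.restrict hE, Measure.map_apply hT1 hE,
      Measure.restrict_apply₀' hA'.nullMeasurableSet] at h1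
    rw [Measure.map_apply_of_aemeasurable hNV (hE.prod hS), Measure.map_apply hT (hE.prod hS)]
    have e1 : (fun ω => (N ω, V ω)) ⁻¹' E ×ˢ S = N ⁻¹' E ∩ V ⁻¹' S := by
      ext ω; simp
    have e2 : (fun z : Ω × ℝ => (√(h (V z.1)) * z.2, V z.1)) ⁻¹' E ×ˢ S =
        (fun z : Ω × ℝ => √(h (V z.1)) * z.2) ⁻¹' E ∩ (V ⁻¹' S) ×ˢ Set.univ := by
      ext z; simp
    rw [e1, e2, h1, ← Measure.restrict_apply (hT1 hE), ← Measure.prod_restrict,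
      Measure.restrict_univ]
  rw [← lintegral_map' (f := f) hf.aemeasurable hNV, key, lintegral_map hf hT,
    lintegral_prod (fun z : Ω × ℝ => f (√(h (V z.1)) * z.2, V z.1)) (hf.comp hT).aemeasurable]

lemma lintegral_affine_gaussian (m σ : ℝ) (hσ : 0 < σ) {f : ℝ → ℝ≥0∞} (hf : Measurable f) :
    ∫⁻ n, f (m + σ * n) ∂(gaussianReal 0 1) =
      ∫⁻ x, f x * gaussianPDF m (σ ^ 2).toNNReal x := by
  have hmap : (gaussianReal 0 1).map (fun n => m + σ * n) = gaussianReal m (σ ^ 2).toNNReal := by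
    have h1 := gaussianReal_map_const_mul (μ := 0) (v := 1) σ
    have h2 := gaussianReal_map_const_add (μ := σ * 0) (v := NNReal.mk (σ ^ 2) (sq_nonneg _) * 1) m
    rw [← h1, Measure.map_map (by fun_prop) (by fun_prop)] at h2
    rw [mul_zero, zero_add, mul_one] at h2
    rw [Real.toNNReal_of_nonneg (sq_nonneg σ)]
    exact h2
  have hv : (σ ^ 2).toNNReal ≠ 0 := by
    rw [Ne, Real.toNNReal_eq_zero, not_le]; positivity
  rw [← lintegral_map hf (by fun_prop), hmap, gaussianReal_of_var_ne_zero _ hv,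
    lintegral_withDensity_eq_lintegral_mul _ (measurable_gaussianPDF _ _) hf]
  simp only [Pi.mul_apply, mul_comm]

/-- The Fourier representation of the Gaussian density. -/
lemma integral_cexp_mul_cexp (b d : ℝ) (hb : 0 < b) :
    ∫ ξ : ℝ, Complex.exp (Complex.I * (d : ℂ) * (ξ : ℂ)) *
      Complex.exp ((-(b * ξ ^ 2 / 2) : ℝ) : ℂ) =
      ((2 * Real.pi * gaussianPDFReal 0 b.toNNReal d : ℝ) : ℂ) := by
  have h := fourierIntegral_gaussian (b := ((b / 2 : ℝ) : ℂ)) (by simpa using hb) (d : ℂ)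
  have e : ∀ ξ : ℝ, (-((b / 2 : ℝ) : ℂ) * (ξ : ℂ) ^ 2) = ((-(b * ξ ^ 2 / 2) : ℝ) : ℂ) := fun ξ => by
    push_cast; ring
  simp only [e] at h
  rw [h, gaussianPDFReal, Real.coe_toNNReal _ hb.le]
  have e1 : ((Real.pi : ℂ) / ((b / 2 : ℝ) : ℂ)) ^ (1 / 2 : ℂ) =
      ((√(2 * Real.pi / b) : ℝ) : ℂ) := by
    rw [Real.sqrt_eq_rpow, Complex.ofReal_cpow (by positivity)]
    congr 1
    · push_cast; field_simp
    · push_cast; rfl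
  have e2 : (-(d : ℂ) ^ 2 / (4 * ((b / 2 : ℝ) : ℂ))) = ((-(d - 0) ^ 2 / (2 * b) : ℝ) : ℂ) := by
    push_cast
    have : (b : ℂ) ≠ 0 := by exact_mod_cast hb.ne'
    field_simp
    ring
  rw [e1, e2, ← Complex.ofReal_exp, ← Complex.ofReal_mul, ← mul_assoc]
  congr 2
  have hpi := Real.pi_pos
  have h3 : √(2 * Real.pi * b) ^ 2 = 2 * Real.pi * b := Real.sq_sqrt (by positivity)
  have h4 : √(2 * Real.pi / b) = √(2 * Real.pi * b) / b := by
    rw [eq_div_iff hb.ne', ← Real.sqrt_sq hb.le, ← Real.sqrt_mul (by positivity),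
      Real.sqrt_sq hb.le]
    congr 1
    field_simp
  have h5 : √(2 * Real.pi * b) ≠ 0 := by positivity
  rw [h4]
  field_simp
  linarith

/-- The change of variables `y = y₀ e^{ν u}`. -/
lemma lintegral_comp_mul_exp (ν y₀ : ℝ) (hν : ν ≠ 0) (hy₀ : 0 < y₀) (G : ℝ → ℝ≥0∞) :
    ∫⁻ y in Set.Ioi 0, G y =
      ∫⁻ u, ENNReal.ofReal (|ν| * (y₀ * Real.exp (ν * u))) * G (y₀ * Real.exp (ν * u)) := by
  have himg : (fun u => y₀ * Real.exp (ν * u)) '' Set.univ = Set.Ioi 0 := by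
    ext y
    simp only [Set.image_univ, Set.mem_range, Set.mem_Ioi]
    constructor
    · rintro ⟨u, rfl⟩; positivity
    · intro hy
      refine ⟨Real.log (y / y₀) / ν, ?_⟩
      rw [mul_div_cancel₀ _ hν, Real.exp_log (by positivity)]
      field_simp
  have hinj : Set.InjOn (fun u => y₀ * Real.exp (ν * u)) Set.univ := fun u _ w _ huw => by
    have := Real.exp_injective (mul_left_cancel₀ hy₀.ne' huw)
    exact mul_left_cancel₀ hν this
  have hd : ∀ u ∈ Set.univ, HasDerivWithinAt (fun u => y₀ * Real.exp (ν * u))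
      (ν * (y₀ * Real.exp (ν * u))) Set.univ u := fun u _ => by
    have := (((hasDerivAt_id u).const_mul ν).exp.const_mul y₀).hasDerivWithinAt (s := Set.univ)
    refine this.congr_deriv ?_
    simp only [id]; ring
  rw [← himg, lintegral_image_eq_lintegral_abs_deriv_mul MeasurableSet.univ hd hinj,
    setLIntegral_univ]
  refine lintegral_congr fun u => ?_
  rw [abs_mul, abs_of_pos (show 0 < y₀ * Real.exp (ν * u) by positivity)]

/-- A property holding for almost every `u` holds at `u = ln (y / y₀) / ν` for almost every
`y > 0`. -/
lemma ae_log_div (ν y₀ : ℝ) (hν : ν ≠ 0) (hy₀ : 0 < y₀) {p : ℝ → Prop} (hp : ∀ᵐ u : ℝ, p u) :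
    ∀ᵐ y : ℝ, 0 < y → p (Real.log (y / y₀) / ν) := by
  have h : volume ((fun u => y₀ * Real.exp (ν * u)) '' {u | ¬ p u}) = 0 :=
    addHaar_image_eq_zero_of_differentiableOn_of_addHaar_eq_zero _
      (by fun_prop) (ae_iff.1 hp)
  rw [ae_iff]
  refine measure_mono_null (fun y hy => ?_) h
  obtain ⟨hy0, hy1⟩ : 0 < y ∧ ¬ p (Real.log (y / y₀) / ν) := by simpa using hy
  refine ⟨_, hy1, ?_⟩
  simp only
  rw [mul_div_cancel₀ _ hν, Real.exp_log (by positivity)]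
  field_simp

/-- The relation between the density of `B^H_t` and the lognormal density. -/
lemma mul_lognormalDensity (H ν y₀ t : ℝ) (hν : ν ≠ 0) (hy₀ : 0 < y₀) (ht : 0 < t) (u : ℝ) :
    |ν| * (y₀ * Real.exp (ν * u)) * lognormalDensity H ν y₀ t (y₀ * Real.exp (ν * u)) =
      gaussianPDFReal 0 (t ^ (2 * H)).toNNReal u := by
  have hT : 0 < t ^ (2 * H) := Real.rpow_pos_of_pos ht _
  have hpi := Real.pi_pos
  have hν' : 0 < |ν| := abs_pos.2 hν
  have hE := Real.exp_pos (ν * u)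
  have e1 : √(2 * Real.pi * ν ^ 2 * t ^ (2 * H)) = |ν| * √(2 * Real.pi * t ^ (2 * H)) := by
    rw [← Real.sqrt_sq_eq_abs, ← Real.sqrt_mul (sq_nonneg _)]
    congr 1; ring
  have h5 : 0 < √(2 * Real.pi * t ^ (2 * H)) := by positivity
  rw [lognormalDensity, gaussianPDFReal, Real.coe_toNNReal _ hT.le, mul_div_cancel_left₀ _ hy₀.ne',
    Real.log_exp, e1]
  have e2 : -(ν * u) ^ 2 / (2 * ν ^ 2 * t ^ (2 * H)) = -(u - 0) ^ 2 / (2 * t ^ (2 * H)) := by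
    field_simp; ring
  rw [e2]
  field_simp

end FSABR

namespace FSABR

/-! ### Mixtures of conditional Gaussian densities and their Fourier representation -/

section Bridge

/-- The conditional mean of `X_t` given `z = (∫ e^{ν B^H} dB, v_t)`. -/
noncomputable def condMean (ρ x₀ y₀ : ℝ) (z : ℝ × ℝ) : ℝ :=
  x₀ + ρ * y₀ * z.1 - y₀ ^ 2 / 2 * z.2

/-- The conditional variance of `X_t` given `z = (∫ e^{ν B^H} dB, v_t)`. -/
noncomputable def condVar (ρ y₀ : ℝ) (z : ℝ × ℝ) : ℝ := (1 - ρ ^ 2) * y₀ ^ 2 * z.2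

/-- The conditional density of `X_t` given `z = (∫ e^{ν B^H} dB, v_t)`. -/
noncomputable def condPDFReal (ρ x₀ y₀ : ℝ) (z : ℝ × ℝ) (x : ℝ) : ℝ :=
  gaussianPDFReal (condMean ρ x₀ y₀ z) (condVar ρ y₀ z).toNNReal x

lemma condPDFReal_nonneg (ρ x₀ y₀ : ℝ) (z : ℝ × ℝ) (x : ℝ) : 0 ≤ condPDFReal ρ x₀ y₀ z x :=
  gaussianPDFReal_nonneg _ _ _

lemma measurable_condPDFReal (ρ x₀ y₀ : ℝ) :
    Measurable (fun w : (ℝ × ℝ) × ℝ => condPDFReal ρ x₀ y₀ w.1 w.2) := by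
  unfold condPDFReal gaussianPDFReal condMean condVar
  fun_prop

/-- The integrand of the bridge representation. -/
noncomputable def bridgeIntegrand (ρ x₀ y₀ x ξ : ℝ) (z : ℝ × ℝ) : ℂ :=
  Complex.exp (Complex.I * ((x - x₀ - ρ * y₀ * z.1 + y₀ ^ 2 * z.2 / 2 : ℝ) : ℂ) * (ξ : ℂ)) *
    Complex.exp ((-((1 - ρ ^ 2) * y₀ ^ 2 * z.2 * ξ ^ 2 / 2) : ℝ) : ℂ)

lemma norm_bridgeIntegrand (ρ x₀ y₀ x ξ : ℝ) (z : ℝ × ℝ) :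
    ‖bridgeIntegrand ρ x₀ y₀ x ξ z‖ = Real.exp (-(condVar ρ y₀ z / 2) * ξ ^ 2) := by
  have e : Complex.I * ((x - x₀ - ρ * y₀ * z.1 + y₀ ^ 2 * z.2 / 2 : ℝ) : ℂ) * (ξ : ℂ) =
      (((x - x₀ - ρ * y₀ * z.1 + y₀ ^ 2 * z.2 / 2) * ξ : ℝ) : ℂ) * Complex.I := by
    push_cast; ring
  rw [bridgeIntegrand, e, norm_mul, Complex.norm_exp_ofReal_mul_I, one_mul, ← Complex.ofReal_exp,
    Complex.norm_real, Real.norm_of_nonneg (Real.exp_pos _).le, condVar]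
  congr 1; ring

lemma integral_bridgeIntegrand (ρ x₀ y₀ x : ℝ) (z : ℝ × ℝ) (hz : 0 < condVar ρ y₀ z) :
    ∫ ξ : ℝ, bridgeIntegrand ρ x₀ y₀ x ξ z =
      ((2 * Real.pi * condPDFReal ρ x₀ y₀ z x : ℝ) : ℂ) := by
  have h := integral_cexp_mul_cexp (condVar ρ y₀ z) (x - condMean ρ x₀ y₀ z) hz
  have e1 : x - x₀ - ρ * y₀ * z.1 + y₀ ^ 2 * z.2 / 2 = x - condMean ρ x₀ y₀ z := by
    rw [condMean]; ring
  have e2 : gaussianPDFReal 0 (condVar ρ y₀ z).toNNReal (x - condMean ρ x₀ y₀ z) =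
      condPDFReal ρ x₀ y₀ z x := by
    rw [condPDFReal, gaussianPDFReal, gaussianPDFReal, sub_zero]
  rw [← e2, ← h]
  simp only [bridgeIntegrand, e1, condVar]

/-- Fubini's theorem for the bridge representation. -/
lemma integral_integral_bridgeIntegrand {ρ x₀ y₀ : ℝ} (hρ : 0 < 1 - ρ ^ 2) (hy₀ : 0 < y₀)
    (κ : Measure (ℝ × ℝ)) [IsProbabilityMeasure κ] (hpos : ∀ᵐ z ∂κ, 0 < z.2)
    (hint : Integrable (fun z : ℝ × ℝ => (√z.2)⁻¹) κ) (x : ℝ) :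
    Integrable (fun ξ => ∫ z, bridgeIntegrand ρ x₀ y₀ x ξ z ∂κ) ∧
    Integrable (fun z => condPDFReal ρ x₀ y₀ z x) κ ∧
    ((∫ z, condPDFReal ρ x₀ y₀ z x ∂κ : ℝ) : ℂ) =
      1 / (2 * (Real.pi : ℂ)) * ∫ ξ, ∫ z, bridgeIntegrand ρ x₀ y₀ x ξ z ∂κ := by
  have hvar : ∀ᵐ z ∂κ, 0 < condVar ρ y₀ z := by
    filter_upwards [hpos] with z hz
    unfold condVar; positivity
  have hm : Measurable (fun w : ℝ × (ℝ × ℝ) => bridgeIntegrand ρ x₀ y₀ x w.1 w.2) := by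
    unfold bridgeIntegrand
    fun_prop
  have hI : Integrable (fun w : ℝ × (ℝ × ℝ) => bridgeIntegrand ρ x₀ y₀ x w.1 w.2)
      ((volume : Measure ℝ).prod κ) := by
    rw [integrable_prod_iff' hm.aestronglyMeasurable]
    constructor
    · filter_upwards [hvar] with z hz
      refine (integrable_norm_iff ?_).1 ?_
      · exact (hm.comp (measurable_id.prodMk measurable_const)).aestronglyMeasurable
      · simp only [norm_bridgeIntegrand]
        exact integrable_exp_neg_mul_sq (by positivity)
    -- The modulus is e^{-`condVar` ξ²/2}, whose ξ-integral √(2π/`condVar`) is a constant times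
    -- v^{-1/2}. This is where the inverse moment enters.
    · have h := hint.const_mul (√(2 * Real.pi / ((1 - ρ ^ 2) * y₀ ^ 2)))
      refine h.congr ?_
      filter_upwards [hpos] with z hz
      simp only [norm_bridgeIntegrand]
      rw [integral_gaussian, condVar, ← div_eq_mul_inv, ← Real.sqrt_div (by positivity)]
      congr 1
      field_simp
  have hpdf : Integrable (fun z => condPDFReal ρ x₀ y₀ z x) κ := by
    have h := hint.const_mul (√(2 * Real.pi * ((1 - ρ ^ 2) * y₀ ^ 2)))⁻¹
    refine h.mono' ((measurable_condPDFReal ρ x₀ y₀).comp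
      (measurable_id.prodMk measurable_const)).aestronglyMeasurable ?_
    filter_upwards [hvar, hpos] with z hz hz2
    rw [Real.norm_of_nonneg (condPDFReal_nonneg ρ x₀ y₀ z x), condPDFReal, gaussianPDFReal,
      Real.coe_toNNReal _ hz.le, ← mul_inv, ← Real.sqrt_mul (by positivity)]
    have e : 2 * Real.pi * ((1 - ρ ^ 2) * y₀ ^ 2) * z.2 = 2 * Real.pi * condVar ρ y₀ z := by
      rw [condVar]; ring
    rw [e]
    refine mul_le_of_le_one_right (by positivity) (Real.exp_le_one_iff.2 ?_)
    exact div_nonpos_of_nonpos_of_nonneg (neg_nonpos.2 (sq_nonneg _)) (by positivity)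
  refine ⟨hI.integral_prod_left, hpdf, ?_⟩
  have hswap := integral_integral_swap (f := fun ξ z => bridgeIntegrand ρ x₀ y₀ x ξ z) hI
  have h2 : ∫ z, (∫ ξ, bridgeIntegrand ρ x₀ y₀ x ξ z) ∂κ =
      ∫ z, ((2 * Real.pi * condPDFReal ρ x₀ y₀ z x : ℝ) : ℂ) ∂κ :=
    integral_congr_ae (by
      filter_upwards [hvar] with z hz
      exact integral_bridgeIntegrand ρ x₀ y₀ x z hz)
  rw [hswap, h2, integral_complex_ofReal, integral_const_mul]
  have hpi : (Real.pi : ℂ) ≠ 0 := by exact_mod_cast Real.pi_ne_zero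
  push_cast
  field_simp

/-- The density of `X_t` given `B^H_t = u`. -/
noncomputable def bridgeDensity (κ : Kernel ℝ (ℝ × ℝ)) (ρ x₀ y₀ u x : ℝ) : ℝ≥0∞ :=
  ∫⁻ z, ENNReal.ofReal (condPDFReal ρ x₀ y₀ z x) ∂(κ u)

lemma measurable_bridgeDensity (κ : Kernel ℝ (ℝ × ℝ)) [IsSFiniteKernel κ] (ρ x₀ y₀ : ℝ) :
    Measurable (fun w : ℝ × ℝ => bridgeDensity κ ρ x₀ y₀ w.1 w.2) := by
  have h := Measurable.lintegral_kernel_prod_right (κ := κ.comap Prod.fst measurable_fst)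
    (f := fun (w : ℝ × ℝ) (z : ℝ × ℝ) => ENNReal.ofReal (condPDFReal ρ x₀ y₀ z w.2))
    (((measurable_condPDFReal ρ x₀ y₀).comp
      (measurable_snd.prodMk (measurable_snd.comp measurable_fst))).ennreal_ofReal)
  simpa only [Kernel.comap_apply] using! h

/-- The joint density of `(X_t, Y_t)`. -/
noncomputable def jointDensity (κ : Kernel ℝ (ℝ × ℝ)) (H ν ρ x₀ y₀ t : ℝ) (w : ℝ × ℝ) : ℝ≥0∞ :=
  Set.indicator (Set.Ioi 0) (fun y => bridgeDensity κ ρ x₀ y₀ (Real.log (y / y₀) / ν) w.1 *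
    ENNReal.ofReal (lognormalDensity H ν y₀ t y)) w.2

lemma measurable_jointDensity (κ : Kernel ℝ (ℝ × ℝ)) [IsSFiniteKernel κ] (H ν ρ x₀ y₀ t : ℝ) :
    Measurable (jointDensity κ H ν ρ x₀ y₀ t) := by
  have e : jointDensity κ H ν ρ x₀ y₀ t = Set.indicator (Prod.snd ⁻¹' Set.Ioi 0)
      (fun w : ℝ × ℝ => bridgeDensity κ ρ x₀ y₀ (Real.log (w.2 / y₀) / ν) w.1 *
        ENNReal.ofReal (lognormalDensity H ν y₀ t w.2)) := by
    ext w
    by_cases h : w.2 ∈ Set.Ioi (0 : ℝ) <;> simp [jointDensity, Set.indicator]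
  rw [e]
  refine Measurable.indicator (Measurable.mul ?_ ?_) (measurable_snd measurableSet_Ioi)
  · exact (measurable_bridgeDensity κ ρ x₀ y₀).comp (Measurable.prodMk
      (by fun_prop : Measurable fun w : ℝ × ℝ => Real.log (w.2 / y₀) / ν) measurable_fst)
  · unfold lognormalDensity
    fun_prop

/-- The density of `X_t` given `B^H_t = u`, as a mixture of Gaussian densities. -/
lemma lintegral_lintegral_condPDFReal (κ : Kernel ℝ (ℝ × ℝ)) [IsMarkovKernel κ] (ρ x₀ y₀ u : ℝ)
    {f : ℝ → ℝ≥0∞} (hf : Measurable f) :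
    ∫⁻ z, (∫⁻ x, f x * ENNReal.ofReal (condPDFReal ρ x₀ y₀ z x)) ∂(κ u) =
      ∫⁻ x, f x * bridgeDensity κ ρ x₀ y₀ u x := by
  have hk := (measurable_condPDFReal ρ x₀ y₀).ennreal_ofReal
  have hm : AEMeasurable (Function.uncurry fun (z : ℝ × ℝ) (x : ℝ) =>
      f x * ENNReal.ofReal (condPDFReal ρ x₀ y₀ z x)) ((κ u).prod volume) :=
    ((hf.comp measurable_snd).mul hk).aemeasurable
  rw [lintegral_lintegral_swap hm]
  simp only [bridgeDensity]
  refine lintegral_congr fun x => ?_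
  have hkx : Measurable fun z : ℝ × ℝ => ENNReal.ofReal (condPDFReal ρ x₀ y₀ z x) := by
    unfold condPDFReal gaussianPDFReal condMean condVar
    fun_prop
  exact lintegral_const_mul (f x) hkx

/-- The joint density, in terms of the conditional law of `(∫ e^{ν B^H} dB, v_t)` given `B^H_t`. -/
lemma lintegral_jointDensity (κ : Kernel ℝ (ℝ × ℝ)) [IsMarkovKernel κ] {H ν y₀ t : ℝ} (ρ x₀ : ℝ)
    (hν : ν ≠ 0) (hy₀ : 0 < y₀) (ht : 0 < t) {F : ℝ × ℝ → ℝ≥0∞} (hF : Measurable F) :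
    ∫⁻ u, ∫⁻ z, (∫⁻ x, F (x, y₀ * Real.exp (ν * u)) *
      ENNReal.ofReal (condPDFReal ρ x₀ y₀ z x)) ∂(κ u) ∂(gaussianReal 0 (t ^ (2 * H)).toNNReal) =
    ∫⁻ w, jointDensity κ H ν ρ x₀ y₀ t w * F w := by
  have hq := measurable_bridgeDensity κ ρ x₀ y₀
  have h1 : ∀ u, ∫⁻ z, (∫⁻ x, F (x, y₀ * Real.exp (ν * u)) *
      ENNReal.ofReal (condPDFReal ρ x₀ y₀ z x)) ∂(κ u) =
      ∫⁻ x, F (x, y₀ * Real.exp (ν * u)) * bridgeDensity κ ρ x₀ y₀ u x := fun u =>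
    lintegral_lintegral_condPDFReal κ ρ x₀ y₀ u (hF.comp (measurable_id.prodMk measurable_const))
  have hv : (t ^ (2 * H)).toNNReal ≠ 0 := by
    rw [Ne, Real.toNNReal_eq_zero, not_le]; exact Real.rpow_pos_of_pos ht _
  have hG : Measurable (fun w : ℝ × ℝ => F (w.2, y₀ * Real.exp (ν * w.1)) *
      bridgeDensity κ ρ x₀ y₀ w.1 w.2) := (hF.comp (by fun_prop)).mul hq
  simp only [h1]
  rw [gaussianReal_of_var_ne_zero _ hv, lintegral_withDensity_eq_lintegral_mul _
    (measurable_gaussianPDF _ _) hG.lintegral_prod_right']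
  have hR : ∫⁻ w, jointDensity κ H ν ρ x₀ y₀ t w * F w =
      ∫⁻ x, ∫⁻ y, jointDensity κ H ν ρ x₀ y₀ t (x, y) * F (x, y) := by
    rw [Measure.volume_eq_prod]
    exact lintegral_prod _ ((measurable_jointDensity κ H ν ρ x₀ y₀ t).mul hF).aemeasurable
  have hx : ∀ x, ∫⁻ y, jointDensity κ H ν ρ x₀ y₀ t (x, y) * F (x, y) =
      ∫⁻ u, gaussianPDF 0 (t ^ (2 * H)).toNNReal u *
        (F (x, y₀ * Real.exp (ν * u)) * bridgeDensity κ ρ x₀ y₀ u x) := fun x => by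
    have e : ∀ y, jointDensity κ H ν ρ x₀ y₀ t (x, y) * F (x, y) = Set.indicator (Set.Ioi 0)
        (fun y => bridgeDensity κ ρ x₀ y₀ (Real.log (y / y₀) / ν) x *
          ENNReal.ofReal (lognormalDensity H ν y₀ t y) * F (x, y)) y := fun y => by
      by_cases h : y ∈ Set.Ioi (0 : ℝ) <;> simp [jointDensity, Set.indicator]
    simp only [e]
    rw [lintegral_indicator measurableSet_Ioi, lintegral_comp_mul_exp ν y₀ hν hy₀]
    refine lintegral_congr fun u => ?_
    have hu : Real.log (y₀ * Real.exp (ν * u) / y₀) / ν = u := by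
      rw [mul_div_cancel_left₀ _ hy₀.ne', Real.log_exp, mul_div_cancel_left₀ _ hν]
    -- The Jacobian |ν| y₀ e^{νu} times the lognormal density is the Gaussian density of B^H_t.
    rw [hu, gaussianPDF, ← mul_lognormalDensity H ν y₀ t hν hy₀ ht u,
      mul_comm |ν|, ENNReal.ofReal_mul (p := y₀ * Real.exp (ν * u) * |ν|) (by positivity)]
    ring
  rw [hR]
  simp only [hx]
  rw [lintegral_lintegral_swap]
  · refine lintegral_congr fun u => ?_
    simp only [Pi.mul_apply]
    have hGu : Measurable fun x => F (x, y₀ * Real.exp (ν * u)) * bridgeDensity κ ρ x₀ y₀ u x :=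
      hG.comp (measurable_const.prodMk measurable_id)
    rw [lintegral_const_mul _ hGu]
  · exact (((measurable_gaussianPDF _ _).comp measurable_snd).mul
      (hG.comp measurable_swap)).aemeasurable

end Bridge

end FSABR

namespace FSABR

/-! ### The joint law of log-price and volatility -/

section Density

variable {Ω : Type*} {mΩ : MeasurableSpace Ω} {P : Measure Ω} [IsProbabilityMeasure P]
  {ℱ : Filtration ℝ≥0 mΩ} {B W BH X Y : ℝ≥0 → Ω → ℝ} {H ν ρ x₀ y₀ : ℝ}

lemma IsFBMGeneratedBy.aemeasurable_intVar (hBH : IsFBMGeneratedBy ℱ P H B BH)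
    (hB : IsFilteredBM ℱ P B) (hH : 0 < H ∧ H < 1) (ν : ℝ) (t : ℝ≥0) (ht : 0 < t) :
    AEMeasurable (intVar ν BH t) P := by
  obtain ⟨V, hV, hVe⟩ := hBH.intVar_ae_eq hB hH ν t ht
  exact ⟨V, hV.mono (measurable_iff_comap_le.1
    (measurable_pi_lambda _ fun s => hB.measurable s)) le_rfl, hVe⟩

lemma IsLognormalFSABR.aemeasurable (hXY : IsLognormalFSABR ℱ P B W BH ν ρ x₀ y₀ X Y)
    (hBH : IsFBMGeneratedBy ℱ P H B BH) (hB : IsFilteredBM ℱ P B) (hW : IsFilteredBM ℱ P W)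
    (hH : 0 < H ∧ H < 1) (t : ℝ≥0) (ht : 0 < t) :
    AEMeasurable (fun ω => (X t ω, Y t ω)) P := by
  have h1 := hBH.aemeasurable_expIntegral hB hB hH ν t ht
  have h2 := hBH.aemeasurable_expIntegral hB hW hH ν t ht
  have h3 := hBH.aemeasurable_intVar hB hH ν t ht
  have h4 := (hBH.hasLaw hB hH t).aemeasurable
  refine AEMeasurable.prodMk ?_ ?_
  · refine AEMeasurable.congr ?_ (EventuallyEq.symm (hXY.logPrice t))
    exact ((((h1.const_mul ρ).add (h2.const_mul _)).const_mul y₀).const_add x₀).sub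
      (h3.const_mul _)
  · refine AEMeasurable.congr ?_ (EventuallyEq.symm (hXY.vol t))
    exact (Real.measurable_exp.comp_aemeasurable (h4.const_mul ν)).const_mul y₀

/-- Conditionally on `B`, the log-price is Gaussian. -/
lemma IsLognormalFSABR.lintegral_eq (hXY : IsLognormalFSABR ℱ P B W BH ν ρ x₀ y₀ X Y)
    (hBH : IsFBMGeneratedBy ℱ P H B BH) (hB : IsFilteredBM ℱ P B) (hW : IsFilteredBM ℱ P W)
    (hBW : IndepFun (fun ω t => B t ω) (fun ω t => W t ω) P) (hH : 0 < H ∧ H < 1)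
    (hρ : 0 < 1 - ρ ^ 2) (hy₀ : 0 < y₀) (t : ℝ≥0) (ht : 0 < t) {F : ℝ × ℝ → ℝ≥0∞}
    (hF : Measurable F) :
    ∫⁻ ω, F (X t ω, Y t ω) ∂P = ∫⁻ ω, (∫⁻ x, F (x, y₀ * Real.exp (ν * BH t ω)) *
      ENNReal.ofReal (condPDFReal ρ x₀ y₀ (expIntegral ℱ P ν BH B t ω, intVar ν BH t ω) x)) ∂P := by
  obtain ⟨v, hvm, hv⟩ := hBH.intVar_ae_eq hB hH ν t ht
  obtain ⟨J, hJm, hJ⟩ := hBH.expIntegral_ae_eq hB hH ν t ht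
  obtain ⟨U, hUm, hU⟩ := hBH.exists_version hB hH
  have hvpos : ∀ᵐ ω ∂P, 0 < v ω := by
    filter_upwards [hv, hBH.cont] with ω h1 h2
    rw [← h1]; exact intVar_pos ht h2
  -- J, v and U t are the versions measurable for the path of B; the conditionally Gaussian variable
  -- is the integral against W.
  have key := lintegral_of_condGaussian (P := P) (β := (ℝ × ℝ) × ℝ)
    (measurable_iff_comap_le.1 (measurable_pi_lambda _ fun s => hB.measurable s))
    (V := fun ω => ((J ω, v ω), U t ω))
    ((hJm.prodMk hvm).prodMk ((hUm t).mono (past_le_comap B t) le_rfl))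
    (hBH.aemeasurable_expIntegral hB hW hH ν t ht) (h := fun b => b.1.2) (by fun_prop)
    (hvpos.mono fun ω h => h.le)
    (fun A hA ξ => by
      rw [hBH.setIntegral_cexp_expIntegral hB hW hBW hH ν t ht hA ξ]
      refine integral_congr_ae (ae_restrict_of_ae ?_)
      filter_upwards [hv] with ω h
      rw [h])
    (f := fun w => F (condMean ρ x₀ y₀ w.2.1 + y₀ * √(1 - ρ ^ 2) * w.1,
      y₀ * Real.exp (ν * w.2.2)))
    (hF.comp (by unfold condMean; fun_prop))
  calc ∫⁻ ω, F (X t ω, Y t ω) ∂P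
      = ∫⁻ ω, F (condMean ρ x₀ y₀ (J ω, v ω) + y₀ * √(1 - ρ ^ 2) * expIntegral ℱ P ν BH W t ω,
          y₀ * Real.exp (ν * U t ω)) ∂P := by
        refine lintegral_congr_ae ?_
        filter_upwards [hXY.logPrice t, hXY.vol t, hv, hJ, hU t] with ω h1 h2 h3 h4 h5
        rw [h1, h2, h3, h4, h5, condMean]
        congr 2
        ring
    _ = _ := key
    _ = _ := by
        refine lintegral_congr_ae ?_
        filter_upwards [hv, hJ, hU t, hvpos] with ω h3 h4 h5 h6
        have hs : 0 < y₀ * √(1 - ρ ^ 2) * √(v ω) := by positivity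
        have h := lintegral_affine_gaussian (condMean ρ x₀ y₀ (J ω, v ω)) _ hs
          (f := fun x => F (x, y₀ * Real.exp (ν * U t ω))) (hF.comp (by fun_prop))
        have hsq : (y₀ * √(1 - ρ ^ 2) * √(v ω)) ^ 2 = condVar ρ y₀ (J ω, v ω) := by
          rw [mul_pow, mul_pow, Real.sq_sqrt hρ.le, Real.sq_sqrt h6.le, condVar]; ring
        rw [hsq] at h
        rw [h3, h4, ← h5]
        simp only [← mul_assoc]
        exact h

/-- The law of `(X_t, Y_t)` has the density `jointDensity`. -/
theorem IsLognormalFSABR.map_eq (hXY : IsLognormalFSABR ℱ P B W BH ν ρ x₀ y₀ X Y)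
    (hBH : IsFBMGeneratedBy ℱ P H B BH) (hB : IsFilteredBM ℱ P B) (hW : IsFilteredBM ℱ P W)
    (hBW : IndepFun (fun ω t => B t ω) (fun ω t => W t ω) P) (hH : 0 < H ∧ H < 1)
    (hν : ν ≠ 0) (hρ : 0 < 1 - ρ ^ 2) (hy₀ : 0 < y₀) (t : ℝ≥0) (ht : 0 < t) :
    P.map (fun ω => (X t ω, Y t ω)) = (volume : Measure (ℝ × ℝ)).withDensity
      (jointDensity (condDistrib (fun ω => (expIntegral ℱ P ν BH B t ω, intVar ν BH t ω))
        (BH t) P) H ν ρ x₀ y₀ t) := by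
  set Z := fun ω => (expIntegral ℱ P ν BH B t ω, intVar ν BH t ω) with hZdef
  have hZ : AEMeasurable Z P := (hBH.aemeasurable_expIntegral hB hB hH ν t ht).prodMk
    (hBH.aemeasurable_intVar hB hH ν t ht)
  have hlaw := hBH.hasLaw hB hH t
  refine Measure.ext_of_lintegral _ fun F hF => ?_
  have hm : Measurable fun w : ℝ × (ℝ × ℝ) => ∫⁻ x, F (x, y₀ * Real.exp (ν * w.1)) *
      ENNReal.ofReal (condPDFReal ρ x₀ y₀ w.2 x) := by
    refine Measurable.lintegral_prod_right' (f := fun w : (ℝ × (ℝ × ℝ)) × ℝ =>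
      F (w.2, y₀ * Real.exp (ν * w.1.1)) * ENNReal.ofReal (condPDFReal ρ x₀ y₀ w.1.2 w.2)) ?_
    refine (hF.comp (by fun_prop)).mul (Measurable.ennreal_ofReal ?_)
    exact (measurable_condPDFReal ρ x₀ y₀).comp
      ((measurable_snd.comp measurable_fst).prodMk measurable_snd)
  rw [lintegral_map' hF.aemeasurable (hXY.aemeasurable hBH hB hW hH t ht),
    hXY.lintegral_eq hBH hB hW hBW hH hρ hy₀ t ht hF,
    lintegral_withDensity_eq_lintegral_mul _ (measurable_jointDensity _ _ _ _ _ _ _) hF]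
  refine Eq.trans ?_ (lintegral_jointDensity (condDistrib Z (BH t) P) ρ x₀ hν hy₀
    (NNReal.coe_pos.2 ht) hF)
  -- The integrand depends on ω only through (B^H_t, Z), so its expectation disintegrates into the
  -- law of B^H_t and the conditional law of Z.
  rw [← hlaw.map_eq, ← Measure.lintegral_compProd hm, compProd_map_condDistrib hZ,
    lintegral_map' hm.aemeasurable (hlaw.aemeasurable.prodMk hZ)]

/-- For almost every `u`, the law of `(∫ e^{ν B^H} dB, v_t)` given `B^H_t = u` charges only `v_t > 0`
and integrates `v_t ^ (-1 / 2)`. -/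
lemma IsFBMGeneratedBy.ae_condDistrib (hBH : IsFBMGeneratedBy ℱ P H B BH)
    (hB : IsFilteredBM ℱ P B) (hH : 0 < H ∧ H < 1) (ν : ℝ) (t : ℝ≥0) (ht : 0 < t) :
    ∀ᵐ u : ℝ, (∀ᵐ z ∂(condDistrib (fun ω => (expIntegral ℱ P ν BH B t ω, intVar ν BH t ω))
        (BH t) P u), 0 < z.2) ∧
      Integrable (fun z : ℝ × ℝ => (√z.2)⁻¹) (condDistrib
        (fun ω => (expIntegral ℱ P ν BH B t ω, intVar ν BH t ω)) (BH t) P u) := by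
  set Z := fun ω => (expIntegral ℱ P ν BH B t ω, intVar ν BH t ω) with hZdef
  have hZ : AEMeasurable Z P := (hBH.aemeasurable_expIntegral hB hB hH ν t ht).prodMk
    (hBH.aemeasurable_intVar hB hH ν t ht)
  have hlaw := hBH.hasLaw hB hH t
  have hUZ : AEMeasurable (fun ω => (BH t ω, Z ω)) P := hlaw.aemeasurable.prodMk hZ
  have hv : ((t : ℝ) ^ (2 * H)).toNNReal ≠ 0 := by
    rw [Ne, Real.toNNReal_eq_zero, not_le]; exact Real.rpow_pos_of_pos (NNReal.coe_pos.2 ht) _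
  -- The conditional law is controlled only for almost every u under the law of B^H_t. That Gaussian
  -- law is nondegenerate because t > 0, so its null sets are Lebesgue null.
  have hac : (volume : Measure ℝ) ≪ P.map (BH t) := by
    rw [hlaw.map_eq]; exact gaussianReal_absolutelyContinuous' 0 hv
  have h1 : ∀ᵐ w ∂(P.map (BH t) ⊗ₘ condDistrib Z (BH t) P), 0 < w.2.2 := by
    rw [compProd_map_condDistrib hZ, ae_map_iff hUZ
      (measurableSet_lt measurable_const (by fun_prop))]
    filter_upwards [hBH.cont] with ω hω
    exact intVar_pos ht hω
  have h2 : Integrable (fun w : ℝ × (ℝ × ℝ) => (√w.2.2)⁻¹)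
      (P.map (BH t) ⊗ₘ condDistrib Z (BH t) P) := by
    rw [compProd_map_condDistrib hZ, integrable_map_measure
      (Measurable.aestronglyMeasurable (by fun_prop)) hUZ]
    exact hBH.integrable_inv_sqrt_intVar hB hH ν t ht
  have h3 := ((Measure.integrable_compProd_iff h2.aestronglyMeasurable).1 h2).1
  filter_upwards [hac.ae_le (Measure.ae_ae_of_ae_compProd h1), hac.ae_le h3] with u hu1 hu2
  exact ⟨hu1, hu2⟩

lemma lognormalDensity_nonneg (H ν t : ℝ) {y₀ y : ℝ} (hy : 0 ≤ y) :
    0 ≤ lognormalDensity H ν y₀ t y := by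
  unfold lognormalDensity
  positivity

end Density

end FSABR

/-! ### Absolute continuity and the bridge representation -/

theorem theorem2p1 {Ω : Type*} {mΩ : MeasurableSpace Ω} (P : Measure Ω) [IsProbabilityMeasure P]
    (ℱ : Filtration ℝ≥0 mΩ) (B W BH : ℝ≥0 → Ω → ℝ)
    (hB : FSABR.IsFilteredBM ℱ P B) (hW : FSABR.IsFilteredBM ℱ P W)
    (hBW : IndepFun (fun ω t => B t ω) (fun ω t => W t ω) P)
    (H : ℝ) (hH : 0 < H ∧ H < 1) (hBH : FSABR.IsFBMGeneratedBy ℱ P H B BH)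
    (ν ρ x₀ y₀ : ℝ) (hν : ν ≠ 0) (hρ : -1 < ρ ∧ ρ < 1) (hy₀ : 0 < y₀)
    (X Y : ℝ≥0 → Ω → ℝ) (hXY : FSABR.IsLognormalFSABR ℱ P B W BH ν ρ x₀ y₀ X Y)
    (t : ℝ≥0) (ht : 0 < t) :
    AEMeasurable (fun ω => (X t ω, Y t ω)) P ∧
    P.map (fun ω => (X t ω, Y t ω)) ≪ (volume : Measure (ℝ × ℝ)) ∧
    ∀ p : ℝ × ℝ → ℝ, Measurable p → (∀ z, 0 ≤ p z) →
      P.map (fun ω => (X t ω, Y t ω)) =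
        (volume : Measure (ℝ × ℝ)).withDensity (fun z => ENNReal.ofReal (p z)) →
      ∀ᵐ z : ℝ × ℝ,
        (z.2 ≤ 0 → p z = 0) ∧
        (0 < z.2 →
          Integrable (fun ξ : ℝ => FSABR.bridgeCondExp ℱ P B BH ν ρ x₀ y₀ t z.1 z.2 ξ) ∧
          (p z : ℂ) = (FSABR.lognormalDensity H ν y₀ t z.2 : ℂ) *
            (1 / (2 * (Real.pi : ℂ)) *
              ∫ ξ : ℝ, FSABR.bridgeCondExp ℱ P B BH ν ρ x₀ y₀ t z.1 z.2 ξ)) := by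
  have hρ2 : 0 < 1 - ρ ^ 2 := by nlinarith [hρ.1, hρ.2]
  have hmap := hXY.map_eq hBH hB hW hBW hH hν hρ2 hy₀ t ht
  refine ⟨hXY.aemeasurable hBH hB hW hH t ht, ?_, fun p hp hp0 hpmap => ?_⟩
  · rw [hmap]
    exact withDensity_absolutelyContinuous _ _
  -- Densities with respect to Lebesgue measure are unique almost everywhere, so p may be replaced
  -- by `jointDensity`.
  have hae := (withDensity_eq_iff_of_sigmaFinite hp.ennreal_ofReal.aemeasurable
    (FSABR.measurable_jointDensity _ _ _ _ _ _ _).aemeasurable).1 (hpmap.symm.trans hmap)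
  -- The conditions on the conditional law hold for almost every u, hence at u = ln(y/y₀)/ν for
  -- almost every y > 0, hence for almost every (x, y) with y > 0.
  have hu := (Measure.quasiMeasurePreserving_snd (μ := (volume : Measure ℝ))).ae
    (FSABR.ae_log_div ν y₀ hν hy₀ (hBH.ae_condDistrib hB hH ν t ht))
  rw [← Measure.volume_eq_prod] at hu
  filter_upwards [hae, hu] with z hz huz
  constructor
  · intro hz2
    rw [FSABR.jointDensity, Set.indicator_of_notMem (by simpa using hz2),
      ENNReal.ofReal_eq_zero] at hz
    exact le_antisymm hz (hp0 z)
  · intro hz2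
    obtain ⟨hpos, hint⟩ := huz hz2
    obtain ⟨h1, h2, h3⟩ := FSABR.integral_integral_bridgeIntegrand hρ2 hy₀ _ hpos hint z.1 (x₀ := x₀)
    refine ⟨h1, ?_⟩
    rw [FSABR.jointDensity, Set.indicator_of_mem (Set.mem_Ioi.2 hz2), FSABR.bridgeDensity,
      ← ofReal_integral_eq_lintegral_ofReal h2
        (ae_of_all _ fun _ => FSABR.condPDFReal_nonneg _ _ _ _ _),
      ← ENNReal.ofReal_mul (integral_nonneg fun _ => FSABR.condPDFReal_nonneg _ _ _ _ _),
      ENNReal.ofReal_eq_ofReal_iff (hp0 z) (mul_nonneg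
        (integral_nonneg fun _ => FSABR.condPDFReal_nonneg _ _ _ _ _)
        (FSABR.lognormalDensity_nonneg H ν t hz2.le))] at hz
    rw [hz, Complex.ofReal_mul, h3, mul_comm]
    -- `bridgeCondExp` unfolds to the integral of `bridgeIntegrand` against the conditional law.
    rfl
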